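/- There is a universal constant $C>0$ with the following property. Let $d\ge 2$, $p\in[1,2]$, $1/p+1/q=1$ ($q\in[2,\infty]$), $M,M_2,\varepsilon>0$, $R\ge 0$, and put $\gamma=\varepsilon/(2M_2)$. There are parameters (a number of iterations $N\ge 0$, a batch size $B\ge 1$, weights $a_k>0$, $\beta>0$ and an exponent $r\in(1,2]$), which depend only on $d,p,q,M,M_2,R,\varepsilon$, such that the following holds. Let $Q\subseteq\mathbb{R}^d$ be closed and convex, $x^0\in Q$, and let $Q_\gamma$ be the set of the points at Euclidean distance at most $\gamma$ from $Q$. Let $f$ be convex on $Q_\gamma$ with $|f(y)-f(x)|\le M\|y-x\|_p$ and $|f(y)-f(x)|\le M_2\|y-x\|_2$ for all $x,y\in Q_\gamma$. Suppose that $f$ has a minimizer $x_*$ on $Q$ with $\|x^0-x_*\|_p\sqrt{\min\{q,\ln d\}}\le R$. Run the following batched accelerated stochastic gradient method for the smoothed problem $\min_{x\in Q} f_\gamma(x)$, $f_\gamma(x)=\mathbb{E}_u f(x+\gamma u)$ with $u$ uniform on the unit Euclidean ball. Let $A_k=\sum_{i<k}a_i$, $y_0=x^0$, $G_0=0$, let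 $z_k$ be the minimizer over $x\in Q$ of $\langle G_k,x\rangle+\frac{\beta}{2}\|x-x^0\|_r^2$, and for $k=0,\dots,N-1$ let $$x_{k+1}=\frac{A_ky_k+a_kz_k}{A_{k+1}},\quad g_{k+1}=\frac1B\sum_{j=1}^{B} d\,\frac{f(x_{k+1}+\gamma e_{k,j})-f(x_{k+1}-\gamma e_{k,j})}{2\gamma}\,e_{k,j},\quad G_{k+1}=G_k+a_kg_{k+1},\quad y_{k+1}=\frac{A_ky_k+a_kz_{k+1}}{A_{k+1}},$$ where the $e_{k,j}$ are independent and uniformly distributed on the unit Euclidean sphere. The method uses only values of $f$ (exact zeroth-order oracle), and the $2B$ oracle calls of one iteration can be made in parallel. Its output $y_N$ satisfies $\mathbb{E} f(y_N)-f(x_*)\le\varepsilon$ (the expectation exists). For every realization of the directions it makes at most $$C\,\frac{d^{1/4}\sqrt{MM_2}\,R}{\varepsilon}\ \text{ successive iterations and at most }\ C\,\frac{\min\{q,\ln d\}\,d^{2/q}M_2^2R^2}{\varepsilon^2}\ \text{ zeroth-order oracle calls.}$$ The latter number is also at most $C\,dM_2^2R^2/\varepsilon^2$ if $p=2$, and at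 most $C\,(\ln d)M_2^2R^2/\varepsilon^2$ if $p=1$. -/

import Mathlib

open MeasureTheory
open scoped ENNReal

noncomputable section

/-- The ambient space `ℝ^d` with its Euclidean structure. -/
abbrev Vec (d : ℕ) : Type := EuclideanSpace ℝ (Fin d)

/-- The unit Euclidean sphere of `ℝ^d`. -/
abbrev UnitSphere (d : ℕ) : Type := Metric.sphere (0 : Vec d) 1

/-- The norm `‖x‖_p` on `ℝ^d`, for `p ∈ [1, ∞]`. -/
def pNorm {d : ℕ} (p : ℝ≥0∞) (x : Vec d) : ℝ :=
  ‖WithLp.toLp p (WithLp.ofLp x)‖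

/-- The quantity `min {q, ln d}`; it equals `ln d` for `q = ∞`. -/
def minQLog (q : ℝ≥0∞) (d : ℕ) : ℝ :=
  (min q (ENNReal.ofReal (Real.log d))).toReal

/-- A deterministic method with access to an objective only through a zeroth-order oracle.
Either it stops with an output point, or it sends to the oracle a batch of `m` points,
all chosen before any of the answers is known (so that they may be processed in parallel),
and continues in a way that depends on the `m` returned function values. -/
inductive ZOMethod (d : ℕ) : Type
  | output (x : Vec d) : ZOMethod d
  | query (m : ℕ) (pts : Fin m → Vec d) (next : (Fin m → ℝ) → ZOMethod d) : ZOMethod d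

namespace ZOMethod

/-- The output point when the oracle returns the values of `f`. -/
def run {d : ℕ} (f : Vec d → ℝ) : ZOMethod d → Vec d
  | output x => x
  | query _ pts next => run f (next fun i => f (pts i))

/-- The number of successive iterations (rounds of parallel oracle calls). -/
def iterations {d : ℕ} (f : Vec d → ℝ) : ZOMethod d → ℕ
  | output _ => 0
  | query _ pts next => iterations f (next fun i => f (pts i)) + 1

/-- The total number of zeroth-order oracle calls. -/
def oracleCalls {d : ℕ} (f : Vec d → ℝ) : ZOMethod d → ℕ
  | output _ => 0
  | query m pts next => oracleCalls f (next fun i => f (pts i)) + m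

end ZOMethod

/-- The parameters of the batched accelerated gradient method. -/
structure AGMParams where
  /-- number of iterations -/
  N : ℕ
  /-- batch size -/
  B : ℕ
  /-- the weights `a_k` of the gradients -/
  a : ℕ → ℝ
  /-- weight of the prox-function -/
  β : ℝ
  /-- exponent of the prox-function `x ↦ ‖x - x⁰‖_r² / 2` -/
  r : ℝ≥0∞
  B_pos : 0 < B
  a_pos : ∀ k, 0 < a k
  β_pos : 0 < β
  one_lt_r : 1 < r
  r_le_two : r ≤ 2

namespace AGMParams

/-- `A_k = a_0 + ⋯ + a_{k-1}`. -/
def A (P : AGMParams) (k : ℕ) : ℝ := ∑ i ∈ Finset.range k, P.a i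

/-- The objective `⟨G, x⟩ + β ‖x - x⁰‖_r² / 2` of the prox-step. -/
def proxObjective {d : ℕ} (P : AGMParams) (x₀ G x : Vec d) : ℝ :=
  inner ℝ G x + P.β * (pNorm P.r (x - x₀) ^ 2 / 2)

open scoped Classical in
/-- The prox-step: the minimizer of `⟨G, x⟩ + β ‖x - x⁰‖_r² / 2` over `x ∈ Q`
(it exists and is unique for closed convex nonempty `Q`). -/
def prox {d : ℕ} (P : AGMParams) (Q : Set (Vec d)) (x₀ G : Vec d) : Vec d :=
  if h : ∃ z ∈ Q, IsMinOn (P.proxObjective x₀ G) Q z then h.choose else x₀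

/-- The convex combination `(A_k y + a_k z) / A_{k+1}`. -/
def combine {d : ℕ} (P : AGMParams) (k : ℕ) (y z : Vec d) : Vec d :=
  (P.A (k + 1))⁻¹ • (P.A k • y + P.a k • z)

end AGMParams

/-- The batch average over `j` of `d (v⁺_j - v⁻_j) / (2γ) • e_j`. For `v^±_j = f (x ± γ e_j)` this
is the average of the two-point estimators of the gradient at `x` of
`f_γ (x) = 𝔼_u f (x + γ u)`, `u` uniform on the unit Euclidean ball. -/
def batchGradient {d B : ℕ} (γ : ℝ) (e : Fin B → UnitSphere d) (vplus vminus : Fin B → ℝ) :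
    Vec d :=
  (B : ℝ)⁻¹ • ∑ j, ((d : ℝ) * ((vplus j - vminus j) / (2 * γ))) • (e j : Vec d)

/-- `n` further iterations of the batched accelerated gradient method on `Q`, applied to the smoothed
objective with smoothing parameter `γ`, when `k` iterations have been made, `y` is the current
approximate solution and `G` is the weighted sum of the gradient estimates found so far:
`z_k = prox G_k`, `x_{k+1} = (A_k y_k + a_k z_k) / A_{k+1}`,
`g_{k+1}` = the batch gradient estimate at `x_{k+1}`,
`G_{k+1} = G_k + a_k g_{k+1}`, `z_{k+1} = prox G_{k+1}`,
`y_{k+1} = (A_k y_k + a_k z_{k+1}) / A_{k+1}`. -/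
def fgmLoop {d : ℕ} (P : AGMParams) (γ : ℝ) (Q : Set (Vec d)) (x₀ : Vec d) :
    (n : ℕ) → (Fin n → Fin P.B → UnitSphere d) → (k : ℕ) → (y G : Vec d) → ZOMethod d
  | 0, _, _, y, _ => ZOMethod.output y
  | n + 1, e, k, y, G =>
    let x := P.combine k y (P.prox Q x₀ G)
    ZOMethod.query (P.B + P.B)
      (Fin.append (fun j => x + γ • (e 0 j : Vec d)) (fun j => x - γ • (e 0 j : Vec d)))
      fun v =>
        let g := batchGradient γ (e 0) (fun j => v (Fin.castAdd P.B j)) (fun j => v (Fin.natAdd P.B j))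
        let G' := G + P.a k • g
        fgmLoop P γ Q x₀ n (fun i => e i.succ) (k + 1) (P.combine k y (P.prox Q x₀ G')) G'

/-- The smoothing scheme based on the batched accelerated gradient method: `N` iterations from the
starting point `x₀`, where `e k j` is the `j`-th random direction of iteration `k`. -/
def fgm {d : ℕ} (P : AGMParams) (γ : ℝ) (Q : Set (Vec d)) (x₀ : Vec d)
    (e : Fin P.N → Fin P.B → UnitSphere d) : ZOMethod d :=
  fgmLoop P γ Q x₀ P.N e 0 x₀ 0

/-- The uniform probability measure on the unit Euclidean sphere (normalized surface measure). -/
def uniformSphere (d : ℕ) : Measure (UnitSphere d) :=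
  ((volume : Measure (Vec d)).toSphere Set.univ)⁻¹ • (volume : Measure (Vec d)).toSphere

/-- The law of `N × B` independent uniform directions. -/
def directionLaw (d N B : ℕ) : Measure (Fin N → Fin B → UnitSphere d) :=
  Measure.pi fun _ => Measure.pi fun _ => uniformSphere d

end

/-!
The smoothed function `f_γ` is convex, within `M₂ γ = ε / 2` of `f`, and by the divergence theorem
the two-point estimator `d (f (x + γ e) - f (x - γ e)) / (2γ) • e` is an unbiased estimator of its
gradient, which is Lipschitz with constant of order `√d M / γ`. Each coordinate of the estimator is
a product of two odd Lipschitz functions on the sphere, so Gaussian concentration (by the rotation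
argument of Maurey and Pisier, transferred to the sphere in polar coordinates) bounds its
exponential moments. Hence the average of `B ≥ ρ` estimators has variance of order
`ρ d^(2/ρ) M₂² / B` in the `ρ`-norm.

For the conjugate exponent `r ∈ (1, 2]` of `ρ`, the function `‖·‖_r² / 2` is `(r - 1)`-strongly
convex in the `r`-norm, and a potential argument for accelerated dual averaging bounds the expected
error by the sum of the prox-term `β ‖x⁰ - xs‖_r² / (2 A_N)`, the accumulated variance and the error
of smoothing. Taking `ρ ≈ min {q, ln d}` loses only constants in comparison with `q`.

Three choices of the parameters cover all cases. If `R` is small in comparison with `ε`, then the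
starting point is already accurate. Otherwise let `n` be the bound on the number of iterations and
`T = d^(2/q) M₂² R² / ε²` the bound on the number of calls without the factor `min {q, ln d}`. If
`n ≤ T`, then the weights grow linearly and the batches are large. If `T ≤ n`, then constant weights
and small batches suffice, and the method only exploits that `f_γ` is Lipschitz.
-/

section PNorm

variable {d : ℕ} {p r s : ℝ≥0∞}

theorem one_le_toReal_of_one_le (hp : 1 ≤ p) (hp' : p ≠ ⊤) : 1 ≤ p.toReal := by
  simpa only [ENNReal.toReal_one] using ENNReal.toReal_mono hp' hp

theorem pNorm_two (x : Vec d) : pNorm 2 x = ‖x‖ := rfl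

theorem pNorm_eq_sum (hp : 0 < p.toReal) (x : Vec d) :
    pNorm p x = (∑ i, |x i| ^ p.toReal) ^ (1 / p.toReal) :=
  PiLp.norm_eq_sum hp _

theorem pNorm_rpow (hp : 0 < p.toReal) (x : Vec d) :
    pNorm p x ^ p.toReal = ∑ i, |x i| ^ p.toReal := by
  rw [pNorm_eq_sum hp, ← Real.rpow_mul (Finset.sum_nonneg fun i _ => by positivity),
    one_div_mul_cancel hp.ne', Real.rpow_one]

theorem inner_le_pNorm_mul_pNorm (h : s.toReal.HolderConjugate r.toReal) (g x : Vec d) :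
    inner ℝ g x ≤ pNorm s g * pNorm r x := by
  rw [pNorm_eq_sum h.pos, pNorm_eq_sum h.symm.pos, PiLp.inner_apply]
  simpa only [RCLike.inner_apply, conj_trivial, mul_comm] using
    Real.inner_le_Lp_mul_Lq Finset.univ g.ofLp x.ofLp h

theorem pNorm_nonneg (hp : 1 ≤ p) (x : Vec d) : 0 ≤ pNorm p x := by
  have : Fact (1 ≤ p) := ⟨hp⟩
  exact norm_nonneg _

theorem pNorm_zero (hp : 1 ≤ p) : pNorm p (0 : Vec d) = 0 := by
  have : Fact (1 ≤ p) := ⟨hp⟩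
  exact norm_zero

theorem pNorm_add_le (hp : 1 ≤ p) (x y : Vec d) : pNorm p (x + y) ≤ pNorm p x + pNorm p y := by
  have : Fact (1 ≤ p) := ⟨hp⟩
  exact norm_add_le (WithLp.toLp p (WithLp.ofLp x)) (WithLp.toLp p (WithLp.ofLp y))

theorem pNorm_smul (hp : 1 ≤ p) (c : ℝ) (x : Vec d) : pNorm p (c • x) = |c| * pNorm p x := by
  have : Fact (1 ≤ p) := ⟨hp⟩
  exact norm_smul c (WithLp.toLp p (WithLp.ofLp x))

theorem pNorm_sub_comm (hp : 1 ≤ p) (x y : Vec d) : pNorm p (x - y) = pNorm p (y - x) := by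
  have : Fact (1 ≤ p) := ⟨hp⟩
  exact norm_sub_rev (WithLp.toLp p (WithLp.ofLp x)) (WithLp.toLp p (WithLp.ofLp y))

theorem pNorm_sub_le (hp : 1 ≤ p) (x y z : Vec d) :
    pNorm p (x - z) ≤ pNorm p (x - y) + pNorm p (y - z) := by
  rw [← sub_add_sub_cancel x y z]
  exact pNorm_add_le hp _ _

theorem continuous_pNorm (hp : 1 ≤ p) : Continuous (pNorm p : Vec d → ℝ) := by
  have : Fact (1 ≤ p) := ⟨hp⟩
  unfold pNorm
  fun_prop

theorem abs_apply_le_pNorm (hp : 1 ≤ p) (x : Vec d) (i : Fin d) : |x i| ≤ pNorm p x := by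
  have : Fact (1 ≤ p) := ⟨hp⟩
  exact PiLp.norm_apply_le (WithLp.toLp p (WithLp.ofLp x)) i

theorem pNorm_antitone (hp : 1 ≤ p) (hpr : p ≤ r) (hr : r ≠ ⊤) (x : Vec d) :
    pNorm r x ≤ pNorm p x := by
  have hp₁ := one_le_toReal_of_one_le hp (ne_top_of_le_ne_top hr hpr)
  have hpr' : p.toReal ≤ r.toReal := ENNReal.toReal_mono hr hpr
  have hx := pNorm_nonneg hp x
  set a := p.toReal
  set b := r.toReal
  have hsplit : ∀ {t : ℝ}, 0 ≤ t → t ^ b = t ^ a * t ^ (b - a) := fun ht => by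
    rw [← Real.rpow_add' ht (by linarith), add_sub_cancel]
  refine (Real.rpow_le_rpow_iff (pNorm_nonneg (hp.trans hpr) x) hx (by linarith : 0 < b)).1 ?_
  calc pNorm r x ^ b = ∑ i, |x i| ^ a * |x i| ^ (b - a) := by
        rw [pNorm_rpow (by linarith)]
        exact Finset.sum_congr rfl fun i _ => hsplit (abs_nonneg _)
    _ ≤ ∑ i, |x i| ^ a * pNorm p x ^ (b - a) := by
        gcongr with i
        exact abs_apply_le_pNorm hp x i
    _ = pNorm p x ^ b := by rw [← Finset.sum_mul, ← pNorm_rpow (by linarith), hsplit hx]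

theorem pNorm_le_card_rpow_mul (hp : 1 ≤ p) (hpr : p ≤ r) (hr : r ≠ ⊤) (x : Vec d) :
    pNorm p x ≤ (d : ℝ) ^ (1 / p.toReal - 1 / r.toReal) * pNorm r x := by
  have hp₁ := one_le_toReal_of_one_le hp (ne_top_of_le_ne_top hr hpr)
  have hpr' : p.toReal ≤ r.toReal := ENNReal.toReal_mono hr hpr
  have hx := pNorm_nonneg hp x
  have hx' := pNorm_nonneg (hp.trans hpr) x
  set a := p.toReal
  set b := r.toReal
  have ha : 0 < a := by linarith
  have hb : 0 < b := by linarith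
  have hpow : ∀ i, (|x i| ^ a) ^ (b / a) = |x i| ^ b := fun i => by
    rw [← Real.rpow_mul (abs_nonneg _), mul_div_cancel₀ _ ha.ne']
  have hmean := Real.rpow_sum_le_const_mul_sum_rpow_of_nonneg (s := Finset.univ)
    (f := fun i => |x i| ^ a) ((one_le_div ha).2 hpr') fun i _ => by positivity
  simp only [hpow, Finset.card_univ, Fintype.card_fin] at hmean
  rw [← pNorm_rpow ha, ← pNorm_rpow hb, ← Real.rpow_mul hx, mul_div_cancel₀ _ ha.ne'] at hmean
  refine (Real.rpow_le_rpow_iff hx (by positivity) hb).1 (hmean.trans_eq ?_)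
  rw [Real.mul_rpow (by positivity) hx', ← Real.rpow_mul d.cast_nonneg]
  congr 2
  field_simp

theorem mul_inner_le_pNorm_sq_add (hconj : s.toReal.HolderConjugate r.toReal)
    {a μ : ℝ} (ha : 0 ≤ a) (hμ : 0 < μ) (ξ w : Vec d) :
    a * inner ℝ ξ w ≤ μ / 2 * pNorm r w ^ 2 + a ^ 2 / (2 * μ) * pNorm s ξ ^ 2 := by
  have hyoung : μ / 2 * pNorm r w ^ 2 + a ^ 2 / (2 * μ) * pNorm s ξ ^ 2
      - a * (pNorm s ξ * pNorm r w) = (μ * pNorm r w - a * pNorm s ξ) ^ 2 / (2 * μ) := by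
    field_simp
    ring
  have hsq : 0 ≤ (μ * pNorm r w - a * pNorm s ξ) ^ 2 / (2 * μ) := by positivity
  linarith [mul_le_mul_of_nonneg_left (inner_le_pNorm_mul_pNorm hconj ξ w) ha]

end PNorm

section UniformConvexity

theorem sq_rpow_half {a : ℝ} (ha : 0 ≤ a) (r : ℝ) : (a ^ 2) ^ (r / 2) = a ^ r := by
  rw [← Real.rpow_two, ← Real.rpow_mul ha, mul_div_cancel₀ _ two_ne_zero]

theorem le_of_hasDerivAt_nonneg_Ioo {g g' : ℝ → ℝ} {a b x : ℝ} (hg : ContinuousOn g (Set.Icc a b))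
    (hg' : ∀ x ∈ Set.Ioo a b, HasDerivAt g (g' x) x) (h₀ : ∀ x ∈ Set.Ioo a b, 0 ≤ g' x)
    (hx : x ∈ Set.Icc a b) : g a ≤ g x := by
  rw [← interior_Icc] at hg' h₀
  exact monotoneOn_of_hasDerivWithinAt_nonneg (convex_Icc a b) hg
    (fun y hy => (hg' y hy).hasDerivWithinAt) h₀ (Set.left_mem_Icc.2 (hx.1.trans hx.2)) hx hx.1

theorem hasDerivAt_one_add_rpow {x : ℝ} (hx : 0 < 1 + x) (s : ℝ) :
    HasDerivAt (fun t : ℝ => (1 + t) ^ s) (s * (1 + x) ^ (s - 1)) x := by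
  simpa using ((hasDerivAt_id x).const_add 1).rpow_const (p := s) (Or.inl hx.ne')

theorem hasDerivAt_one_sub_rpow {x : ℝ} (hx : 0 < 1 - x) (s : ℝ) :
    HasDerivAt (fun t : ℝ => (1 - t) ^ s) (-(s * (1 - x) ^ (s - 1))) x := by
  simpa using ((hasDerivAt_id x).const_sub 1).rpow_const (p := s) (Or.inl hx.ne')

theorem two_mul_le_one_add_rpow_sub_one_sub_rpow {s t : ℝ} (hs : 0 ≤ s) (hs₁ : s ≤ 1)
    (ht : t ∈ Set.Icc (0 : ℝ) 1) : 2 * s * t ≤ (1 + t) ^ s - (1 - t) ^ s := by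
  have hcont : ContinuousOn (fun t : ℝ => (1 + t) ^ s - (1 - t) ^ s - 2 * s * t) (Set.Icc 0 1) := by
    have := Real.continuous_rpow_const hs
    fun_prop
  have hderiv : ∀ x ∈ Set.Ioo (0 : ℝ) 1,
      HasDerivAt (fun t : ℝ => (1 + t) ^ s - (1 - t) ^ s - 2 * s * t)
        (s * ((1 + x) ^ (s - 1) + (1 - x) ^ (s - 1) - 2)) x := fun x hx =>
    (((hasDerivAt_one_add_rpow (by linarith [hx.1]) s).sub
      (hasDerivAt_one_sub_rpow (by linarith [hx.2]) s)).sub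
      ((hasDerivAt_id x).const_mul (2 * s))).congr_deriv (by ring)
  have hnonneg : ∀ x ∈ Set.Ioo (0 : ℝ) 1,
      0 ≤ s * ((1 + x) ^ (s - 1) + (1 - x) ^ (s - 1) - 2) := by
    intro x hx
    have hu : 0 < 1 + x := by linarith [hx.1]
    have hv : 0 < 1 - x := by linarith [hx.2]
    have hprod : 1 ≤ (1 + x) ^ (s - 1) * (1 - x) ^ (s - 1) := by
      rw [← Real.mul_rpow hu.le hv.le]
      exact Real.one_le_rpow_of_pos_of_le_one_of_nonpos (by positivity)
        (by nlinarith [sq_nonneg x]) (by linarith)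
    have hsum : 2 ≤ (1 + x) ^ (s - 1) + (1 - x) ^ (s - 1) := by
      have hu' : 0 < (1 + x) ^ (s - 1) := by positivity
      have hv' : 0 < (1 - x) ^ (s - 1) := by positivity
      nlinarith [sq_nonneg ((1 + x) ^ (s - 1) - (1 - x) ^ (s - 1))]
    exact mul_nonneg hs (by linarith)
  have hzero := le_of_hasDerivAt_nonneg_Ioo hcont hderiv hnonneg ht
  simp only [add_zero, Real.one_rpow, sub_zero, sub_self, mul_zero] at hzero
  linarith

theorem two_add_mul_sq_le_rpow_add_rpow {r t : ℝ} (hr : 1 ≤ r) (hr₂ : r ≤ 2)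
    (ht : t ∈ Set.Icc (0 : ℝ) 1) :
    2 + r * (r - 1) * t ^ 2 ≤ (1 + t) ^ r + (1 - t) ^ r := by
  have hr₀ : 0 ≤ r := by linarith
  have hcont : ContinuousOn (fun t : ℝ => (1 + t) ^ r + (1 - t) ^ r - r * (r - 1) * t ^ 2)
      (Set.Icc 0 1) := by
    have := Real.continuous_rpow_const hr₀
    fun_prop
  have hderiv : ∀ x ∈ Set.Ioo (0 : ℝ) 1,
      HasDerivAt (fun t : ℝ => (1 + t) ^ r + (1 - t) ^ r - r * (r - 1) * t ^ 2)
        (r * ((1 + x) ^ (r - 1) - (1 - x) ^ (r - 1) - 2 * (r - 1) * x)) x := fun x hx =>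
    (((hasDerivAt_one_add_rpow (by linarith [hx.1]) r).add
      (hasDerivAt_one_sub_rpow (by linarith [hx.2]) r)).sub
      ((hasDerivAt_pow 2 x).const_mul (r * (r - 1)))).congr_deriv (by push_cast; ring)
  have hnonneg : ∀ x ∈ Set.Ioo (0 : ℝ) 1,
      0 ≤ r * ((1 + x) ^ (r - 1) - (1 - x) ^ (r - 1) - 2 * (r - 1) * x) := fun x hx =>
    mul_nonneg hr₀ (sub_nonneg.2 (two_mul_le_one_add_rpow_sub_one_sub_rpow (by linarith)
      (by linarith) ⟨hx.1.le, hx.2.le⟩))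
  have hzero := le_of_hasDerivAt_nonneg_Ioo hcont hderiv hnonneg ht
  simp only [add_zero, Real.one_rpow, sub_zero, ne_eq, OfNat.ofNat_ne_zero, not_false_eq_true,
    zero_pow, mul_zero] at hzero
  linarith

theorem one_add_mul_sq_rpow_half_le {r t : ℝ} (hr : 1 ≤ r) (hr₂ : r ≤ 2)
    (ht : t ∈ Set.Icc (0 : ℝ) 1) :
    (1 + (r - 1) * t ^ 2) ^ (r / 2) ≤ ((1 + t) ^ r + (1 - t) ^ r) / 2 := by
  have hbernoulli : (1 + (r - 1) * t ^ 2) ^ (r / 2) ≤ 1 + r / 2 * ((r - 1) * t ^ 2) :=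
    rpow_one_add_le_one_add_mul_self (by nlinarith [sq_nonneg t]) (by linarith) (by linarith)
  linarith [two_add_mul_sq_le_rpow_add_rpow hr hr₂ ht]

theorem sq_add_mul_sq_rpow_half_le_of_le {r x y : ℝ} (hr : 1 ≤ r) (hr₂ : r ≤ 2) (hy : 0 ≤ y)
    (hyx : y ≤ x) :
    (x ^ 2 + (r - 1) * y ^ 2) ^ (r / 2) ≤ (|x + y| ^ r + |x - y| ^ r) / 2 := by
  rcases (hy.trans hyx).eq_or_lt with rfl | hx
  · obtain rfl : y = 0 := le_antisymm hyx hy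
    simp [Real.zero_rpow (show r ≠ 0 by linarith), Real.zero_rpow (show r / 2 ≠ 0 by linarith)]
  obtain ⟨t, rfl⟩ : ∃ t, y = x * t := ⟨y / x, by field_simp⟩
  have ht : 0 ≤ t := nonneg_of_mul_nonneg_right hy hx
  have ht₁ : t ≤ 1 := le_of_mul_le_mul_left (hyx.trans_eq (mul_one x).symm) hx
  have : 0 ≤ r - 1 := by linarith
  calc (x ^ 2 + (r - 1) * (x * t) ^ 2) ^ (r / 2)
      = x ^ r * (1 + (r - 1) * t ^ 2) ^ (r / 2) := by
        rw [← sq_rpow_half hx.le, ← Real.mul_rpow (by positivity) (by positivity)]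
        ring_nf
    _ ≤ x ^ r * (((1 + t) ^ r + (1 - t) ^ r) / 2) := by
        gcongr
        exact one_add_mul_sq_rpow_half_le hr hr₂ ⟨ht, ht₁⟩
    _ = (|x + x * t| ^ r + |x - x * t| ^ r) / 2 := by
        rw [← mul_one_add, ← mul_one_sub, abs_mul, abs_mul, abs_of_pos hx,
          abs_of_nonneg (by linarith : 0 ≤ 1 + t), abs_of_nonneg (by linarith : 0 ≤ 1 - t),
          Real.mul_rpow hx.le (by linarith), Real.mul_rpow hx.le (by linarith)]
        ring

theorem abs_add_rpow_add_abs_sub_rpow (r x y : ℝ) :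
    |x + y| ^ r + |x - y| ^ r = |(|x| + |y|)| ^ r + |(|x| - |y|)| ^ r := by
  rcases abs_choice x with hx | hx <;> rcases abs_choice y with hy | hy <;> rw [hx, hy]
  · rw [sub_neg_eq_add, ← sub_eq_add_neg, add_comm]
  · rw [neg_add_eq_sub, abs_sub_comm, neg_sub_left, abs_neg, add_comm x, add_comm y]
    exact add_comm _ _
  · rw [← neg_add, abs_neg, neg_sub_neg, abs_sub_comm]

theorem sq_add_mul_sq_rpow_half_le {r : ℝ} (hr : 1 ≤ r) (hr₂ : r ≤ 2) (x y : ℝ) :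
    (x ^ 2 + (r - 1) * y ^ 2) ^ (r / 2) ≤ (|x + y| ^ r + |x - y| ^ r) / 2 := by
  rw [abs_add_rpow_add_abs_sub_rpow, ← sq_abs x, ← sq_abs y]
  rcases le_total |y| |x| with h | h
  · exact sq_add_mul_sq_rpow_half_le_of_le hr hr₂ (abs_nonneg y) h
  · rw [add_comm |x| |y|, abs_sub_comm |x| |y|]
    have hsq : |x| ^ 2 ≤ |y| ^ 2 := by gcongr
    have : 0 ≤ r - 1 := by linarith
    refine (Real.rpow_le_rpow (by positivity) ?_ (by linarith)).trans
      (sq_add_mul_sq_rpow_half_le_of_le hr hr₂ (abs_nonneg x) h)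
    nlinarith

/-- The ordinary Minkowski inequality in `ℓ_{1/s}`, applied to the vectors `(u i ^ s, v i ^ s)`. -/
theorem rpow_sum_add_rpow_sum_le {ι : Type*} (I : Finset ι) {s : ℝ} (hs : 0 < s) (hs₁ : s ≤ 1)
    {u v : ι → ℝ} (hu : ∀ i, 0 ≤ u i) (hv : ∀ i, 0 ≤ v i) :
    (∑ i ∈ I, u i ^ s) ^ (1 / s) + (∑ i ∈ I, v i ^ s) ^ (1 / s)
      ≤ (∑ i ∈ I, (u i + v i) ^ s) ^ (1 / s) := by
  set p := ENNReal.ofReal (1 / s)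
  have hp : p.toReal = 1 / s := ENNReal.toReal_ofReal (by positivity)
  have hp₀ : 0 < p.toReal := by rw [hp]; positivity
  have : Fact (1 ≤ p) := ⟨ENNReal.one_le_ofReal.2 ((one_le_div hs).2 hs₁)⟩
  have hroot : ∀ {t : ℝ}, 0 ≤ t → (t ^ s) ^ (1 / s) = t := fun ht => by
    rw [← Real.rpow_mul ht, mul_one_div_cancel hs.ne', Real.rpow_one]
  have hsum : ∀ {w : ι → ℝ}, (∀ i, 0 ≤ w i) → |∑ i ∈ I, w i ^ s| = ∑ i ∈ I, w i ^ s :=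
    fun hw => abs_of_nonneg (Finset.sum_nonneg fun i _ => Real.rpow_nonneg (hw i) s)
  have hmink := norm_sum_le I fun i => WithLp.toLp p ![u i ^ s, v i ^ s]
  simp only [PiLp.norm_eq_sum hp₀, Fin.sum_univ_two, WithLp.ofLp_sum, Finset.sum_apply,
    Matrix.cons_val_zero, Matrix.cons_val_one, Real.norm_eq_abs, hp, one_div_one_div,
    hsum hu, hsum hv, abs_of_nonneg (Real.rpow_nonneg (hu _) s),
    abs_of_nonneg (Real.rpow_nonneg (hv _) s), hroot (hu _), hroot (hv _)] at hmink
  have hnonneg : 0 ≤ (∑ i ∈ I, u i ^ s) ^ (1 / s) + (∑ i ∈ I, v i ^ s) ^ (1 / s) :=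
    add_nonneg (Real.rpow_nonneg (Finset.sum_nonneg fun i _ => Real.rpow_nonneg (hu i) s) _)
      (Real.rpow_nonneg (Finset.sum_nonneg fun i _ => Real.rpow_nonneg (hv i) s) _)
  simpa only [← Real.rpow_mul hnonneg, mul_one_div_cancel hs.ne', Real.rpow_one] using
    Real.rpow_le_rpow (Real.rpow_nonneg hnonneg s) hmink (by positivity : 0 ≤ 1 / s)

theorem sum_sq_rpow_half_rpow_eq_pNorm_sq {d : ℕ} {r : ℝ≥0∞} (hr : 0 < r.toReal) {c : ℝ}
    (hc : 0 ≤ c) (x : Vec d) :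
    (∑ i, (c * x i ^ 2) ^ (r.toReal / 2)) ^ (1 / (r.toReal / 2)) = c * pNorm r x ^ 2 := by
  have hterm : ∀ i, (c * x i ^ 2) ^ (r.toReal / 2) = c ^ (r.toReal / 2) * |x i| ^ r.toReal :=
    fun i => by rw [Real.mul_rpow hc (sq_nonneg _), ← sq_abs, sq_rpow_half (abs_nonneg _)]
  have hx : 0 ≤ pNorm r x := by
    rw [pNorm_eq_sum hr]
    positivity
  rw [Finset.sum_congr rfl fun i _ => hterm i, ← Finset.mul_sum, ← pNorm_rpow hr,
    ← sq_rpow_half hx, ← Real.mul_rpow hc (sq_nonneg _), ← Real.rpow_mul (by positivity),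
    mul_one_div_cancel (by positivity), Real.rpow_one]

/-- Due to Ball, Carlen and Lieb; the constant `r - 1` is sharp. -/
theorem pNorm_sq_add_mul_pNorm_sq_le {d : ℕ} {r : ℝ≥0∞} (hr : 1 ≤ r) (hr₂ : r ≤ 2) (x y : Vec d) :
    pNorm r x ^ 2 + (r.toReal - 1) * pNorm r y ^ 2
      ≤ (pNorm r (x + y) ^ 2 + pNorm r (x - y) ^ 2) / 2 := by
  have h₁ : 1 ≤ r.toReal := one_le_toReal_of_one_le hr (ne_top_of_le_ne_top (by simp) hr₂)
  have h₂ : r.toReal ≤ 2 := by simpa using ENNReal.toReal_mono (by simp) hr₂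
  have hadd := pNorm_nonneg hr (x + y)
  have hsub := pNorm_nonneg hr (x - y)
  have hc : 0 ≤ r.toReal - 1 := by linarith
  have hr₀ : 0 < r.toReal := by linarith
  calc pNorm r x ^ 2 + (r.toReal - 1) * pNorm r y ^ 2
      ≤ (∑ i, (x i ^ 2 + (r.toReal - 1) * y i ^ 2) ^ (r.toReal / 2)) ^ (1 / (r.toReal / 2)) := by
        have hmink := rpow_sum_add_rpow_sum_le Finset.univ (s := r.toReal / 2) (by linarith)
          (by linarith) (fun i => mul_nonneg zero_le_one (sq_nonneg (x i)))
          (fun i => mul_nonneg hc (sq_nonneg (y i)))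
        rw [sum_sq_rpow_half_rpow_eq_pNorm_sq hr₀ zero_le_one,
          sum_sq_rpow_half_rpow_eq_pNorm_sq hr₀ hc] at hmink
        simpa only [one_mul] using hmink
    _ ≤ (1 / 2 * pNorm r (x + y) ^ r.toReal + 1 / 2 * pNorm r (x - y) ^ r.toReal)
          ^ (1 / (r.toReal / 2)) := by
        rw [pNorm_rpow hr₀, pNorm_rpow hr₀, ← mul_add, ← Finset.sum_add_distrib, Finset.mul_sum]
        gcongr with i
        rw [PiLp.add_apply, PiLp.sub_apply]
        linarith [sq_add_mul_sq_rpow_half_le h₁ h₂ (x i) (y i)]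
    _ ≤ 1 / 2 * (pNorm r (x + y) ^ r.toReal) ^ (1 / (r.toReal / 2))
          + 1 / 2 * (pNorm r (x - y) ^ r.toReal) ^ (1 / (r.toReal / 2)) :=
        (convexOn_rpow ((one_le_div (by positivity)).2 (by linarith))).2
          (Set.mem_Ici.2 (by positivity)) (Set.mem_Ici.2 (by positivity)) (by norm_num)
          (by norm_num) (by norm_num)
    _ = (pNorm r (x + y) ^ 2 + pNorm r (x - y) ^ 2) / 2 := by
        have hsq : r.toReal * (1 / (r.toReal / 2)) = 2 := by field_simp
        rw [← Real.rpow_mul hadd, ← Real.rpow_mul hsub, hsq, Real.rpow_two, Real.rpow_two]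
        ring

end UniformConvexity

namespace AGMParams

variable {d : ℕ} (P : AGMParams) {Q : Set (Vec d)} {x₀ : Vec d}

theorem r_ne_top : P.r ≠ ⊤ := ne_top_of_le_ne_top (by simp) P.r_le_two

theorem one_lt_toReal_r : 1 < P.r.toReal := by
  rw [← ENNReal.toReal_one]
  exact (ENNReal.toReal_lt_toReal (by simp) P.r_ne_top).2 P.one_lt_r

/-- A modulus of quadratic growth, with respect to `‖·‖_r`, of the objective of the prox-step around
its minimizer. The objective is `β (r - 1)`-strongly convex; comparing the minimizer with midpoints
only gives half of the optimal modulus `β (r - 1) / 2`. -/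
noncomputable def growth : ℝ := P.β * (P.r.toReal - 1) / 4

theorem growth_pos : 0 < P.growth :=
  div_pos (mul_pos P.β_pos (sub_pos.2 P.one_lt_toReal_r)) four_pos

theorem norm_le_pNorm_r (x : Vec d) : ‖x‖ ≤ pNorm P.r x := by
  rw [← pNorm_two]
  exact pNorm_antitone P.one_lt_r.le P.r_le_two (by simp) x

theorem proxObjective_midpoint_le (x₀ G w z : Vec d) :
    P.proxObjective x₀ G ((1 / 2 : ℝ) • w + (1 / 2 : ℝ) • z)
      ≤ (P.proxObjective x₀ G w + P.proxObjective x₀ G z) / 2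
        - P.growth / 2 * pNorm P.r (w - z) ^ 2 := by
  have hconvex := pNorm_sq_add_mul_pNorm_sq_le P.one_lt_r.le P.r_le_two
    ((1 / 2 : ℝ) • w + (1 / 2 : ℝ) • z - x₀) ((1 / 2 : ℝ) • (w - z))
  have hadd : (1 / 2 : ℝ) • w + (1 / 2 : ℝ) • z - x₀ + (1 / 2 : ℝ) • (w - z) = w - x₀ := by module
  have hsub : (1 / 2 : ℝ) • w + (1 / 2 : ℝ) • z - x₀ - (1 / 2 : ℝ) • (w - z) = z - x₀ := by module
  rw [hadd, hsub, pNorm_smul P.one_lt_r.le, abs_of_nonneg (by norm_num)] at hconvex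
  unfold proxObjective growth
  rw [inner_add_right, inner_smul_right, inner_smul_right]
  linarith [mul_le_mul_of_nonneg_left hconvex P.β_pos.le]

theorem proxObjective_add_le_of_isMinOn (hQ : Convex ℝ Q) {G z w : Vec d} (hz : z ∈ Q)
    (hmin : IsMinOn (P.proxObjective x₀ G) Q z) (hw : w ∈ Q) :
    P.proxObjective x₀ G z + P.growth * pNorm P.r (w - z) ^ 2 ≤ P.proxObjective x₀ G w := by
  have hmem : (1 / 2 : ℝ) • w + (1 / 2 : ℝ) • z ∈ Q :=
    hQ hw hz (by norm_num) (by norm_num) (by norm_num)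
  linarith [isMinOn_iff.1 hmin _ hmem, P.proxObjective_midpoint_le x₀ G w z]

theorem continuous_proxObjective (x₀ G : Vec d) : Continuous (P.proxObjective x₀ G) := by
  unfold proxObjective
  have := continuous_pNorm (d := d) P.one_lt_r.le
  fun_prop

theorem proxObjective_self_le (G : Vec d) {w : Vec d} (hw : 2 * ‖G‖ / P.β ≤ ‖w - x₀‖) :
    P.proxObjective x₀ G x₀ ≤ P.proxObjective x₀ G w := by
  have hβ := P.β_pos
  have hsq : ‖w - x₀‖ ^ 2 ≤ pNorm P.r (w - x₀) ^ 2 := by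
    gcongr
    exact P.norm_le_pNorm_r _
  have hinner : -(‖G‖ * ‖w - x₀‖) ≤ inner ℝ G (w - x₀) :=
    (abs_le.1 (abs_real_inner_le_norm _ _)).1
  have hlarge : ‖G‖ * ‖w - x₀‖ ≤ P.β * (‖w - x₀‖ ^ 2 / 2) := by
    rw [div_le_iff₀ hβ] at hw
    nlinarith [norm_nonneg (w - x₀)]
  rw [inner_sub_right] at hinner
  rw [proxObjective, proxObjective, sub_self, pNorm_zero P.one_lt_r.le]
  linarith [mul_le_mul_of_nonneg_left hsq hβ.le]

theorem exists_isMinOn_proxObjective (hQ : IsClosed Q) (hx₀ : x₀ ∈ Q) (G : Vec d) :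
    ∃ z ∈ Q, IsMinOn (P.proxObjective x₀ G) Q z := by
  refine (P.continuous_proxObjective x₀ G).continuousOn.exists_isMinOn' hQ hx₀ ?_
  filter_upwards [Filter.mem_inf_of_left
    (isCompact_closedBall x₀ (2 * ‖G‖ / P.β)).compl_mem_cocompact] with w hw
  rw [Set.mem_compl_iff, Metric.mem_closedBall, not_le, dist_eq_norm] at hw
  exact P.proxObjective_self_le G hw.le

theorem prox_mem (hQ : IsClosed Q) (hx₀ : x₀ ∈ Q) (G : Vec d) : P.prox Q x₀ G ∈ Q := by
  have h := P.exists_isMinOn_proxObjective hQ hx₀ G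
  rw [prox, dif_pos h]
  exact h.choose_spec.1

theorem isMinOn_prox (hQ : IsClosed Q) (hx₀ : x₀ ∈ Q) (G : Vec d) :
    IsMinOn (P.proxObjective x₀ G) Q (P.prox Q x₀ G) := by
  have h := P.exists_isMinOn_proxObjective hQ hx₀ G
  rw [prox, dif_pos h]
  exact h.choose_spec.2

theorem proxObjective_prox_add_le (hQ : IsClosed Q) (hQc : Convex ℝ Q) (hx₀ : x₀ ∈ Q) (G : Vec d)
    {w : Vec d} (hw : w ∈ Q) :
    P.proxObjective x₀ G (P.prox Q x₀ G) + P.growth * pNorm P.r (w - P.prox Q x₀ G) ^ 2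
      ≤ P.proxObjective x₀ G w :=
  P.proxObjective_add_le_of_isMinOn hQc (P.prox_mem hQ hx₀ G) (P.isMinOn_prox hQ hx₀ G) hw

theorem norm_prox_sub_prox_le (hQ : IsClosed Q) (hQc : Convex ℝ Q) (hx₀ : x₀ ∈ Q) (G G' : Vec d) :
    2 * P.growth * ‖P.prox Q x₀ G - P.prox Q x₀ G'‖ ≤ ‖G - G'‖ := by
  have hG := P.proxObjective_prox_add_le hQ hQc hx₀ G (P.prox_mem hQ hx₀ G')
  have hG' := P.proxObjective_prox_add_le hQ hQc hx₀ G' (P.prox_mem hQ hx₀ G)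
  rw [pNorm_sub_comm P.one_lt_r.le] at hG
  set z := P.prox Q x₀ G
  set z' := P.prox Q x₀ G'
  have hgrowth : P.growth * ‖z - z'‖ ^ 2 ≤ P.growth * pNorm P.r (z - z') ^ 2 := by
    have := P.growth_pos
    gcongr
    exact P.norm_le_pNorm_r _
  have hinner := real_inner_le_norm (G - G') (z' - z)
  rw [norm_sub_rev z' z, inner_sub_left, inner_sub_right, inner_sub_right] at hinner
  unfold proxObjective at hG hG'
  rcases (norm_nonneg (z - z')).eq_or_lt with hz | hz
  · rw [← hz, mul_zero]
    exact norm_nonneg _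
  · refine le_of_mul_le_mul_right ?_ hz
    linarith

theorem continuous_prox (hQ : IsClosed Q) (hQc : Convex ℝ Q) (hx₀ : x₀ ∈ Q) :
    Continuous (P.prox Q x₀) := by
  have hgrowth : 0 < 2 * P.growth := mul_pos two_pos P.growth_pos
  refine (LipschitzWith.of_dist_le_mul (K := Real.toNNReal (2 * P.growth)⁻¹)
    fun G G' => ?_).continuous
  rw [Real.coe_toNNReal _ (by positivity), dist_eq_norm, dist_eq_norm, inv_mul_eq_div,
    le_div_iff₀' hgrowth]
  exact P.norm_prox_sub_prox_le hQ hQc hx₀ G G'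

end AGMParams

section Polar

variable {d : ℕ}

theorem integral_uniformSphere (φ : UnitSphere d → ℝ) :
    ∫ e, φ e ∂uniformSphere d = ((volume : Measure (Vec d)).toSphere.real Set.univ)⁻¹ *
      ∫ e, φ e ∂(volume : Measure (Vec d)).toSphere := by
  rw [uniformSphere, integral_smul_measure, smul_eq_mul, ENNReal.toReal_inv]
  rfl

variable [NeZero d]

theorem toSphere_real_univ_pos :
    0 < (volume : Measure (Vec d)).toSphere.real Set.univ := by
  rw [Measure.toSphere_real_apply_univ]
  have hball : 0 < (volume : Measure (Vec d)).real (Metric.ball 0 1) :=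
    ENNReal.toReal_pos (Metric.measure_ball_pos _ _ one_pos).ne' measure_ball_lt_top.ne
  have : 0 < Module.finrank ℝ (Vec d) := Module.finrank_pos
  positivity

instance : IsProbabilityMeasure (uniformSphere d) := by
  refine ⟨?_⟩
  rw [uniformSphere, Measure.smul_apply, smul_eq_mul]
  refine ENNReal.inv_mul_cancel (fun h => ?_) (measure_ne_top _ _)
  exact (toSphere_real_univ_pos (d := d)).ne' (by rw [Measure.real, h, ENNReal.toReal_zero])

theorem integral_polar (φ : Vec d → ℝ) (k : ℝ → ℝ) :
    ∫ x : Vec d, φ (‖x‖⁻¹ • x) * k ‖x‖ =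
      (∫ e : UnitSphere d, φ e ∂(volume : Measure (Vec d)).toSphere) *
        ∫ r : Set.Ioi (0 : ℝ), k r ∂(Measure.volumeIoiPow (Module.finrank ℝ (Vec d) - 1)) := by
  calc ∫ x : Vec d, φ (‖x‖⁻¹ • x) * k ‖x‖
      = ∫ x : ({(0 : Vec d)}ᶜ : Set (Vec d)), φ (‖x.1‖⁻¹ • x.1) * k ‖x.1‖
          ∂((volume : Measure (Vec d)).comap (↑)) := by
        rw [integral_subtype_comap (measurableSet_singleton _).compl
          fun x : Vec d => φ (‖x‖⁻¹ • x) * k ‖x‖, restrict_compl_singleton]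
    _ = ∫ z : UnitSphere d × Set.Ioi (0 : ℝ), φ z.1 * k z.2
          ∂((volume : Measure (Vec d)).toSphere.prod
            (Measure.volumeIoiPow (Module.finrank ℝ (Vec d) - 1))) := by
        simpa using
          (volume : Measure (Vec d)).measurePreserving_homeomorphUnitSphereProd.integral_comp
          (Homeomorph.measurableEmbedding _)
          (fun z : UnitSphere d × Set.Ioi (0 : ℝ) => φ z.1 * k z.2)
    _ = _ := integral_prod_mul (fun e : UnitSphere d => φ e) (fun r : Set.Ioi (0 : ℝ) => k r)

/-- The direction `x / ‖x‖` is uniformly distributed and independent of `‖x‖` under every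
rotation invariant density. -/
theorem integral_direction_mul_norm (φ : Vec d → ℝ) (k : ℝ → ℝ) :
    ∫ x : Vec d, φ (‖x‖⁻¹ • x) * k ‖x‖ =
      (∫ e : UnitSphere d, φ e ∂uniformSphere d) * ∫ x : Vec d, k ‖x‖ := by
  have hnorm := integral_polar (d := d) (fun _ => 1) k
  simp only [one_mul, integral_const, smul_eq_mul, mul_one] at hnorm
  rw [integral_polar, hnorm, integral_uniformSphere]
  have := (toSphere_real_univ_pos (d := d)).ne'
  field_simp

end Polar

section Divergence

section Calculus

theorem lineDeriv_le_sub_of_convexOn {E : Type*} [AddCommGroup E] [Module ℝ E] {F : E → ℝ}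
    (hF : ConvexOn ℝ Set.univ F) {u v : E} (h : LineDifferentiableAt ℝ F u v) :
    lineDeriv ℝ F u v ≤ F (u + v) - F u := by
  have hline : ConvexOn ℝ Set.univ fun t : ℝ => F (u + t • v) := by
    simpa [Function.comp_def, AffineMap.lineMap_apply, add_comm] using
      hF.comp_affineMap (AffineMap.lineMap u (u + v))
  have := hline.le_slope_of_hasDerivAt (Set.mem_univ 0) (Set.mem_univ 1) one_pos h.hasLineDerivAt
  simpa [slope_def_field] using this

theorem hasFDerivAt_norm_of_ne_zero {E : Type*} [NormedAddCommGroup E] [InnerProductSpace ℝ E]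
    {x : E} (hx : x ≠ 0) : HasFDerivAt (fun y : E => ‖y‖) (‖x‖⁻¹ • innerSL ℝ x) x := by
  have h := (hasStrictFDerivAt_norm_sq x).hasFDerivAt.sqrt (by simpa using hx)
  simp only [Real.sqrt_sq (norm_nonneg _)] at h
  refine h.congr_fderiv ?_
  ext w
  simp only [_root_.smul_apply, innerSL_apply_apply, smul_eq_mul, nsmul_eq_mul, one_div, mul_inv]
  push_cast
  ring

theorem norm_inv_norm_smul_le_one {E : Type*} [NormedAddCommGroup E] [NormedSpace ℝ E] (x : E) :
    ‖‖x‖⁻¹ • x‖ ≤ 1 := by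
  rw [norm_smul, norm_inv, norm_norm]
  exact inv_mul_le_one

theorem abs_inner_inv_norm_smul_le {E : Type*} [NormedAddCommGroup E] [InnerProductSpace ℝ E]
    (x v : E) : |inner ℝ (‖x‖⁻¹ • x) v| ≤ ‖v‖ :=
  (abs_real_inner_le_norm _ _).trans
    (mul_le_of_le_one_left (norm_nonneg v) (norm_inv_norm_smul_le_one x))

theorem abs_apply_add_sub_le {E : Type*} [SeminormedAddCommGroup E] {F : E → ℝ} {K : NNReal}
    (hK : LipschitzWith K F) (u v : E) : |F (u + v) - F u| ≤ K * ‖v‖ := by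
  simpa [Real.dist_eq, dist_eq_norm] using hK.dist_le_mul (u + v) u

end Calculus

variable {d : ℕ}

/-- The radial cutoff of the unit ball: `1` for `‖x‖ ≤ 1 - δ`, `0` for `‖x‖ ≥ 1`, and linear in
`‖x‖` in between. Its gradient turns an integral over the ball into one over the outer shell. -/
noncomputable def radialCutoff (d : ℕ) (δ : ℝ) (x : Vec d) : ℝ := max 0 (min 1 ((1 - ‖x‖) / δ))

variable {δ : ℝ}

theorem radialCutoff_nonneg (x : Vec d) : 0 ≤ radialCutoff d δ x := le_max_left _ _

theorem radialCutoff_le_one (x : Vec d) : radialCutoff d δ x ≤ 1 :=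
  max_le zero_le_one (min_le_left _ _)

theorem radialCutoff_eq_one (hδ : 0 < δ) {x : Vec d} (hx : ‖x‖ ≤ 1 - δ) :
    radialCutoff d δ x = 1 := by
  have : 1 ≤ (1 - ‖x‖) / δ := by rw [le_div_iff₀ hδ]; linarith
  rw [radialCutoff, min_eq_left this, max_eq_right zero_le_one]

theorem radialCutoff_eq_zero (hδ : 0 < δ) {x : Vec d} (hx : 1 ≤ ‖x‖) :
    radialCutoff d δ x = 0 :=
  max_eq_left <| (min_le_right _ _).trans <|
    div_nonpos_of_nonpos_of_nonneg (by linarith) hδ.le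

theorem radialCutoff_eq_div (hδ : 0 < δ) {x : Vec d} (hδx : 1 - δ ≤ ‖x‖) (hx : ‖x‖ ≤ 1) :
    radialCutoff d δ x = (1 - ‖x‖) / δ := by
  have : (1 - ‖x‖) / δ ≤ 1 := by rw [div_le_one hδ]; linarith
  rw [radialCutoff, min_eq_right this, max_eq_right (div_nonneg (by linarith) hδ.le)]

theorem lipschitzWith_radialCutoff (hδ : 0 < δ) :
    LipschitzWith (Real.toNNReal (1 / δ)) (radialCutoff d δ) := by
  have h : LipschitzWith (Real.toNNReal (1 / δ)) (fun x : Vec d => (1 - ‖x‖) / δ) := by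
    refine LipschitzWith.of_dist_le_mul fun x y => ?_
    rw [Real.coe_toNNReal _ (by positivity), Real.dist_eq, dist_eq_norm, ← sub_div, abs_div,
      abs_of_pos hδ, div_eq_mul_one_div, mul_comm]
    gcongr
    rw [sub_sub_sub_cancel_left, norm_sub_rev]
    exact abs_norm_sub_norm_le y x
  exact (h.const_min 1).const_max 0

theorem hasCompactSupport_radialCutoff (hδ : 0 < δ) : HasCompactSupport (radialCutoff d δ) := by
  refine HasCompactSupport.intro (isCompact_closedBall (0 : Vec d) 1) fun x hx => ?_
  rw [Metric.mem_closedBall, dist_zero_right, not_le] at hx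
  exact radialCutoff_eq_zero hδ hx.le

/-- The shell `1 - δ < ‖x‖ < 1`, where the radial cutoff is not locally constant. -/
def shell (d : ℕ) (δ : ℝ) : Set (Vec d) := {x | 1 - δ < ‖x‖ ∧ ‖x‖ < 1}

theorem measurableSet_shell : MeasurableSet (shell d δ) := by
  unfold shell
  measurability

theorem shell_subset_ball : shell d δ ⊆ Metric.ball 0 1 := fun x hx => by simpa using hx.2

theorem volume_shell_ne_top : volume (shell d δ) ≠ ⊤ :=
  (measure_mono shell_subset_ball |>.trans_lt measure_ball_lt_top).ne

theorem volume_real_shell (hδ : 0 < δ) (hδ₁ : δ < 1) :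
    (volume : Measure (Vec d)).real (shell d δ)
      = (1 - (1 - δ) ^ d) * (volume : Measure (Vec d)).real (Metric.ball 0 1) := by
  have hshell : shell d δ = Metric.ball 0 1 \ Metric.closedBall 0 (1 - δ) := by
    ext x
    simp [shell, and_comm]
  have hsub : Metric.closedBall (0 : Vec d) (1 - δ) ⊆ Metric.ball 0 1 :=
    Metric.closedBall_subset_ball (by linarith)
  rw [hshell, measureReal_sdiff hsub measurableSet_closedBall measure_ball_lt_top.ne]
  have : (volume : Measure (Vec d)).real (Metric.closedBall 0 (1 - δ))
      = (1 - δ) ^ d * (volume : Measure (Vec d)).real (Metric.ball 0 1) := by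
    rw [Measure.real, Measure.addHaar_closedBall _ _ (by linarith), ENNReal.toReal_mul,
      ENNReal.toReal_ofReal (pow_nonneg (by linarith) _), finrank_euclideanSpace_fin]
    rfl
  rw [this]
  ring

theorem lineDeriv_radialCutoff_of_mem_shell {x : Vec d} (hδ₁ : δ < 1) (hx : x ∈ shell d δ)
    (v : Vec d) : lineDeriv ℝ (radialCutoff d δ) x (-v) = δ⁻¹ * inner ℝ (‖x‖⁻¹ • x) v := by
  have hδ : 0 < δ := by linarith [hx.1, hx.2]
  have hlocal : radialCutoff d δ =ᶠ[nhds x] fun y => (1 - ‖y‖) / δ := by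
    filter_upwards [continuous_norm.continuousAt.eventually (gt_mem_nhds hx.2),
      continuous_norm.continuousAt.eventually (lt_mem_nhds hx.1)] with y hy hδy
    exact radialCutoff_eq_div hδ hδy.le hy.le
  have hx₀ : x ≠ 0 := norm_pos_iff.1 (by linarith [hx.1])
  have hderiv : HasFDerivAt (radialCutoff d δ) (δ⁻¹ • -(‖x‖⁻¹ • innerSL ℝ x)) x := by
    refine HasFDerivAt.congr_of_eventuallyEq ?_ hlocal
    simpa [div_eq_inv_mul] using ((hasFDerivAt_norm_of_ne_zero hx₀).const_sub 1).const_mul δ⁻¹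
  rw [(hderiv.hasLineDerivAt (-v)).lineDeriv]
  simp [inner_smul_left]

theorem lineDeriv_radialCutoff_of_notMem_shell {x : Vec d} (hδ : 0 < δ) (hx : ‖x‖ ≠ 1)
    (hδx : ‖x‖ ≠ 1 - δ) (hshell : x ∉ shell d δ) (v : Vec d) :
    lineDeriv ℝ (radialCutoff d δ) x v = 0 := by
  suffices h : ∃ c, radialCutoff d δ =ᶠ[nhds x] fun _ => c by
    obtain ⟨c, hc⟩ := h
    have := (hasFDerivAt_const (𝕜 := ℝ) c x).congr_of_eventuallyEq hc
    rw [(this.hasLineDerivAt v).lineDeriv, _root_.zero_apply]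
  rcases lt_or_gt_of_ne hx with hx | hx
  · have hδx : ‖x‖ < 1 - δ := (le_of_not_gt fun h => hshell ⟨h, hx⟩).lt_of_ne hδx
    refine ⟨1, ?_⟩
    filter_upwards [continuous_norm.continuousAt.eventually (gt_mem_nhds hδx)] with y hy
    exact radialCutoff_eq_one hδ hy.le
  · refine ⟨0, ?_⟩
    filter_upwards [continuous_norm.continuousAt.eventually (lt_mem_nhds hx)] with y hy
    exact radialCutoff_eq_zero hδ hy.le

theorem integral_sub_mul_radialCutoff_le {F : Vec d → ℝ} {K : NNReal} (hK : LipschitzWith K F)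
    (hδ : 0 < δ) (v : Vec d) :
    ∫ u, (F (u + v) - F u) * radialCutoff d δ u
      ≤ (∫ u in Metric.ball (0 : Vec d) 1, (F (u + v) - F u))
        + volume.real (shell d δ) * (K * ‖v‖) := by
  have hF := hK.continuous
  have hχ := (lipschitzWith_radialCutoff (d := d) hδ).continuous
  have hball : Integrable ((Metric.ball 0 1).indicator fun u : Vec d => F (u + v) - F u) := by
    refine (integrable_indicator_iff measurableSet_ball).2 ?_
    exact (Continuous.continuousOn (by fun_prop)).integrableOn_compact (isCompact_closedBall _ _)
      |>.mono_set Metric.ball_subset_closedBall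
  have hshell : Integrable ((shell d δ).indicator fun _ : Vec d => K * ‖v‖) :=
    (integrable_indicator_iff measurableSet_shell).2 (integrableOn_const volume_shell_ne_top)
  rw [← smul_eq_mul (volume.real _), ← setIntegral_const, ← integral_indicator measurableSet_shell,
    ← integral_indicator measurableSet_ball, ← integral_add hball hshell]
  refine integral_mono ((Continuous.mul (by fun_prop) hχ).integrable_of_hasCompactSupport
    (hasCompactSupport_radialCutoff hδ).mul_left) (hball.add hshell) fun u => ?_
  rcases le_or_gt 1 ‖u‖ with hu | hu
  · simp [radialCutoff_eq_zero hδ hu, shell, hu]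
  rcases le_or_gt ‖u‖ (1 - δ) with hδu | hδu
  · simp [radialCutoff_eq_one hδ hδu, shell, hu, hδu]
  · have hincr := abs_le.1 (abs_apply_add_sub_le hK u v)
    have hχ₀ := radialCutoff_nonneg (δ := δ) u
    have hχ₁ := radialCutoff_le_one (δ := δ) u
    rw [Set.indicator_of_mem (by simpa using hu),
      Set.indicator_of_mem (show u ∈ shell d δ from ⟨hδu, hu⟩)]
    nlinarith

theorem integrableOn_shell_inner_direction_mul {g : Vec d → ℝ} (hg : Measurable g) {C : ℝ}
    (hC : ∀ u ∈ shell d δ, |g u| ≤ C) (v : Vec d) :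
    IntegrableOn (fun u : Vec d => inner ℝ (‖u‖⁻¹ • u) v * g u) (shell d δ) := by
  refine Measure.integrableOn_of_bounded (M := ‖v‖ * C) volume_shell_ne_top
    (Measurable.aestronglyMeasurable (by fun_prop)) ?_
  refine (ae_restrict_iff' measurableSet_shell).2 (.of_forall fun u hu => ?_)
  rw [norm_mul]
  exact mul_le_mul (abs_inner_inv_norm_smul_le u v) (hC u hu) (abs_nonneg _) (norm_nonneg _)

theorem abs_apply_direction_sub_le_of_mem_shell {F : Vec d → ℝ} {K : NNReal}
    (hK : LipschitzWith K F) (hδ₁ : δ < 1) {u : Vec d} (hu : u ∈ shell d δ) :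
    |F (‖u‖⁻¹ • u) - F u| ≤ K * δ := by
  have hu₀ : 0 < ‖u‖ := by linarith [hu.1]
  have hdist : ‖‖u‖⁻¹ • u - u‖ = 1 - ‖u‖ := by
    have : ‖u‖⁻¹ • u - u = (1 - ‖u‖) • (‖u‖⁻¹ • u) := by
      rw [sub_smul, one_smul, smul_smul, mul_inv_cancel₀ hu₀.ne', one_smul]
    rw [this, norm_smul, norm_smul, norm_inv, norm_norm, inv_mul_cancel₀ hu₀.ne', mul_one,
      Real.norm_eq_abs, abs_of_nonneg (by linarith [hu.2])]
  calc |F (‖u‖⁻¹ • u) - F u| ≤ K * ‖‖u‖⁻¹ • u - u‖ := by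
        simpa [Real.dist_eq, dist_eq_norm] using hK.dist_le_mul (‖u‖⁻¹ • u) u
    _ ≤ K * δ := by rw [hdist]; exact mul_le_mul_of_nonneg_left (by linarith [hu.1]) K.2

theorem tendsto_volume_real_shell :
    Filter.Tendsto (fun δ => (volume : Measure (Vec d)).real (shell d δ))
      (nhdsWithin 0 (Set.Ioi 0)) (nhds 0) := by
  have hcont : Continuous fun δ : ℝ =>
      (1 - (1 - δ) ^ d) * (volume : Measure (Vec d)).real (Metric.ball 0 1) := by fun_prop
  have := (hcont.tendsto 0).mono_left (nhdsWithin_le_nhds (s := Set.Ioi 0))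
  simp only [sub_zero, one_pow, sub_self, zero_mul] at this
  refine this.congr' ?_
  filter_upwards [Ioo_mem_nhdsGT one_pos] with δ hδ
  rw [volume_real_shell hδ.1 hδ.2]

theorem tendsto_inv_mul_volume_real_shell :
    Filter.Tendsto (fun δ => δ⁻¹ * (volume : Measure (Vec d)).real (shell d δ))
      (nhdsWithin 0 (Set.Ioi 0))
      (nhds (d * (volume : Measure (Vec d)).real (Metric.ball 0 1))) := by
  have hderiv : HasDerivAt (fun δ : ℝ => 1 - (1 - δ) ^ d) d 0 := by
    simpa using (((hasDerivAt_id (0 : ℝ)).const_sub 1).pow d).const_sub 1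
  refine (hderiv.tendsto_slope_zero_right.mul_const _).congr' ?_
  filter_upwards [Ioo_mem_nhdsGT one_pos] with δ hδ
  rw [volume_real_shell hδ.1 hδ.2]
  simp
  ring

variable [NeZero d]

theorem lineDeriv_radialCutoff_ae (hδ : 0 < δ) (hδ₁ : δ < 1) (v : Vec d) :
    ∀ᵐ x : Vec d, lineDeriv ℝ (radialCutoff d δ) x (-v)
      = (shell d δ).indicator (fun x => δ⁻¹ * inner ℝ (‖x‖⁻¹ • x) v) x := by
  have hsphere (r : ℝ) : ∀ᵐ x : Vec d, ‖x‖ ≠ r := by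
    have : ∀ᵐ x : Vec d, x ∉ Metric.sphere (0 : Vec d) r :=
      compl_mem_ae_iff.2 (Measure.addHaar_sphere _ _ _)
    simpa only [mem_sphere_zero_iff_norm] using this
  filter_upwards [hsphere 1, hsphere (1 - δ)] with x hx hδx
  by_cases h : x ∈ shell d δ
  · rw [Set.indicator_of_mem h, lineDeriv_radialCutoff_of_mem_shell hδ₁ h]
  · rw [Set.indicator_of_notMem h, lineDeriv_radialCutoff_of_notMem_shell hδ hx hδx h]

theorem integral_shell_direction (φ : Vec d → ℝ) :
    ∫ x in shell d δ, φ (‖x‖⁻¹ • x) =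
      (∫ e : UnitSphere d, φ e ∂uniformSphere d) * volume.real (shell d δ) := by
  calc ∫ x in shell d δ, φ (‖x‖⁻¹ • x)
      = ∫ x : Vec d, φ (‖x‖⁻¹ • x) * (Set.Ioo (1 - δ) 1).indicator 1 ‖x‖ := by
        rw [← integral_indicator measurableSet_shell]
        refine integral_congr_ae (.of_forall fun x => ?_)
        have : (shell d δ).indicator 1 x = (Set.Ioo (1 - δ) 1).indicator (1 : ℝ → ℝ) ‖x‖ := rfl
        by_cases hx : x ∈ shell d δ <;> simp [← this, hx]
    _ = (∫ e : UnitSphere d, φ e ∂uniformSphere d) *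
          ∫ x : Vec d, (Set.Ioo (1 - δ) 1).indicator 1 ‖x‖ := integral_direction_mul_norm _ _
    _ = _ := by
        rw [← integral_indicator_one measurableSet_shell]
        rfl

theorem integral_lineDeriv_mul_radialCutoff {F : Vec d → ℝ} {K : NNReal} (hK : LipschitzWith K F)
    (hδ : 0 < δ) (hδ₁ : δ < 1) (v : Vec d) :
    ∫ u, lineDeriv ℝ F u v * radialCutoff d δ u
      = ∫ u in shell d δ, δ⁻¹ * inner ℝ (‖u‖⁻¹ • u) v * F u := by
  rw [hK.integral_lineDeriv_mul_eq (lipschitzWith_radialCutoff hδ)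
    (hasCompactSupport_radialCutoff hδ), ← integral_indicator measurableSet_shell]
  refine integral_congr_ae ?_
  filter_upwards [lineDeriv_radialCutoff_ae hδ hδ₁ v] with u hu
  rw [hu, ← Set.indicator_mul_left]

theorem sphereFlux_sub_le_integral_shell {F : Vec d → ℝ} {K : NNReal} (hK : LipschitzWith K F)
    (hδ : 0 < δ) (hδ₁ : δ < 1) (v : Vec d) :
    δ⁻¹ * ((∫ e : UnitSphere d, inner ℝ (e : Vec d) v * F e ∂uniformSphere d) *
        volume.real (shell d δ)) - volume.real (shell d δ) * (K * ‖v‖)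
      ≤ ∫ u in shell d δ, δ⁻¹ * inner ℝ (‖u‖⁻¹ • u) v * F u := by
  obtain ⟨C, hC⟩ : ∃ C, ∀ u ∈ Metric.closedBall (0 : Vec d) 1, |F u| ≤ C :=
    (isCompact_closedBall _ _).exists_bound_of_continuousOn hK.continuous.continuousOn
  have hF := hK.continuous.measurable
  have hint : IntegrableOn (fun u : Vec d => inner ℝ (‖u‖⁻¹ • u) v * F u) (shell d δ) :=
    integrableOn_shell_inner_direction_mul hF (fun u hu => hC u (by simpa using hu.2.le)) v
  have hint' : IntegrableOn (fun u : Vec d => inner ℝ (‖u‖⁻¹ • u) v * F (‖u‖⁻¹ • u))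
      (shell d δ) :=
    integrableOn_shell_inner_direction_mul (g := fun u => F (‖u‖⁻¹ • u)) (by fun_prop)
      (fun u _ => hC _ (by simpa using norm_inv_norm_smul_le_one u)) v
  have hconst : IntegrableOn (fun _ : Vec d => K * ‖v‖) (shell d δ) :=
    integrableOn_const volume_shell_ne_top
  rw [← integral_shell_direction (fun w => inner ℝ w v * F w), ← integral_const_mul,
    ← smul_eq_mul (volume.real _), ← setIntegral_const,
    ← integral_sub (hint'.const_mul _) hconst]
  simp only [mul_assoc]
  refine setIntegral_mono_on ((hint'.const_mul _).sub hconst) (hint.const_mul _)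
    measurableSet_shell fun u hu => ?_
  have hdiff : inner ℝ (‖u‖⁻¹ • u) v * (F (‖u‖⁻¹ • u) - F u) ≤ ‖v‖ * (K * δ) := by
    refine (le_abs_self _).trans ?_
    rw [abs_mul]
    exact mul_le_mul (abs_inner_inv_norm_smul_le u v)
      (abs_apply_direction_sub_le_of_mem_shell hK hδ₁ hu) (abs_nonneg _) (norm_nonneg _)
  have := mul_le_mul_of_nonneg_left hdiff (inv_pos.2 hδ).le
  have : δ⁻¹ * (‖v‖ * (K * δ)) = K * ‖v‖ := by field_simp
  linarith

theorem sphereFlux_mul_volume_shell_le {F : Vec d → ℝ} (hF : ConvexOn ℝ Set.univ F) {K : NNReal}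
    (hK : LipschitzWith K F) (hδ : 0 < δ) (hδ₁ : δ < 1) (v : Vec d) :
    δ⁻¹ * ((∫ e : UnitSphere d, inner ℝ (e : Vec d) v * F e ∂uniformSphere d) *
        volume.real (shell d δ)) - 2 * (volume.real (shell d δ) * (K * ‖v‖))
      ≤ ∫ u in Metric.ball (0 : Vec d) 1, (F (u + v) - F u) := by
  have hχ := (lipschitzWith_radialCutoff (d := d) hδ).continuous
  have hχ_supp := hasCompactSupport_radialCutoff (d := d) hδ
  have hFc := hK.continuous
  have hconvex : ∫ u, lineDeriv ℝ F u v * radialCutoff d δ u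
      ≤ ∫ u, (F (u + v) - F u) * radialCutoff d δ u := by
    refine integral_mono_ae
      ((hχ.integrable_of_hasCompactSupport hχ_supp).mul_of_top_right (hK.memLp_lineDeriv v))
      ((Continuous.mul (by fun_prop) hχ).integrable_of_hasCompactSupport hχ_supp.mul_left) ?_
    filter_upwards [hK.ae_lineDifferentiableAt v] with u hu
    exact mul_le_mul_of_nonneg_right (lineDeriv_le_sub_of_convexOn hF hu) (radialCutoff_nonneg u)
  rw [integral_lineDeriv_mul_radialCutoff hK hδ hδ₁] at hconvex
  linarith [integral_sub_mul_radialCutoff_le hK hδ v, sphereFlux_sub_le_integral_shell hK hδ hδ₁ v]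

-- The divergence theorem equates the left-hand side with the integral of `∂_v F` over the ball,
-- which is at most the right-hand side by convexity.
theorem sphereFlux_le_integral_ball {F : Vec d → ℝ} (hF : ConvexOn ℝ Set.univ F) {K : NNReal}
    (hK : LipschitzWith K F) (v : Vec d) :
    d * (∫ e : UnitSphere d, inner ℝ (e : Vec d) v * F e ∂uniformSphere d) *
        (volume : Measure (Vec d)).real (Metric.ball 0 1)
      ≤ ∫ u in Metric.ball (0 : Vec d) 1, (F (u + v) - F u) := by
  set flux := ∫ e : UnitSphere d, inner ℝ (e : Vec d) v * F e ∂uniformSphere d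
  have hlim := (tendsto_inv_mul_volume_real_shell (d := d)).mul_const flux |>.sub
    ((tendsto_volume_real_shell (d := d)).mul_const (K * ‖v‖) |>.const_mul 2)
  rw [zero_mul, mul_zero, sub_zero, mul_right_comm] at hlim
  refine le_of_tendsto hlim ?_
  filter_upwards [Ioo_mem_nhdsGT one_pos] with δ hδ
  calc _ = _ := by ring
    _ ≤ _ := sphereFlux_mul_volume_shell_le hF hK hδ.1 hδ.2 v

end Divergence

section Gaussian

open ProbabilityTheory

variable {d : ℕ}

/-- The density of the standard Gaussian measure of `ℝ^d` as a function of the norm; the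
normalizing constant is kept as an integral. -/
noncomputable def gaussianRadial (d : ℕ) (t : ℝ) : ℝ :=
  (∫ x : Vec d, Real.exp (-(1 / 2) * ‖x‖ ^ 2))⁻¹ * Real.exp (-(1 / 2) * t ^ 2)

theorem integrable_exp_neg_mul_sq_norm {b : ℝ} (hb : 0 < b) :
    Integrable fun x : Vec d => Real.exp (-b * ‖x‖ ^ 2) := by
  refine (GaussianFourier.integrable_cexp_neg_mul_sq_norm_add (V := Vec d) (b := (b : ℂ))
    (by simpa using hb) 0 0).re.congr (.of_forall fun x => ?_)
  have : (-(b : ℂ) * ‖x‖ ^ 2 + 0 * (inner ℝ (0 : Vec d) x : ℝ))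
      = ((-b * ‖x‖ ^ 2 : ℝ) : ℂ) := by
    push_cast; ring
  simp only [this, RCLike.re_to_complex]
  rw [← Complex.ofReal_exp, Complex.ofReal_re]

theorem gaussianRadial_nonneg (t : ℝ) : 0 ≤ gaussianRadial d t := by
  unfold gaussianRadial
  have : 0 ≤ ∫ x : Vec d, Real.exp (-(1 / 2) * ‖x‖ ^ 2) :=
    integral_nonneg fun x => (Real.exp_pos _).le
  positivity

theorem continuous_gaussianRadial : Continuous (gaussianRadial d) := by
  unfold gaussianRadial
  fun_prop

theorem measurable_ofReal_gaussianRadial_norm :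
    Measurable fun x : Vec d => ENNReal.ofReal (gaussianRadial d ‖x‖) := by
  have := continuous_gaussianRadial (d := d)
  fun_prop

theorem gaussianRadial_norm_smul_cexp (x t : Vec d) :
    gaussianRadial d ‖x‖ • Complex.exp ((inner ℝ x t : ℝ) * Complex.I)
      = ((Real.pi / (1 / 2) : ℂ) ^ (Module.finrank ℝ (Vec d) / 2 : ℂ))⁻¹ *
        Complex.exp (-(1 / 2) * ‖x‖ ^ 2 + Complex.I * (inner ℝ t x : ℝ)) := by
  have hmass : ((∫ y : Vec d, Real.exp (-(1 / 2) * ‖y‖ ^ 2) : ℝ) : ℂ)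
      = (Real.pi / (1 / 2) : ℂ) ^ (Module.finrank ℝ (Vec d) / 2 : ℂ) := by
    rw [← integral_complex_ofReal]
    simpa using GaussianFourier.integral_cexp_neg_mul_sq_norm_add (V := Vec d) (b := 1 / 2)
      (by norm_num) 0 0
  rw [Complex.real_smul, gaussianRadial, Complex.ofReal_mul, Complex.ofReal_inv, hmass,
    Complex.exp_add, real_inner_comm]
  push_cast
  ring_nf

theorem stdGaussian_eq_withDensity :
    stdGaussian (Vec d) = volume.withDensity fun x => ENNReal.ofReal (gaussianRadial d ‖x‖) := by
  have hint : Integrable fun x : Vec d => gaussianRadial d ‖x‖ :=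
    (integrable_exp_neg_mul_sq_norm (by norm_num)).const_mul _
  have := isFiniteMeasure_withDensity_ofReal hint.2
  refine Measure.ext_of_charFun (funext fun t => ?_)
  have hmass : (Real.pi / (1 / 2) : ℂ) ^ (Module.finrank ℝ (Vec d) / 2 : ℂ) ≠ 0 := by
    rw [Complex.cpow_ne_zero_iff]
    left
    simp [Real.pi_ne_zero]
  rw [charFun_stdGaussian, charFun_apply, integral_withDensity_eq_integral_toReal_smul
    measurable_ofReal_gaussianRadial_norm (.of_forall fun x => ENNReal.ofReal_lt_top)]
  simp only [ENNReal.toReal_ofReal (gaussianRadial_nonneg _), gaussianRadial_norm_smul_cexp]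
  rw [integral_const_mul, GaussianFourier.integral_cexp_neg_mul_sq_norm_add (by norm_num),
    inv_mul_cancel_left₀ hmass, Complex.I_sq]
  congr 1
  ring

theorem integral_stdGaussian (G : Vec d → ℝ) :
    ∫ x, G x ∂stdGaussian (Vec d) = ∫ x : Vec d, G x * gaussianRadial d ‖x‖ := by
  rw [stdGaussian_eq_withDensity, integral_withDensity_eq_integral_toReal_smul
    measurable_ofReal_gaussianRadial_norm (.of_forall fun x => ENNReal.ofReal_lt_top)]
  simp only [ENNReal.toReal_ofReal (gaussianRadial_nonneg _), smul_eq_mul, mul_comm]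

theorem stdGaussian_absolutelyContinuous : stdGaussian (Vec d) ≪ volume := by
  rw [stdGaussian_eq_withDensity]
  exact withDensity_absolutelyContinuous _ _

theorem integrable_exp_sq_norm_stdGaussian {b : ℝ} (hb : b < 1 / 2) :
    Integrable (fun x => Real.exp (b * ‖x‖ ^ 2)) (stdGaussian (Vec d)) := by
  rw [stdGaussian_eq_withDensity, integrable_withDensity_iff_integrable_smul'
    measurable_ofReal_gaussianRadial_norm (.of_forall fun x => ENNReal.ofReal_lt_top)]
  refine ((integrable_exp_neg_mul_sq_norm (d := d) (b := 1 / 2 - b) (by linarith)).const_mul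
    (∫ x : Vec d, Real.exp (-(1 / 2) * ‖x‖ ^ 2))⁻¹).congr (.of_forall fun x => ?_)
  simp only [ENNReal.toReal_ofReal (gaussianRadial_nonneg _), smul_eq_mul]
  rw [gaussianRadial, mul_assoc, ← Real.exp_add]
  ring_nf

-- The direction and the norm of a standard Gaussian vector are independent.
theorem integral_stdGaussian_direction_mul_norm [NeZero d] (φ : Vec d → ℝ) (k : ℝ → ℝ) :
    ∫ x, φ (‖x‖⁻¹ • x) * k ‖x‖ ∂stdGaussian (Vec d) =
      (∫ e : UnitSphere d, φ e ∂uniformSphere d) * ∫ x, k ‖x‖ ∂stdGaussian (Vec d) := by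
  rw [integral_stdGaussian, integral_stdGaussian (fun x => k ‖x‖)]
  simp only [mul_assoc]
  exact integral_direction_mul_norm φ fun t => k t * gaussianRadial d t

theorem integral_inner_sq_stdGaussian (v : Vec d) :
    ∫ x, inner ℝ v x ^ 2 ∂stdGaussian (Vec d) = ‖v‖ ^ 2 := by
  have h := variance_dual_stdGaussian (innerSL ℝ v : StrongDual ℝ (Vec d))
  rw [innerSL_apply_norm, variance_eq_integral (by fun_prop), integral_strongDual_stdGaussian] at h
  simpa using h

theorem integrable_inner_sq_stdGaussian (v : Vec d) :
    Integrable (fun x => inner ℝ v x ^ 2) (stdGaussian (Vec d)) :=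
  (IsGaussian.memLp_dual (stdGaussian (Vec d)) (innerSL ℝ v : StrongDual ℝ (Vec d)) 2
    (by simp)).integrable_sq

theorem integrable_norm_sq_stdGaussian :
    Integrable (fun x => ‖x‖ ^ 2) (stdGaussian (Vec d)) :=
  (IsGaussian.memLp_id (stdGaussian (Vec d)) 2 (by simp)).norm.integrable_sq

theorem integral_norm_sq_stdGaussian : ∫ x, ‖x‖ ^ 2 ∂stdGaussian (Vec d) = d := by
  simp only [← (EuclideanSpace.basisFun (Fin d) ℝ).sum_sq_inner_right]
  rw [integral_finsetSum _ fun i _ => integrable_inner_sq_stdGaussian _]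
  simp [integral_inner_sq_stdGaussian]

theorem integral_inner_sq_uniformSphere [NeZero d] (v : Vec d) :
    ∫ e : UnitSphere d, inner ℝ v (e : Vec d) ^ 2 ∂uniformSphere d = ‖v‖ ^ 2 / d := by
  have h := integral_stdGaussian_direction_mul_norm (d := d) (fun x => inner ℝ v x ^ 2)
    fun t => t ^ 2
  rw [integral_norm_sq_stdGaussian] at h
  have hd : (d : ℝ) ≠ 0 := Nat.cast_ne_zero.2 (NeZero.ne d)
  rw [eq_div_iff hd, ← h, ← integral_inner_sq_stdGaussian]
  refine integral_congr_ae (.of_forall fun x => ?_)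
  by_cases hx : x = 0
  · simp [hx]
  · have : ‖x‖ ≠ 0 := norm_ne_zero_iff.2 hx
    simp only [inner_smul_right]
    field_simp

theorem integral_neg_stdGaussian (F : Vec d → ℝ) :
    ∫ x, F (-x) ∂stdGaussian (Vec d) = ∫ x, F x ∂stdGaussian (Vec d) := by
  conv_rhs => rw [← stdGaussian_map (LinearIsometryEquiv.neg ℝ (E := Vec d))]
  exact ((LinearIsometryEquiv.neg ℝ
    (E := Vec d)).toHomeomorph.measurableEmbedding.integral_map F).symm

theorem integral_stdGaussian_eq_zero_of_odd {F : Vec d → ℝ} (hF : ∀ x, F (-x) = -F x) :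
    ∫ x, F x ∂stdGaussian (Vec d) = 0 := by
  have h := integral_neg_stdGaussian F
  simp only [hF, integral_neg] at h
  linarith

theorem integral_exp_sq_gaussianReal_le {b : ℝ} {w : NNReal} (hbw : 4 * b * w ≤ 1) :
    ∫ t, Real.exp (b * t ^ 2) ∂gaussianReal 0 w ≤ 2 := by
  by_cases hw : w = 0
  · rw [hw, gaussianReal_zero_var, integral_dirac]
    norm_num
  have hw_pos : (0 : ℝ) < w := by positivity
  have hdensity (t : ℝ) : gaussianPDFReal 0 w t • Real.exp (b * t ^ 2)
      = (√(2 * Real.pi * w))⁻¹ * Real.exp (-(1 / (2 * w) - b) * t ^ 2) := by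
    rw [gaussianPDFReal, smul_eq_mul, mul_assoc, ← Real.exp_add]
    congr 2
    ring
  have hrate : 1 / (4 * w) ≤ 1 / (2 * w) - b := by
    have : b ≤ 1 / (4 * w) := by rw [le_div_iff₀ (by positivity)]; linarith
    have : 1 / (2 * (w : ℝ)) = 1 / (4 * w) + 1 / (4 * w) := by field_simp; norm_num
    linarith
  rw [integral_gaussianReal_eq_integral_smul hw]
  simp only [hdensity]
  rw [integral_const_mul, integral_gaussian, inv_mul_le_iff₀ (by positivity)]
  calc √(Real.pi / (1 / (2 * w) - b)) ≤ √(Real.pi / (1 / (4 * w))) :=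
        Real.sqrt_le_sqrt (div_le_div_of_nonneg_left Real.pi_pos.le (by positivity) hrate)
    _ ≤ √(2 * Real.pi * w) * 2 := by
        rw [Real.sqrt_le_left (by positivity), mul_pow, Real.sq_sqrt (by positivity)]
        field_simp
        norm_num

theorem integral_exp_inner_sq_stdGaussian_le {b : ℝ} {v : Vec d} (hb : 4 * b * ‖v‖ ^ 2 ≤ 1) :
    ∫ x, Real.exp (b * inner ℝ v x ^ 2) ∂stdGaussian (Vec d) ≤ 2 := by
  have hmap : (stdGaussian (Vec d)).map (innerSL ℝ v : StrongDual ℝ (Vec d))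
      = gaussianReal 0 (Real.toNNReal (‖v‖ ^ 2)) := by
    rw [IsGaussian.map_eq_gaussianReal, integral_strongDual_stdGaussian, variance_dual_stdGaussian,
      innerSL_apply_norm]
  have := integral_exp_sq_gaussianReal_le (w := Real.toNNReal (‖v‖ ^ 2)) (b := b)
    (by rwa [Real.coe_toNNReal _ (sq_nonneg _)])
  rw [← hmap, integral_map (by fun_prop) (by fun_prop)] at this
  simpa using this

end Gaussian

section Concentration

open ProbabilityTheory

variable {d : ℕ} {F : Vec d → ℝ} {K : NNReal} {c : ℝ}

/-- The increment of `F` along the rotation of `x` towards `y` by the angle `δ`, for `z = (x, y)`.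
The increments along `n` rotations by `π / (2n)` add up to `F y - F x`. -/
noncomputable def rotationIncrement (F : Vec d → ℝ) (δ : ℝ) (z : Vec d × Vec d) : ℝ :=
  F (Real.cos δ • z.1 + Real.sin δ • z.2) - F z.1

theorem sum_rotationIncrement (F : Vec d → ℝ) (δ : ℝ) (z : Vec d × Vec d) (n : ℕ) :
    ∑ k ∈ Finset.range n, rotationIncrement F δ (ContinuousLinearMap.rotation (k * δ) z)
      = F (Real.cos (n * δ) • z.1 + Real.sin (n * δ) • z.2) - F z.1 := by
  have hstep (k : ℕ) : rotationIncrement F δ (ContinuousLinearMap.rotation (k * δ) z)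
      = F (Real.cos ((k + 1 : ℕ) * δ) • z.1 + Real.sin ((k + 1 : ℕ) * δ) • z.2)
        - F (Real.cos (k * δ) • z.1 + Real.sin (k * δ) • z.2) := by
    rw [rotationIncrement, ContinuousLinearMap.rotation_apply]
    congr 2
    push_cast
    rw [add_mul, one_mul, Real.cos_add, Real.sin_add]
    module
  rw [Finset.sum_congr rfl fun k _ => hstep k,
    Finset.sum_range_sub fun k : ℕ => F (Real.cos (k * δ) • z.1 + Real.sin (k * δ) • z.2)]
  simp

theorem exp_sq_sum_le (hc : 0 ≤ c) {n : ℕ} (hn : 0 < n) (a : ℕ → ℝ) :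
    Real.exp (c * (∑ k ∈ Finset.range n, a k) ^ 2)
      ≤ (n : ℝ)⁻¹ * ∑ k ∈ Finset.range n, Real.exp (c * (n * a k) ^ 2) := by
  have hn₀ : (n : ℝ) ≠ 0 := by positivity
  have hcauchy : c * (∑ k ∈ Finset.range n, a k) ^ 2
      ≤ ∑ k ∈ Finset.range n, (n : ℝ)⁻¹ * (c * (n * a k) ^ 2) := by
    have := sq_sum_le_card_mul_sum_sq (s := Finset.range n) (f := a)
    rw [Finset.card_range] at this
    refine (mul_le_mul_of_nonneg_left this hc).trans (le_of_eq ?_)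
    rw [Finset.mul_sum, Finset.mul_sum]
    refine Finset.sum_congr rfl fun k _ => ?_
    field_simp
  refine (Real.exp_le_exp.2 hcauchy).trans ?_
  have := convexOn_exp.map_sum_le (t := Finset.range n) (w := fun _ => (n : ℝ)⁻¹)
    (p := fun k => c * (n * a k) ^ 2) (fun _ _ => by positivity)
    (by rw [Finset.sum_const, Finset.card_range, nsmul_eq_mul, mul_inv_cancel₀ hn₀])
    (fun _ _ => Set.mem_univ _)
  simpa only [smul_eq_mul, ← Finset.mul_sum] using this

theorem abs_rotationIncrement_le (hF : LipschitzWith K F) {δ : ℝ} (hδ : 0 ≤ δ)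
    (z : Vec d × Vec d) : |rotationIncrement F δ z| ≤ K * (δ * (‖z.1‖ + ‖z.2‖)) := by
  have hcos : |Real.cos δ - 1| ≤ δ := by
    simpa [abs_of_nonneg hδ] using Real.abs_cos_sub_cos_le δ 0
  have hsin : |Real.sin δ| ≤ δ := by
    simpa [abs_of_nonneg hδ] using Real.abs_sin_le_abs (x := δ)
  calc |rotationIncrement F δ z|
      ≤ K * ‖Real.cos δ • z.1 + Real.sin δ • z.2 - z.1‖ := by
        rw [rotationIncrement, ← Real.dist_eq, ← dist_eq_norm]
        exact hF.dist_le_mul _ _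
    _ = K * ‖(Real.cos δ - 1) • z.1 + Real.sin δ • z.2‖ := by congr 2; module
    _ ≤ K * (|Real.cos δ - 1| * ‖z.1‖ + |Real.sin δ| * ‖z.2‖) := by
        gcongr
        simpa only [norm_smul, Real.norm_eq_abs] using
          norm_add_le ((Real.cos δ - 1) • z.1) (Real.sin δ • z.2)
    _ ≤ K * (δ * (‖z.1‖ + ‖z.2‖)) := by rw [mul_add δ]; gcongr

theorem continuous_rotationIncrement (hF : Continuous F) (δ : ℝ) :
    Continuous (rotationIncrement F δ) := by
  unfold rotationIncrement
  fun_prop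

/-- An integrable majorant, uniform in the step `π / (2n)`, of the exponentials of squared rotation
increments; it justifies the passage to the limit `n → ∞` under the Gaussian integral. -/
noncomputable def gaussianMajorant (z : Vec d × Vec d) : ℝ :=
  Real.exp (1 / 4 * ‖z.1‖ ^ 2) * Real.exp (1 / 4 * ‖z.2‖ ^ 2)

theorem integrable_gaussianMajorant :
    Integrable (gaussianMajorant (d := d)) ((stdGaussian (Vec d)).prod (stdGaussian (Vec d))) :=
  (integrable_exp_sq_norm_stdGaussian (by norm_num)).mul_prod
    (integrable_exp_sq_norm_stdGaussian (by norm_num))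

theorem pi_sq_le_ten : Real.pi ^ 2 ≤ 10 := by
  nlinarith [Real.pi_lt_d2, Real.pi_pos]

theorem exp_sq_rotationIncrement_le (hF : LipschitzWith K F) (hc : 0 ≤ c)
    (hcK : 20 * (c * K ^ 2) ≤ 1) {n : ℕ} (hn : 0 < n) (z : Vec d × Vec d) :
    Real.exp (c * (n * rotationIncrement F (Real.pi / 2 / n) z) ^ 2) ≤ gaussianMajorant z := by
  have hn₀ : (0 : ℝ) < n := by positivity
  have habs : |n * rotationIncrement F (Real.pi / 2 / n) z|
      ≤ K * (Real.pi / 2) * (‖z.1‖ + ‖z.2‖) := by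
    rw [abs_mul, abs_of_pos hn₀]
    calc (n : ℝ) * |rotationIncrement F (Real.pi / 2 / n) z|
        ≤ n * (K * (Real.pi / 2 / n * (‖z.1‖ + ‖z.2‖))) := by
          gcongr
          exact abs_rotationIncrement_le hF (by positivity) z
      _ = _ := by field_simp
  rw [gaussianMajorant, ← Real.exp_add, Real.exp_le_exp]
  calc c * (n * rotationIncrement F (Real.pi / 2 / n) z) ^ 2
      ≤ c * (K * (Real.pi / 2) * (‖z.1‖ + ‖z.2‖)) ^ 2 := by
        rw [← sq_abs (_ * rotationIncrement F _ z)]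
        gcongr
    _ = c * K ^ 2 * Real.pi ^ 2 / 4 * (‖z.1‖ + ‖z.2‖) ^ 2 := by ring
    _ ≤ c * K ^ 2 * 10 / 4 * (2 * (‖z.1‖ ^ 2 + ‖z.2‖ ^ 2)) := by
        gcongr
        · exact pi_sq_le_ten
        · exact add_sq_le
    _ ≤ 1 / 4 * ‖z.1‖ ^ 2 + 1 / 4 * ‖z.2‖ ^ 2 := by nlinarith [sq_nonneg ‖z.1‖, sq_nonneg ‖z.2‖]

theorem integrable_exp_sq_rotationIncrement (hF : LipschitzWith K F) (hc : 0 ≤ c)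
    (hcK : 20 * (c * K ^ 2) ≤ 1) {n : ℕ} (hn : 0 < n) :
    Integrable (fun z => Real.exp (c * (n * rotationIncrement F (Real.pi / 2 / n) z) ^ 2))
      ((stdGaussian (Vec d)).prod (stdGaussian (Vec d))) := by
  have := continuous_rotationIncrement hF.continuous (Real.pi / 2 / n)
  refine integrable_gaussianMajorant.mono' (by fun_prop) (.of_forall fun z => ?_)
  rw [Real.norm_eq_abs, abs_of_pos (Real.exp_pos _)]
  exact exp_sq_rotationIncrement_le hF hc hcK hn z

theorem integrable_exp_sq_sub (hF : LipschitzWith K F) (hc : 0 ≤ c)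
    (hcK : 20 * (c * K ^ 2) ≤ 1) :
    Integrable (fun z : Vec d × Vec d => Real.exp (c * (F z.2 - F z.1) ^ 2))
      ((stdGaussian (Vec d)).prod (stdGaussian (Vec d))) := by
  simpa [rotationIncrement] using integrable_exp_sq_rotationIncrement hF hc hcK one_pos

theorem measurePreserving_rotation (θ : ℝ) :
    MeasurePreserving (ContinuousLinearMap.rotation θ : _ → Vec d × Vec d)
      ((stdGaussian (Vec d)).prod (stdGaussian (Vec d)))
      ((stdGaussian (Vec d)).prod (stdGaussian (Vec d))) :=
  ⟨(ContinuousLinearMap.rotation θ).continuous.measurable,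
    IsGaussian.map_rotation_eq_self (by simp) θ⟩

theorem integral_exp_sq_sub_le_rotationIncrement (hF : LipschitzWith K F) (hc : 0 ≤ c)
    (hcK : 20 * (c * K ^ 2) ≤ 1) {n : ℕ} (hn : 0 < n) :
    ∫ z, Real.exp (c * (F z.2 - F z.1) ^ 2) ∂(stdGaussian (Vec d)).prod (stdGaussian (Vec d))
      ≤ ∫ z, Real.exp (c * (n * rotationIncrement F (Real.pi / 2 / n) z) ^ 2)
        ∂(stdGaussian (Vec d)).prod (stdGaussian (Vec d)) := by
  set μ := (stdGaussian (Vec d)).prod (stdGaussian (Vec d))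
  set δ := Real.pi / 2 / n with hδ
  set g : Vec d × Vec d → ℝ := fun z => Real.exp (c * (n * rotationIncrement F δ z) ^ 2)
  have hn₀ : (n : ℝ) ≠ 0 := by positivity
  have hg : Integrable g μ := integrable_exp_sq_rotationIncrement hF hc hcK hn
  have hg_rot (θ : ℝ) : Integrable (fun z => g (ContinuousLinearMap.rotation θ z)) μ :=
    (measurePreserving_rotation θ).integrable_comp_of_integrable hg
  have hintegral_rot (θ : ℝ) : ∫ z, g (ContinuousLinearMap.rotation θ z) ∂μ = ∫ z, g z ∂μ := by
    have hmp := measurePreserving_rotation (d := d) θ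
    rw [← integral_map hmp.measurable.aemeasurable (hmp.map_eq ▸ hg.aestronglyMeasurable),
      hmp.map_eq]
  calc ∫ z, Real.exp (c * (F z.2 - F z.1) ^ 2) ∂μ
      ≤ ∫ z, (n : ℝ)⁻¹ * ∑ k ∈ Finset.range n, g (ContinuousLinearMap.rotation (k * δ) z) ∂μ := by
        refine integral_mono_of_nonneg (.of_forall fun z => (Real.exp_pos _).le)
          ((integrable_finsetSum _ fun k _ => hg_rot _).const_mul _) (.of_forall fun z => ?_)
        have := exp_sq_sum_le hc hn
          fun k => rotationIncrement F δ (ContinuousLinearMap.rotation (k * δ) z)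
        rwa [sum_rotationIncrement, hδ, mul_div_cancel₀ _ hn₀, Real.cos_pi_div_two,
          Real.sin_pi_div_two, zero_smul, one_smul, zero_add] at this
    _ = ∫ z, g z ∂μ := by
        rw [integral_const_mul, integral_finsetSum _ fun k _ => hg_rot _,
          Finset.sum_congr rfl fun k _ => hintegral_rot _, Finset.sum_const, Finset.card_range,
          nsmul_eq_mul, inv_mul_cancel_left₀ hn₀]

theorem tendsto_rotationIncrement {x : Vec d} (hx : DifferentiableAt ℝ F x) (y : Vec d) :
    Filter.Tendsto (fun n : ℕ => ((n + 1 : ℕ) : ℝ) *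
        rotationIncrement F (Real.pi / 2 / ((n + 1 : ℕ) : ℝ)) (x, y)) Filter.atTop
      (nhds (Real.pi / 2 * fderiv ℝ F x y)) := by
  have hcurve : HasDerivAt (fun δ : ℝ => Real.cos δ • x + Real.sin δ • y) y 0 := by
    have := ((Real.hasDerivAt_cos 0).smul_const x).add ((Real.hasDerivAt_sin 0).smul_const y)
    exact this.congr_deriv (by simp)
  have hFx : HasFDerivAt F (fderiv ℝ F x) (Real.cos 0 • x + Real.sin 0 • y) := by
    simpa using hx.hasFDerivAt
  have hslope := (hFx.comp_hasDerivAt (0 : ℝ) hcurve).tendsto_slope_zero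
  have hδ : Filter.Tendsto (fun n : ℕ => Real.pi / 2 / ((n + 1 : ℕ) : ℝ)) Filter.atTop
      (nhdsWithin 0 {0}ᶜ) := by
    refine tendsto_nhdsWithin_iff.2 ⟨?_, .of_forall fun n => ?_⟩
    · exact (tendsto_const_div_atTop_nhds_zero_nat (Real.pi / 2)).comp
        (Filter.tendsto_add_atTop_nat 1)
    · have : (0 : ℝ) < Real.pi / 2 / ((n + 1 : ℕ) : ℝ) := by positivity
      exact this.ne'
  refine ((hslope.comp hδ).const_mul (Real.pi / 2)).congr fun n => ?_
  have hn : ((n + 1 : ℕ) : ℝ) ≠ 0 := by positivity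
  simp only [Function.comp_apply, rotationIncrement, zero_add, Real.cos_zero, Real.sin_zero,
    one_smul, zero_smul, add_zero, smul_eq_mul, inv_div]
  field_simp

theorem integral_exp_sq_fderiv_apply_le (hF : LipschitzWith K F) (hc : 0 ≤ c)
    (hcK : 20 * (c * K ^ 2) ≤ 1) (x : Vec d) :
    ∫ y, Real.exp (c * (Real.pi / 2 * fderiv ℝ F x y) ^ 2) ∂stdGaussian (Vec d) ≤ 2 := by
  set v := (InnerProductSpace.toDual ℝ (Vec d)).symm (fderiv ℝ F x)
  have hv : ‖v‖ ≤ K := by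
    rw [LinearIsometryEquiv.norm_map]
    exact norm_fderiv_le_of_lipschitz ℝ hF
  have hinner (y : Vec d) : fderiv ℝ F x y = inner ℝ v y := by
    rw [InnerProductSpace.toDual_symm_apply]
  have hrate : 4 * (c * (Real.pi / 2) ^ 2) * ‖v‖ ^ 2 ≤ 1 := by
    calc 4 * (c * (Real.pi / 2) ^ 2) * ‖v‖ ^ 2 = c * Real.pi ^ 2 * ‖v‖ ^ 2 := by ring
      _ ≤ c * 10 * K ^ 2 := by gcongr; exact pi_sq_le_ten
      _ ≤ 1 := by nlinarith [mul_nonneg hc (sq_nonneg (K : ℝ))]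
  calc _ = ∫ y, Real.exp (c * (Real.pi / 2) ^ 2 * inner ℝ v y ^ 2) ∂stdGaussian (Vec d) := by
        simp only [hinner, mul_pow, mul_assoc]
    _ ≤ 2 := integral_exp_inner_sq_stdGaussian_le hrate

theorem integral_exp_sq_fderiv_le (hF : LipschitzWith K F) (hc : 0 ≤ c)
    (hcK : 20 * (c * K ^ 2) ≤ 1) :
    ∫ z, Real.exp (c * (Real.pi / 2 * fderiv ℝ F z.1 z.2) ^ 2)
      ∂(stdGaussian (Vec d)).prod (stdGaussian (Vec d)) ≤ 2 := by
  by_cases hint : Integrable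
      (fun z : Vec d × Vec d => Real.exp (c * (Real.pi / 2 * fderiv ℝ F z.1 z.2) ^ 2))
      ((stdGaussian (Vec d)).prod (stdGaussian (Vec d)))
  · rw [integral_prod _ hint]
    calc _ ≤ ∫ _x, (2 : ℝ) ∂stdGaussian (Vec d) :=
          integral_mono_of_nonneg
            (.of_forall fun x => integral_nonneg fun y => (Real.exp_pos _).le)
            (integrable_const _) (.of_forall (integral_exp_sq_fderiv_apply_le hF hc hcK))
      _ = 2 := by simp
  · rw [integral_undef hint]
    norm_num

-- The Maurey–Pisier argument: cut the rotation of `x` into `y` into `n` equal steps, use that each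
-- step preserves the law of `(x, y)`, and let `n → ∞`.
theorem integral_exp_sq_sub_le (hF : LipschitzWith K F) (hc : 0 ≤ c)
    (hcK : 20 * (c * K ^ 2) ≤ 1) :
    ∫ z, Real.exp (c * (F z.2 - F z.1) ^ 2)
      ∂(stdGaussian (Vec d)).prod (stdGaussian (Vec d)) ≤ 2 := by
  refine le_trans ?_ (integral_exp_sq_fderiv_le hF hc hcK)
  have hlim : Filter.Tendsto (fun n : ℕ => ∫ z, Real.exp (c * (((n + 1 : ℕ) : ℝ) *
      rotationIncrement F (Real.pi / 2 / ((n + 1 : ℕ) : ℝ)) z) ^ 2)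
        ∂(stdGaussian (Vec d)).prod (stdGaussian (Vec d))) Filter.atTop
      (nhds (∫ z, Real.exp (c * (Real.pi / 2 * fderiv ℝ F z.1 z.2) ^ 2)
        ∂(stdGaussian (Vec d)).prod (stdGaussian (Vec d)))) := by
    refine tendsto_integral_of_dominated_convergence gaussianMajorant (fun n => ?_)
      integrable_gaussianMajorant (fun n => .of_forall fun z => ?_) ?_
    · exact (integrable_exp_sq_rotationIncrement hF hc hcK n.succ_pos).aestronglyMeasurable
    · rw [Real.norm_eq_abs, abs_of_pos (Real.exp_pos _)]
      exact exp_sq_rotationIncrement_le hF hc hcK n.succ_pos z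
    · have hae : ∀ᵐ x ∂stdGaussian (Vec d), DifferentiableAt ℝ F x :=
        stdGaussian_absolutelyContinuous.ae_le hF.ae_differentiableAt
      filter_upwards [Measure.quasiMeasurePreserving_fst.ae hae] with z hz
      exact (Real.continuous_exp.tendsto _).comp
        (((tendsto_rotationIncrement hz z.2).pow 2).const_mul _)
  exact ge_of_tendsto' hlim fun n =>
    integral_exp_sq_sub_le_rotationIncrement hF hc hcK n.succ_pos

theorem integrable_exp_sq_of_lipschitz (hF : LipschitzWith K F) (hF₀ : F 0 = 0) (hc : 0 ≤ c)
    (hcK : c * K ^ 2 < 1 / 2) :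
    Integrable (fun x => Real.exp (c * F x ^ 2)) (stdGaussian (Vec d)) := by
  have := hF.continuous
  refine (integrable_exp_sq_norm_stdGaussian hcK).mono' (by fun_prop) (.of_forall fun x => ?_)
  have habs : |F x| ≤ K * ‖x‖ := by
    simpa [Real.dist_eq, hF₀, dist_zero_right] using hF.dist_le_mul x 0
  rw [Real.norm_eq_abs, abs_of_pos (Real.exp_pos _), Real.exp_le_exp]
  calc c * F x ^ 2 ≤ c * (K * ‖x‖) ^ 2 := by rw [← sq_abs (F x)]; gcongr
    _ = c * K ^ 2 * ‖x‖ ^ 2 := by ring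

-- Jensen's inequality in the second copy, made explicit through `1 + t ≤ exp t`.
theorem integral_exp_sq_le_integral_exp_sq_sub {Ω : Type*} [MeasurableSpace Ω] {μ : Measure Ω}
    [IsProbabilityMeasure μ] {X : Ω → ℝ} (hc : 0 ≤ c) (hX : Integrable X μ)
    (hmean : ∫ ω, X ω ∂μ = 0) (hexp : Integrable (fun ω => Real.exp (c * X ω ^ 2)) μ)
    (hmul : Integrable (fun ω => X ω * Real.exp (c * X ω ^ 2)) μ)
    (hsub : Integrable (fun z : Ω × Ω => Real.exp (c * (X z.2 - X z.1) ^ 2)) (μ.prod μ)) :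
    ∫ ω, Real.exp (c * X ω ^ 2) ∂μ
      ≤ ∫ z : Ω × Ω, Real.exp (c * (X z.2 - X z.1) ^ 2) ∂μ.prod μ := by
  have hexp₂ : Integrable (fun z : Ω × Ω => Real.exp (c * X z.2 ^ 2)) (μ.prod μ) := by
    simpa using (integrable_const (1 : ℝ)).mul_prod (μ := μ) hexp
  have hcross := (hX.mul_prod hmul).const_mul (2 * c)
  calc ∫ ω, Real.exp (c * X ω ^ 2) ∂μ
      = ∫ z : Ω × Ω, (Real.exp (c * X z.2 ^ 2)
          - 2 * c * (X z.1 * (X z.2 * Real.exp (c * X z.2 ^ 2)))) ∂μ.prod μ := by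
        rw [integral_sub hexp₂ hcross, integral_const_mul,
          integral_prod_mul X fun ω => X ω * Real.exp (c * X ω ^ 2), hmean]
        simpa using (integral_prod_mul (μ := μ) (ν := μ) (fun _ => (1 : ℝ))
          fun ω => Real.exp (c * X ω ^ 2)).symm
    _ ≤ ∫ z : Ω × Ω, Real.exp (c * (X z.2 - X z.1) ^ 2) ∂μ.prod μ := by
        refine integral_mono (hexp₂.sub hcross) hsub fun z => ?_
        have hsplit : Real.exp (c * (X z.2 - X z.1) ^ 2) = Real.exp (c * X z.2 ^ 2) *
            Real.exp (c * X z.1 ^ 2 - 2 * c * (X z.1 * X z.2)) := by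
          rw [← Real.exp_add]
          ring_nf
        have := Real.add_one_le_exp (c * X z.1 ^ 2 - 2 * c * (X z.1 * X z.2))
        have := Real.exp_pos (c * X z.2 ^ 2)
        simp only [hsplit]
        nlinarith [mul_nonneg hc (sq_nonneg (X z.1))]

theorem integral_exp_sq_stdGaussian_le (hF : LipschitzWith K F) (hodd : ∀ x, F (-x) = -F x)
    (hc : 0 ≤ c) (hcK : 20 * (c * K ^ 2) ≤ 1) :
    ∫ x, Real.exp (c * F x ^ 2) ∂stdGaussian (Vec d) ≤ 2 := by
  have hF₀ : F 0 = 0 := by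
    have := hodd 0
    rw [neg_zero] at this
    linarith
  have hFc := hF.continuous
  have hL2 : MemLp F 2 (stdGaussian (Vec d)) :=
    hF.comp_memLp hF₀ (IsGaussian.memLp_id (stdGaussian (Vec d)) 2 (by simp))
  have hexpL2 : MemLp (fun x => Real.exp (c * F x ^ 2)) 2 (stdGaussian (Vec d)) := by
    rw [memLp_two_iff_integrable_sq (by fun_prop)]
    refine (integrable_exp_sq_of_lipschitz hF hF₀ (c := 2 * c) (by positivity)
      (by linarith)).congr (.of_forall fun x => ?_)
    simp only [← Real.exp_nat_mul]
    push_cast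
    ring_nf
  exact (integral_exp_sq_le_integral_exp_sq_sub hc (hL2.integrable one_le_two)
    (integral_stdGaussian_eq_zero_of_odd hodd) (hexpL2.integrable one_le_two)
    (hL2.integrable_mul hexpL2) (integrable_exp_sq_sub hF hc hcK)).trans
    (integral_exp_sq_sub_le hF hc hcK)

end Concentration

section SphereConcentration

open ProbabilityTheory

variable {d : ℕ} {H : Vec d → ℝ} {K : NNReal} {c : ℝ}

theorem integrable_of_continuous_of_compactSpace {X E : Type*} [TopologicalSpace X]
    [CompactSpace X] [MeasurableSpace X] [OpensMeasurableSpace X] [NormedAddCommGroup E]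
    {μ : Measure X} [IsFiniteMeasureOnCompacts μ] {g : X → E} (hg : Continuous g) :
    Integrable g μ :=
  hg.integrable_of_hasCompactSupport (.of_compactSpace g)

theorem abs_apply_le_mul_norm_of_odd {E : Type*} [SeminormedAddCommGroup E] {H : E → ℝ}
    (hH : LipschitzWith K H) (hodd : ∀ x, H (-x) = -H x) (x : E) : |H x| ≤ K * ‖x‖ := by
  have hH₀ : H 0 = 0 := by
    have := hodd 0
    rw [neg_zero] at this
    linarith
  simpa [Real.dist_eq, hH₀] using hH.dist_le_mul x 0

theorem norm_smul_inv_norm_smul {E : Type*} [NormedAddCommGroup E] [NormedSpace ℝ E] (x : E) :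
    ‖x‖ • (‖x‖⁻¹ • x) = x := by
  rcases eq_or_ne x 0 with rfl | hx
  · simp
  · exact smul_inv_smul₀ (norm_ne_zero_iff.2 hx) x

theorem norm_mul_norm_inv_norm_smul_sub_le {E : Type*} [NormedAddCommGroup E] [NormedSpace ℝ E]
    (x y : E) : ‖y‖ * ‖‖x‖⁻¹ • x - ‖y‖⁻¹ • y‖ ≤ 2 * ‖x - y‖ := by
  have hsplit : ‖y‖ • (‖x‖⁻¹ • x - ‖y‖⁻¹ • y) = (‖y‖ - ‖x‖) • (‖x‖⁻¹ • x) + (x - y) := by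
    rw [smul_sub, sub_smul, norm_smul_inv_norm_smul x, norm_smul_inv_norm_smul y]
    abel
  calc ‖y‖ * ‖‖x‖⁻¹ • x - ‖y‖⁻¹ • y‖ = ‖(‖y‖ - ‖x‖) • (‖x‖⁻¹ • x) + (x - y)‖ := by
        rw [← hsplit, norm_smul, norm_norm]
    _ ≤ |‖y‖ - ‖x‖| * ‖‖x‖⁻¹ • x‖ + ‖x - y‖ := by
        simpa only [norm_smul, Real.norm_eq_abs] using
          norm_add_le ((‖y‖ - ‖x‖) • (‖x‖⁻¹ • x)) (x - y)
    _ ≤ ‖y - x‖ * 1 + ‖x - y‖ := by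
        gcongr
        · exact abs_norm_sub_norm_le y x
        · exact norm_inv_norm_smul_le_one x
    _ = 2 * ‖x - y‖ := by rw [norm_sub_rev y x]; ring

/-- The positively homogeneous extension to `ℝ^d` of the restriction of `H` to the unit sphere. It
transfers the Gaussian concentration inequality to the sphere. -/
noncomputable def homogeneousExtension (H : Vec d → ℝ) (x : Vec d) : ℝ :=
  ‖x‖ * H (‖x‖⁻¹ • x)

theorem lipschitzWith_homogeneousExtension (hH : LipschitzWith K H)
    (hodd : ∀ x, H (-x) = -H x) : LipschitzWith (3 * K) (homogeneousExtension H) := by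
  refine LipschitzWith.of_dist_le_mul fun x y => ?_
  set u := ‖x‖⁻¹ • x
  set w := ‖y‖⁻¹ • y
  have hHu : |H u| ≤ K := (abs_apply_le_mul_norm_of_odd hH hodd u).trans
    (mul_le_of_le_one_right K.2 (norm_inv_norm_smul_le_one x))
  have hHuw : |H u - H w| ≤ K * ‖u - w‖ := by
    rw [← Real.dist_eq, ← dist_eq_norm]
    exact hH.dist_le_mul u w
  rw [Real.dist_eq, dist_eq_norm]
  calc |‖x‖ * H u - ‖y‖ * H w| = |(‖x‖ - ‖y‖) * H u + ‖y‖ * (H u - H w)| := by ring_nf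
    _ ≤ |‖x‖ - ‖y‖| * |H u| + ‖y‖ * |H u - H w| := by
        simpa only [abs_mul, abs_norm] using abs_add_le ((‖x‖ - ‖y‖) * H u) (‖y‖ * (H u - H w))
    _ ≤ ‖x - y‖ * K + ‖y‖ * (K * ‖u - w‖) := by
        gcongr
        exact abs_norm_sub_norm_le x y
    _ = ‖x - y‖ * K + K * (‖y‖ * ‖u - w‖) := by ring
    _ ≤ ‖x - y‖ * K + K * (2 * ‖x - y‖) := by
        gcongr _ + _ * ?_
        exact norm_mul_norm_inv_norm_smul_sub_le x y
    _ = (3 * K : NNReal) * ‖x - y‖ := by push_cast; ring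

theorem exists_abs_apply_direction_le {φ : Vec d → ℝ} (hφ : Continuous φ) :
    ∃ C, ∀ x : Vec d, |φ (‖x‖⁻¹ • x)| ≤ C := by
  obtain ⟨C, hC⟩ := (isCompact_closedBall (0 : Vec d) 1).exists_bound_of_continuousOn
    hφ.continuousOn
  exact ⟨C, fun x => hC _ (mem_closedBall_zero_iff.2 (norm_inv_norm_smul_le_one x))⟩

theorem integrable_direction_mul_stdGaussian {φ k : Vec d → ℝ} (hφ : Continuous φ)
    (hk : Integrable k (stdGaussian (Vec d))) :
    Integrable (fun x => φ (‖x‖⁻¹ • x) * k x) (stdGaussian (Vec d)) := by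
  obtain ⟨C, hC⟩ := exists_abs_apply_direction_le hφ
  have hdirection : Measurable fun x : Vec d => ‖x‖⁻¹ • x := by fun_prop
  exact hk.bdd_mul (hφ.measurable.comp hdirection).aestronglyMeasurable (.of_forall hC)

theorem integral_uniformSphere_eq_integral_stdGaussian [NeZero d] (φ : Vec d → ℝ) :
    ∫ e : UnitSphere d, φ e ∂uniformSphere d = ∫ x, φ (‖x‖⁻¹ • x) ∂stdGaussian (Vec d) := by
  simpa using (integral_stdGaussian_direction_mul_norm φ fun _ => 1).symm

-- The direction and the norm of a Gaussian vector are independent, and `𝔼 ‖x‖² = d`.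
theorem integral_direction_mul_norm_sq_sub_eq_zero [NeZero d] {ψ : Vec d → ℝ}
    (hψ : Continuous ψ) :
    ∫ x, ψ (‖x‖⁻¹ • x) * (‖x‖ ^ 2 - d) ∂stdGaussian (Vec d) = 0 := by
  have hnorm := integral_stdGaussian_direction_mul_norm ψ fun t => t ^ 2
  rw [integral_norm_sq_stdGaussian] at hnorm
  simp only [mul_sub]
  rw [integral_sub (integrable_direction_mul_stdGaussian hψ integrable_norm_sq_stdGaussian)
    (integrable_direction_mul_stdGaussian hψ (integrable_const _)), hnorm, integral_mul_const,
    integral_uniformSphere_eq_integral_stdGaussian, sub_self]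

-- With `t = H (x / ‖x‖)`, the Gaussian integrand is `exp (c d t²) exp (c t² (‖x‖² - d))`, and
-- `1 + s ≤ exp s` bounds the second factor from below by an expression of mean one.
theorem integral_exp_sq_uniformSphere_le [NeZero d] (hH : LipschitzWith K H)
    (hodd : ∀ x, H (-x) = -H x) (hc : 0 ≤ c) (hcK : 180 * (c * K ^ 2) ≤ 1) :
    ∫ e : UnitSphere d, Real.exp (c * d * H e ^ 2) ∂uniformSphere d ≤ 2 := by
  have hF := lipschitzWith_homogeneousExtension hH hodd
  have hFodd (x : Vec d) : homogeneousExtension H (-x) = -homogeneousExtension H x := by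
    simp only [homogeneousExtension, norm_neg, smul_neg, hodd, mul_neg]
  have hHc := hH.continuous
  set φ : Vec d → ℝ := fun x => Real.exp (c * d * H x ^ 2)
  set ψ : Vec d → ℝ := fun x => c * H x ^ 2 * φ x
  have hφ : Integrable (fun x : Vec d => φ (‖x‖⁻¹ • x)) (stdGaussian (Vec d)) := by
    simpa using integrable_direction_mul_stdGaussian (φ := φ) (by fun_prop)
      (integrable_const (1 : ℝ))
  have hψ : Integrable (fun x : Vec d => ψ (‖x‖⁻¹ • x) * (‖x‖ ^ 2 - d)) (stdGaussian (Vec d)) :=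
    integrable_direction_mul_stdGaussian (by fun_prop)
      (integrable_norm_sq_stdGaussian.sub (integrable_const _))
  calc ∫ e : UnitSphere d, φ e ∂uniformSphere d
      = ∫ x, (φ (‖x‖⁻¹ • x) + ψ (‖x‖⁻¹ • x) * (‖x‖ ^ 2 - d)) ∂stdGaussian (Vec d) := by
        rw [integral_add hφ hψ, integral_direction_mul_norm_sq_sub_eq_zero (by fun_prop),
          add_zero, integral_uniformSphere_eq_integral_stdGaussian]
    _ ≤ ∫ x, Real.exp (c * homogeneousExtension H x ^ 2) ∂stdGaussian (Vec d) := by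
        refine integral_mono (hφ.add hψ) (integrable_exp_sq_of_lipschitz hF
          (by simp [homogeneousExtension]) hc (by push_cast; linarith)) fun x => ?_
        set t := H (‖x‖⁻¹ • x)
        have hfactor : Real.exp (c * homogeneousExtension H x ^ 2)
            = φ (‖x‖⁻¹ • x) * Real.exp (c * t ^ 2 * (‖x‖ ^ 2 - d)) := by
          rw [← Real.exp_add, homogeneousExtension]
          congr 1
          ring
        calc φ (‖x‖⁻¹ • x) + ψ (‖x‖⁻¹ • x) * (‖x‖ ^ 2 - d)
            = φ (‖x‖⁻¹ • x) * (c * t ^ 2 * (‖x‖ ^ 2 - d) + 1) := by simp only [ψ, t]; ring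
          _ ≤ Real.exp (c * homogeneousExtension H x ^ 2) := by
              rw [hfactor]
              exact mul_le_mul_of_nonneg_left (Real.add_one_le_exp _) (Real.exp_pos _).le
    _ ≤ 2 := integral_exp_sq_stdGaussian_le hF hFodd hc (by push_cast; linarith)

theorem exp_half_add_le (u v : ℝ) :
    Real.exp ((u + v) / 2) ≤ (Real.exp u + Real.exp v) / 2 := by
  have := convexOn_exp.2 (Set.mem_univ u) (Set.mem_univ v) one_half_pos.le one_half_pos.le
    (add_halves 1)
  simp only [smul_eq_mul] at this
  calc Real.exp ((u + v) / 2) = Real.exp (1 / 2 * u + 1 / 2 * v) := by ring_nf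
    _ ≤ _ := by linarith

theorem integral_exp_abs_mul_uniformSphere_le [NeZero d] {H' : Vec d → ℝ}
    (hH : LipschitzWith K H) (hodd : ∀ x, H (-x) = -H x) (hH' : LipschitzWith K H')
    (hodd' : ∀ x, H' (-x) = -H' x) (hc : 0 ≤ c) (hcK : 180 * (c * K ^ 2) ≤ 1) :
    ∫ e : UnitSphere d, Real.exp (c * |d * H e * H' e|) ∂uniformSphere d ≤ 2 := by
  have hHc := hH.continuous
  have hHc' := hH'.continuous
  have hint : Integrable (fun e : UnitSphere d => Real.exp (c * d * H e ^ 2)) (uniformSphere d) :=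
    integrable_of_continuous_of_compactSpace (by fun_prop)
  have hint' : Integrable (fun e : UnitSphere d => Real.exp (c * d * H' e ^ 2))
      (uniformSphere d) := integrable_of_continuous_of_compactSpace (by fun_prop)
  calc ∫ e : UnitSphere d, Real.exp (c * |d * H e * H' e|) ∂uniformSphere d
      ≤ ∫ e : UnitSphere d, (Real.exp (c * d * H e ^ 2) + Real.exp (c * d * H' e ^ 2)) / 2
          ∂uniformSphere d := by
        refine integral_mono_of_nonneg (.of_forall fun e => (Real.exp_pos _).le)
          ((hint.add hint').div_const _) (.of_forall fun e => ?_)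
        refine (Real.exp_le_exp.2 ?_).trans (exp_half_add_le _ _)
        calc c * |d * H e * H' e| = c * d * (|H e| * |H' e|) := by
              rw [abs_mul, abs_mul, Nat.abs_cast]; ring
          _ ≤ c * d * ((H e ^ 2 + H' e ^ 2) / 2) := by
              gcongr
              rw [← sq_abs (H e), ← sq_abs (H' e)]
              linarith [two_mul_le_add_sq |H e| |H' e|]
          _ = _ := by ring
    _ ≤ 2 := by
        rw [integral_div, integral_add hint hint']
        linarith [integral_exp_sq_uniformSphere_le hH hodd hc hcK,
          integral_exp_sq_uniformSphere_le hH' hodd' hc hcK]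

theorem integral_neg_uniformSphere [NeZero d] (φ : Vec d → ℝ) :
    ∫ e : UnitSphere d, φ (-e) ∂uniformSphere d = ∫ e : UnitSphere d, φ e ∂uniformSphere d := by
  rw [integral_uniformSphere_eq_integral_stdGaussian φ,
    integral_uniformSphere_eq_integral_stdGaussian fun x => φ (-x),
    ← integral_neg_stdGaussian fun x => φ (‖x‖⁻¹ • x)]
  simp only [norm_neg, smul_neg]

end SphereConcentration

section ExpMoments

variable {Ω : Type*} [MeasurableSpace Ω] {μ : Measure Ω}

theorem exp_le_one_add_add_sq_mul_exp_abs (x : ℝ) :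
    Real.exp x ≤ 1 + x + x ^ 2 * Real.exp |x| := by
  rcases le_total |x| 1 with hx | hx
  · have hquadratic := (abs_le.1 (Real.abs_exp_sub_one_sub_id_le hx)).2
    have hexp : 1 ≤ Real.exp |x| := Real.one_le_exp (abs_nonneg x)
    nlinarith [sq_nonneg x]
  · have hsq : 1 ≤ x ^ 2 := (one_le_sq_iff_one_le_abs x).2 hx
    have hexp : |x| + 1 ≤ Real.exp |x| := Real.add_one_le_exp |x|
    rcases le_total 0 x with hx₀ | hx₀
    · rw [abs_of_nonneg hx₀] at *
      nlinarith
    · have := Real.exp_le_one_iff.2 hx₀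
      rw [abs_of_nonpos hx₀] at *
      nlinarith

theorem exp_mul_le_one_add_add_mul_exp_abs {θ l : ℝ} (hθ : 0 < θ) (hl : |l| ≤ θ / 2) (t : ℝ) :
    Real.exp (l * t) ≤ 1 + l * t + 8 * (l / θ) ^ 2 * Real.exp (θ * |t|) := by
  refine (exp_le_one_add_add_sq_mul_exp_abs _).trans ?_
  gcongr 1 + l * t + ?_
  set u := θ * |t| with hu
  have hsq : (l * t) ^ 2 = (l / θ) ^ 2 * u ^ 2 := by
    rw [hu, mul_pow, mul_pow, sq_abs]
    field_simp
  have habs : |l * t| ≤ u / 2 := by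
    rw [abs_mul, hu]
    nlinarith [abs_nonneg t]
  have hpoly : u ^ 2 ≤ 8 * Real.exp (u / 2) := by
    have := Real.quadratic_le_exp_of_nonneg (x := u / 2) (by positivity)
    have : 0 ≤ u := by positivity
    nlinarith
  calc (l * t) ^ 2 * Real.exp |l * t|
      ≤ (l / θ) ^ 2 * (8 * Real.exp (u / 2)) * Real.exp (u / 2) := by
        rw [hsq]
        gcongr
    _ = 8 * (l / θ) ^ 2 * (Real.exp (u / 2) * Real.exp (u / 2)) := by ring
    _ = 8 * (l / θ) ^ 2 * Real.exp u := by rw [← Real.exp_add, add_halves]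

theorem integral_exp_mul_le_of_centered [IsProbabilityMeasure μ] {ξ : Ω → ℝ} {θ l m : ℝ}
    (hθ : 0 < θ) (hξ : Integrable ξ μ) (hmean : ∫ ω, ξ ω ∂μ = 0)
    (hexp : Integrable (fun ω => Real.exp (θ * |ξ ω|)) μ)
    (hm : ∫ ω, Real.exp (θ * |ξ ω|) ∂μ ≤ m) (hl : |l| ≤ θ / 2) :
    ∫ ω, Real.exp (l * ξ ω) ∂μ ≤ Real.exp (8 * m * (l / θ) ^ 2) := by
  have hlin : Integrable (fun ω => 1 + l * ξ ω) μ := (integrable_const _).add (hξ.const_mul _)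
  calc ∫ ω, Real.exp (l * ξ ω) ∂μ
      ≤ ∫ ω, (1 + l * ξ ω + 8 * (l / θ) ^ 2 * Real.exp (θ * |ξ ω|)) ∂μ :=
        integral_mono_of_nonneg (.of_forall fun ω => (Real.exp_pos _).le)
          (hlin.add (hexp.const_mul _))
          (.of_forall fun ω => exp_mul_le_one_add_add_mul_exp_abs hθ hl (ξ ω))
    _ = 1 + 8 * (l / θ) ^ 2 * ∫ ω, Real.exp (θ * |ξ ω|) ∂μ := by
        rw [integral_add hlin (hexp.const_mul _),
          integral_add (integrable_const _) (hξ.const_mul _), integral_const_mul,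
          integral_const_mul, hmean]
        simp
    _ ≤ 8 * m * (l / θ) ^ 2 + 1 := by nlinarith [sq_nonneg (l / θ)]
    _ ≤ Real.exp (8 * m * (l / θ) ^ 2) := Real.add_one_le_exp _

theorem integral_exp_mul_sum_le [SigmaFinite μ] {B : ℕ} {ξ : Ω → ℝ} {l b : ℝ}
    (hb : ∫ ω, Real.exp (l * ξ ω) ∂μ ≤ Real.exp b) :
    ∫ ω : Fin B → Ω, Real.exp (l * ∑ j, ξ (ω j)) ∂Measure.pi (fun _ => μ) ≤ Real.exp (B * b) := by
  simp only [Finset.mul_sum, Real.exp_sum]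
  rw [integral_fintype_prod_eq_prod (f := fun _ ω => Real.exp (l * ξ ω)), Finset.prod_const,
    Finset.card_univ, Fintype.card_fin, Real.exp_nat_mul]
  exact pow_le_pow_left₀ (integral_nonneg fun ω => (Real.exp_pos _).le) hb B

end ExpMoments

section Extension

variable {d : ℕ} {p : ℝ≥0∞}

/-- The McShane extension of `f` from `S`, for the constant `M` and the `p`-norm. It carries an
objective known only near the feasible set to the whole space. -/
noncomputable def lipschitzExtension (p : ℝ≥0∞) (M : ℝ) (S : Set (Vec d)) (f : Vec d → ℝ)
    (y : Vec d) : ℝ :=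
  ⨅ x : S, (f x + M * pNorm p (y - (x : Vec d)))

variable {S : Set (Vec d)} {f : Vec d → ℝ} {M : ℝ}

theorem sub_le_add_mul_pNorm (hp : 1 ≤ p) (hM : 0 ≤ M)
    (hL : ∀ x ∈ S, ∀ y ∈ S, |f y - f x| ≤ M * pNorm p (y - x)) (y : Vec d) {x z : Vec d}
    (hx : x ∈ S) (hz : z ∈ S) :
    f z - M * pNorm p (y - z) ≤ f x + M * pNorm p (y - x) := by
  have hzx := (abs_le.1 (hL x hx z hz)).2
  have htriangle := mul_le_mul_of_nonneg_left (pNorm_sub_le hp z y x) hM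
  rw [pNorm_sub_comm hp z y] at htriangle
  linarith

theorem lipschitzExtension_le (hp : 1 ≤ p) (hM : 0 ≤ M)
    (hL : ∀ x ∈ S, ∀ y ∈ S, |f y - f x| ≤ M * pNorm p (y - x)) (y : Vec d) {x : Vec d}
    (hx : x ∈ S) : lipschitzExtension p M S f y ≤ f x + M * pNorm p (y - x) := by
  refine ciInf_le ⟨f x - M * pNorm p (y - x), ?_⟩ (⟨x, hx⟩ : S)
  rintro _ ⟨z, rfl⟩
  exact sub_le_add_mul_pNorm hp hM hL y z.2 hx

theorem lipschitzExtension_eq (hp : 1 ≤ p) (hM : 0 ≤ M)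
    (hL : ∀ x ∈ S, ∀ y ∈ S, |f y - f x| ≤ M * pNorm p (y - x)) {x : Vec d} (hx : x ∈ S) :
    lipschitzExtension p M S f x = f x := by
  have : Nonempty S := ⟨⟨x, hx⟩⟩
  refine le_antisymm ?_ (le_ciInf fun z => ?_)
  · simpa [pNorm_zero hp] using lipschitzExtension_le hp hM hL x hx
  · simpa [pNorm_zero hp] using sub_le_add_mul_pNorm hp hM hL x z.2 hx

theorem abs_lipschitzExtension_sub_le (hp : 1 ≤ p) (hS : S.Nonempty) (hM : 0 ≤ M)
    (hL : ∀ x ∈ S, ∀ y ∈ S, |f y - f x| ≤ M * pNorm p (y - x)) (x y : Vec d) :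
    |lipschitzExtension p M S f y - lipschitzExtension p M S f x| ≤ M * pNorm p (y - x) := by
  have : Nonempty S := hS.to_subtype
  have hone (x y : Vec d) : lipschitzExtension p M S f y - M * pNorm p (y - x)
      ≤ lipschitzExtension p M S f x := by
    refine le_ciInf fun z => ?_
    have := lipschitzExtension_le hp hM hL y z.2
    have := mul_le_mul_of_nonneg_left (pNorm_sub_le hp y x z) hM
    linarith
  rw [abs_sub_le_iff]
  constructor
  · linarith [hone x y]
  · rw [pNorm_sub_comm hp]
    linarith [hone y x]

theorem convexOn_lipschitzExtension (hp : 1 ≤ p) (hS : S.Nonempty) (hf : ConvexOn ℝ S f)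
    (hM : 0 ≤ M) (hL : ∀ x ∈ S, ∀ y ∈ S, |f y - f x| ≤ M * pNorm p (y - x)) :
    ConvexOn ℝ Set.univ (lipschitzExtension p M S f) := by
  have : Nonempty S := hS.to_subtype
  refine ⟨convex_univ, fun y₁ _ y₂ _ a b ha hb hab => le_of_forall_pos_le_add fun ε hε => ?_⟩
  obtain ⟨⟨x₁, hx₁⟩, h₁⟩ := exists_lt_of_ciInf_lt (lt_add_of_pos_right
    (lipschitzExtension p M S f y₁) hε)
  obtain ⟨⟨x₂, hx₂⟩, h₂⟩ := exists_lt_of_ciInf_lt (lt_add_of_pos_right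
    (lipschitzExtension p M S f y₂) hε)
  have hnorm : pNorm p (a • y₁ + b • y₂ - (a • x₁ + b • x₂))
      ≤ a * pNorm p (y₁ - x₁) + b * pNorm p (y₂ - x₂) := by
    have : a • y₁ + b • y₂ - (a • x₁ + b • x₂) = a • (y₁ - x₁) + b • (y₂ - x₂) := by module
    rw [this]
    refine (pNorm_add_le hp _ _).trans (le_of_eq ?_)
    rw [pNorm_smul hp, pNorm_smul hp, abs_of_nonneg ha, abs_of_nonneg hb]
  simp only [smul_eq_mul]
  calc lipschitzExtension p M S f (a • y₁ + b • y₂)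
      ≤ f (a • x₁ + b • x₂) + M * pNorm p (a • y₁ + b • y₂ - (a • x₁ + b • x₂)) :=
        lipschitzExtension_le hp hM hL _ (hf.1 hx₁ hx₂ ha hb hab)
    _ ≤ a * f x₁ + b * f x₂ + M * (a * pNorm p (y₁ - x₁) + b * pNorm p (y₂ - x₂)) := by
        gcongr
        exact hf.2 hx₁ hx₂ ha hb hab
    _ = a * (f x₁ + M * pNorm p (y₁ - x₁)) + b * (f x₂ + M * pNorm p (y₂ - x₂)) := by ring
    _ ≤ a * (lipschitzExtension p M S f y₁ + ε) + b * (lipschitzExtension p M S f y₂ + ε) := by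
        gcongr
    _ = a * lipschitzExtension p M S f y₁ + b * lipschitzExtension p M S f y₂ + ε := by
        linear_combination ε * hab

end Extension

section Smoothing

variable {d : ℕ} {γ : ℝ} {F G : Vec d → ℝ} {K : NNReal}

/-- The average of `F` over the ball of radius `γ` about `x`, that is, the smoothed function
`f_γ (x) = 𝔼_u F (x + γ u)`. -/
noncomputable def ballAverage (γ : ℝ) (F : Vec d → ℝ) (x : Vec d) : ℝ :=
  ((volume : Measure (Vec d)).real (Metric.ball 0 1))⁻¹ *
    ∫ u in Metric.ball (0 : Vec d) 1, F (x + γ • u)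

/-- The expectation of the two-point estimator `d (F (x + γ e) - F (x - γ e)) / (2γ) • e`, for `e`
uniform on the unit sphere; it is the gradient of the smoothed function. -/
noncomputable def sphereGradient (γ : ℝ) (F : Vec d → ℝ) (x : Vec d) : Vec d :=
  ∫ e : UnitSphere d, ((d : ℝ) * ((F (x + γ • (e : Vec d)) - F (x - γ • (e : Vec d))) / (2 * γ))) •
    (e : Vec d) ∂uniformSphere d

theorem ballAverage_congr {x : Vec d}
    (h : ∀ u : Vec d, ‖u‖ ≤ 1 → F (x + γ • u) = G (x + γ • u)) :
    ballAverage γ F x = ballAverage γ G x := by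
  unfold ballAverage
  congr 1
  exact setIntegral_congr_fun measurableSet_ball fun u hu => h u (mem_ball_zero_iff.1 hu).le

theorem sphereGradient_congr {x : Vec d}
    (h : ∀ u : Vec d, ‖u‖ ≤ 1 → F (x + γ • u) = G (x + γ • u)) :
    sphereGradient γ F x = sphereGradient γ G x := by
  refine integral_congr_ae (.of_forall fun e => ?_)
  have he : ‖(e : Vec d)‖ = 1 := by simp
  have hplus := h e he.le
  have hminus := h (-e) (by rw [norm_neg, he])
  rw [smul_neg, ← sub_eq_add_neg] at hminus
  simp only [hplus, hminus]

theorem volume_real_ball_pos : 0 < (volume : Measure (Vec d)).real (Metric.ball 0 1) :=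
  ENNReal.toReal_pos (Metric.measure_ball_pos _ _ one_pos).ne' measure_ball_lt_top.ne

theorem integrableOn_ball (hG : Continuous G) : IntegrableOn G (Metric.ball (0 : Vec d) 1) :=
  (hG.continuousOn.integrableOn_compact (isCompact_closedBall _ _)).mono_set
    Metric.ball_subset_closedBall

theorem ballAverage_const (c : ℝ) (x : Vec d) : ballAverage γ (fun _ => c) x = c := by
  rw [ballAverage, setIntegral_const, smul_eq_mul, inv_mul_cancel_left₀ volume_real_ball_pos.ne']

theorem ballAverage_le_ballAverage_add (hF : Continuous F) (hG : Continuous G) {x y : Vec d}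
    {c : ℝ} (h : ∀ u : Vec d, ‖u‖ ≤ 1 → F (x + γ • u) ≤ G (y + γ • u) + c) :
    ballAverage γ F x ≤ ballAverage γ G y + c := by
  rw [← ballAverage_const (γ := γ) c y, ballAverage, ballAverage, ballAverage, ← mul_add,
    ← integral_add (integrableOn_ball (by fun_prop)) (integrableOn_ball (by fun_prop))]
  refine mul_le_mul_of_nonneg_left (setIntegral_mono_on (integrableOn_ball (by fun_prop))
    (integrableOn_ball (by fun_prop)) measurableSet_ball fun u hu => h u ?_)
    (inv_pos.2 volume_real_ball_pos).le
  exact (mem_ball_zero_iff.1 hu).le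

theorem ballAverage_le (hK : LipschitzWith K F) (hγ : 0 ≤ γ) (x : Vec d) :
    ballAverage γ F x ≤ F x + γ * K := by
  calc ballAverage γ F x ≤ ballAverage γ (fun _ => F x) x + γ * K := by
        refine ballAverage_le_ballAverage_add hK.continuous continuous_const fun u hu => ?_
        have hlip := (abs_le.1 (abs_apply_add_sub_le hK x (γ • u))).2
        have hnorm : ‖γ • u‖ ≤ γ := by
          rw [norm_smul, Real.norm_eq_abs, abs_of_nonneg hγ]
          exact mul_le_of_le_one_right hγ hu
        have := mul_le_mul_of_nonneg_left hnorm K.coe_nonneg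
        linarith
    _ = F x + γ * K := by rw [ballAverage_const]

theorem setIntegral_ball_neg (g : Vec d → ℝ) :
    ∫ u in Metric.ball (0 : Vec d) 1, g (-u) = ∫ u in Metric.ball (0 : Vec d) 1, g u := by
  rw [← integral_indicator measurableSet_ball, ← integral_indicator measurableSet_ball,
    ← integral_neg_eq_self ((Metric.ball (0 : Vec d) 1).indicator g)]
  congr 1 with u
  simp [Set.indicator]

theorem le_ballAverage (hF : ConvexOn ℝ Set.univ F) (hFc : Continuous F) (x : Vec d) :
    F x ≤ ballAverage γ F x := by
  have hmidpoint (u : Vec d) : F x ≤ (F (x + γ • u) + F (x + γ • (-u))) / 2 := by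
    have hx : (1 / 2 : ℝ) • (x + γ • u) + (1 / 2 : ℝ) • (x + γ • (-u)) = x := by module
    have := hF.2 (Set.mem_univ (x + γ • u)) (Set.mem_univ (x + γ • (-u))) one_half_pos.le
      one_half_pos.le (add_halves (1 : ℝ))
    rw [hx, smul_eq_mul, smul_eq_mul] at this
    linarith
  have hintegral : ∫ _u in Metric.ball (0 : Vec d) 1, F x
      ≤ ∫ u in Metric.ball (0 : Vec d) 1, (F (x + γ • u) + F (x + γ • (-u))) / 2 :=
    setIntegral_mono_on (integrableOn_ball (by fun_prop)) (integrableOn_ball (by fun_prop))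
      measurableSet_ball fun u _ => hmidpoint u
  rw [integral_div, integral_add (integrableOn_ball (by fun_prop))
    (integrableOn_ball (by fun_prop)), setIntegral_ball_neg fun u => F (x + γ • u),
    setIntegral_const, smul_eq_mul] at hintegral
  rw [ballAverage, le_inv_mul_iff₀ volume_real_ball_pos]
  linarith

variable [NeZero d]

theorem inner_sphereGradient (hF : Continuous F) (x v : Vec d) :
    inner ℝ (sphereGradient γ F x) v = ∫ e : UnitSphere d,
      (d : ℝ) * ((F (x + γ • (e : Vec d)) - F (x - γ • (e : Vec d))) / (2 * γ)) *
        inner ℝ (e : Vec d) v ∂uniformSphere d := by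
  rw [real_inner_comm, sphereGradient,
    ← integral_inner (integrable_of_continuous_of_compactSpace (by fun_prop))]
  simp only [inner_smul_right, real_inner_comm]

theorem inner_sphereGradient_eq (hF : Continuous F) (hγ : 0 < γ) (x v : Vec d) :
    inner ℝ (sphereGradient γ F x) v = d / γ *
      ∫ e : UnitSphere d, inner ℝ (e : Vec d) v * F (x + γ • (e : Vec d)) ∂uniformSphere d := by
  set φ : Vec d → ℝ := fun e => inner ℝ e v * F (x + γ • e)
  have hsplit (e : UnitSphere d) :
      (d : ℝ) * ((F (x + γ • (e : Vec d)) - F (x - γ • (e : Vec d))) / (2 * γ)) *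
        inner ℝ (e : Vec d) v = d / (2 * γ) * (φ e + φ (-e)) := by
    simp only [φ, inner_neg_left, smul_neg, ← sub_eq_add_neg]
    field_simp
    ring
  rw [inner_sphereGradient hF, integral_congr_ae (.of_forall hsplit), integral_const_mul,
    integral_add (integrable_of_continuous_of_compactSpace (by fun_prop))
      (integrable_of_continuous_of_compactSpace (by fun_prop)), integral_neg_uniformSphere φ]
  field_simp
  ring

theorem inner_sphereGradient_le (hF : ConvexOn ℝ Set.univ F) (hK : LipschitzWith K F)
    (hγ : 0 < γ) (x v : Vec d) :
    inner ℝ (sphereGradient γ F x) v ≤ ballAverage γ F (x + v) - ballAverage γ F x := by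
  have hFc := hK.continuous
  have hconvex : ConvexOn ℝ Set.univ fun u : Vec d => F (x + γ • u) := by
    refine ⟨convex_univ, fun u _ w _ a b ha hb hab => ?_⟩
    have hcomb : x + γ • (a • u + b • w) = a • (x + γ • u) + b • (x + γ • w) := by
      rw [smul_add a, smul_add b, add_add_add_comm, ← add_smul, hab, one_smul]
      module
    simpa only [hcomb] using hF.2 (Set.mem_univ (x + γ • u)) (Set.mem_univ (x + γ • w)) ha hb hab
  have hlipschitz : LipschitzWith (K * ‖γ‖₊) fun u : Vec d => F (x + γ • u) := by
    refine hK.comp (LipschitzWith.of_dist_le_mul fun u w => ?_)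
    rw [dist_add_left, dist_smul₀, coe_nnnorm]
  have hflux := sphereFlux_le_integral_ball hconvex hlipschitz (γ⁻¹ • v)
  have hshift (u : Vec d) : x + γ • (u + γ⁻¹ • v) = x + v + γ • u := by
    rw [smul_add, smul_inv_smul₀ hγ.ne']
    abel
  simp only [hshift, inner_smul_right, mul_assoc] at hflux
  rw [integral_const_mul, integral_sub (integrableOn_ball (by fun_prop))
    (integrableOn_ball (by fun_prop))] at hflux
  rw [inner_sphereGradient_eq hFc hγ, ballAverage, ballAverage, ← mul_sub,
    le_inv_mul_iff₀ volume_real_ball_pos]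
  refine le_trans (le_of_eq ?_) hflux
  ring

theorem integral_abs_inner_uniformSphere_le (v : Vec d) :
    ∫ e : UnitSphere d, |inner ℝ (e : Vec d) v| ∂uniformSphere d ≤ ‖v‖ / √d := by
  have hjensen : (∫ e : UnitSphere d, |inner ℝ v (e : Vec d)| ∂uniformSphere d) ^ 2
      ≤ ∫ e : UnitSphere d, |inner ℝ v (e : Vec d)| ^ 2 ∂uniformSphere d :=
    (even_two.convexOn_pow (𝕜 := ℝ)).map_integral_le (continuous_pow 2).continuousOn isClosed_univ
      (.of_forall fun _ => Set.mem_univ _)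
      (integrable_of_continuous_of_compactSpace (by fun_prop))
      (integrable_of_continuous_of_compactSpace (by fun_prop))
  simp only [sq_abs] at hjensen
  rw [integral_inner_sq_uniformSphere] at hjensen
  simp only [real_inner_comm v]
  refine le_of_abs_le (abs_le_of_sq_le_sq (hjensen.trans_eq ?_) (by positivity))
  rw [div_pow, Real.sq_sqrt d.cast_nonneg]

theorem inner_sphereGradient_sub_le (hF : Continuous F) (hγ : 0 < γ) {c : ℝ} (hc : 0 ≤ c)
    {x y : Vec d} (hFc : ∀ u, |F (y + u) - F (x + u)| ≤ c) (v : Vec d) :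
    inner ℝ (sphereGradient γ F y - sphereGradient γ F x) v ≤ √d / γ * c * ‖v‖ := by
  have hpointwise (e : UnitSphere d) : inner ℝ (e : Vec d) v * F (y + γ • (e : Vec d))
      - inner ℝ (e : Vec d) v * F (x + γ • (e : Vec d)) ≤ c * |inner ℝ (e : Vec d) v| := by
    rw [← mul_sub, mul_comm c]
    refine (le_abs_self _).trans ?_
    rw [abs_mul]
    exact mul_le_mul_of_nonneg_left (hFc _) (abs_nonneg _)
  rw [inner_sub_left, inner_sphereGradient_eq hF hγ, inner_sphereGradient_eq hF hγ, ← mul_sub,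
    ← integral_sub (integrable_of_continuous_of_compactSpace (by fun_prop))
      (integrable_of_continuous_of_compactSpace (by fun_prop))]
  calc d / γ * ∫ e : UnitSphere d, (inner ℝ (e : Vec d) v * F (y + γ • (e : Vec d))
          - inner ℝ (e : Vec d) v * F (x + γ • (e : Vec d))) ∂uniformSphere d
      ≤ d / γ * ∫ e : UnitSphere d, c * |inner ℝ (e : Vec d) v| ∂uniformSphere d := by
        gcongr
        · exact integrable_of_continuous_of_compactSpace (by fun_prop)
        · exact integrable_of_continuous_of_compactSpace (by fun_prop)
        · exact hpointwise
    _ ≤ d / γ * (c * (‖v‖ / √d)) := by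
        rw [integral_const_mul]
        gcongr
        exact integral_abs_inner_uniformSphere_le v
    _ = d / √d / γ * c * ‖v‖ := by ring
    _ = √d / γ * c * ‖v‖ := by rw [Real.div_sqrt]

end Smoothing

section Variance

theorem integral_exp_mul_abs_sub_integral_le {Ω : Type*} [MeasurableSpace Ω] {μ : Measure Ω}
    [IsProbabilityMeasure μ] {X : Ω → ℝ} {θ : ℝ} (hθ : 0 ≤ θ) (hX : Integrable X μ)
    (hexp : Integrable (fun ω => Real.exp (θ * |X ω|)) μ) :
    ∫ ω, Real.exp (θ * |X ω - ∫ ω, X ω ∂μ|) ∂μ ≤ (∫ ω, Real.exp (θ * |X ω|) ∂μ) ^ 2 := by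
  set m := ∫ ω, X ω ∂μ
  have hjensen : Real.exp (θ * |m|) ≤ ∫ ω, Real.exp (θ * |X ω|) ∂μ := calc
    Real.exp (θ * |m|) ≤ Real.exp (∫ ω, θ * |X ω| ∂μ) := by
        rw [integral_const_mul]
        gcongr
        exact abs_integral_le_integral_abs
    _ ≤ ∫ ω, Real.exp (θ * |X ω|) ∂μ :=
        convexOn_exp.map_integral_le Real.continuous_exp.continuousOn isClosed_univ
          (.of_forall fun _ => Set.mem_univ _) (hX.abs.const_mul θ) hexp
  calc ∫ ω, Real.exp (θ * |X ω - m|) ∂μ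
      ≤ ∫ ω, Real.exp (θ * |X ω|) * Real.exp (θ * |m|) ∂μ := by
        refine integral_mono_of_nonneg (.of_forall fun _ => (Real.exp_pos _).le)
          (hexp.mul_const _) (.of_forall fun ω => ?_)
        simp only [← Real.exp_add, ← mul_add]
        gcongr
        exact abs_sub _ _
    _ ≤ (∫ ω, Real.exp (θ * |X ω|) ∂μ) ^ 2 := by
        rw [integral_mul_const, sq]
        gcongr

theorem integrable_rpow_of_le_one {Ω : Type*} [MeasurableSpace Ω] {μ : Measure Ω}
    [IsFiniteMeasure μ] {g : Ω → ℝ} {a : ℝ} (hg : Integrable g μ) (hg₀ : ∀ ω, 0 ≤ g ω)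
    (ha : 0 ≤ a) (ha₁ : a ≤ 1) : Integrable (fun ω => g ω ^ a) μ := by
  refine ((integrable_const (1 : ℝ)).add hg).mono'
    (hg.aestronglyMeasurable.aemeasurable.pow_const a).aestronglyMeasurable
    (.of_forall fun ω => ?_)
  rw [Real.norm_of_nonneg (Real.rpow_nonneg (hg₀ ω) a)]
  calc g ω ^ a ≤ (1 + g ω) ^ a := by
        have := hg₀ ω
        gcongr
        linarith
    _ ≤ 1 + g ω := Real.rpow_le_self_of_one_le (by linarith [hg₀ ω]) ha₁

theorem integral_rpow_le_rpow_integral {Ω : Type*} [MeasurableSpace Ω] {μ : Measure Ω}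
    [IsProbabilityMeasure μ] {g : Ω → ℝ} {a : ℝ} (hg : Integrable g μ) (hg₀ : ∀ ω, 0 ≤ g ω)
    (ha : 0 ≤ a) (ha₁ : a ≤ 1) : ∫ ω, g ω ^ a ∂μ ≤ (∫ ω, g ω ∂μ) ^ a :=
  (Real.concaveOn_rpow ha ha₁).le_map_integral
    (continuousOn_id.rpow_const fun _ _ => .inr ha) isClosed_Ici (.of_forall hg₀) hg
    (integrable_rpow_of_le_one hg hg₀ ha ha₁)

variable {d : ℕ}

theorem pNorm_sq_le_rpow_sum_exp {ρ l : ℝ} (hρ : 1 ≤ ρ) (hl : 0 < l) (s : Vec d) :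
    pNorm (ENNReal.ofReal ρ) s ^ 2
      ≤ (ρ / l) ^ 2 * (∑ i, Real.exp (l * |s i|)) ^ (2 / ρ) := by
  have hρ₀ : 0 < ρ := one_pos.trans_le hρ
  have htoReal : (ENNReal.ofReal ρ).toReal = ρ := ENNReal.toReal_ofReal hρ₀.le
  have hnorm := pNorm_nonneg (ENNReal.one_le_ofReal.2 hρ) s
  have hcoordinate (i : Fin d) : |s i| ^ ρ ≤ (ρ / l) ^ ρ * Real.exp (l * |s i|) := by
    have hexp := Real.add_one_le_exp (l * |s i| / ρ)
    calc |s i| ^ ρ ≤ (ρ / l * Real.exp (l * |s i| / ρ)) ^ ρ := by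
          gcongr
          calc |s i| = ρ / l * (l * |s i| / ρ) := by field_simp
            _ ≤ ρ / l * Real.exp (l * |s i| / ρ) := by gcongr; linarith
      _ = (ρ / l) ^ ρ * Real.exp (l * |s i|) := by
          rw [Real.mul_rpow (by positivity) (Real.exp_pos _).le, ← Real.exp_mul,
            div_mul_cancel₀ _ hρ₀.ne']
  have hsum : pNorm (ENNReal.ofReal ρ) s ^ ρ ≤ (ρ / l) ^ ρ * ∑ i, Real.exp (l * |s i|) := by
    have hpow := pNorm_rpow (htoReal.symm ▸ hρ₀) s
    rw [htoReal] at hpow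
    rw [hpow, Finset.mul_sum]
    exact Finset.sum_le_sum fun i _ => hcoordinate i
  have hpower := Real.rpow_le_rpow (by positivity) hsum (by positivity : 0 ≤ 2 / ρ)
  rw [← Real.rpow_mul hnorm, Real.mul_rpow (by positivity) (by positivity),
    ← Real.rpow_mul (by positivity), mul_div_cancel₀ _ hρ₀.ne'] at hpower
  exact_mod_cast hpower

theorem integral_pNorm_sq_le_of_integral_exp_le {Ω : Type*} [MeasurableSpace Ω] {μ : Measure Ω}
    [IsProbabilityMeasure μ] {S : Ω → Vec d} {ρ l c : ℝ} (hρ : 2 ≤ ρ) (hl : 0 < l)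
    (hexp : ∀ i, Integrable (fun ω => Real.exp (l * |S ω i|)) μ)
    (hc : ∀ i, ∫ ω, Real.exp (l * |S ω i|) ∂μ ≤ c) :
    ∫ ω, pNorm (ENNReal.ofReal ρ) (S ω) ^ 2 ∂μ ≤ (ρ / l) ^ 2 * (d * c) ^ (2 / ρ) := by
  have hexponent : 2 / ρ ≤ 1 := (div_le_one (two_pos.trans_le hρ)).2 hρ
  have hexponent₀ : 0 ≤ 2 / ρ := div_nonneg two_pos.le (two_pos.le.trans hρ)
  set W : Ω → ℝ := fun ω => ∑ i, Real.exp (l * |S ω i|)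
  have hW : Integrable W μ := integrable_finsetSum _ fun i _ => hexp i
  have hW₀ (ω : Ω) : 0 ≤ W ω := Finset.sum_nonneg fun i _ => (Real.exp_pos _).le
  have hW_le : ∫ ω, W ω ∂μ ≤ d * c := by
    rw [integral_finsetSum _ fun i _ => hexp i]
    simpa using Finset.sum_le_card_nsmul Finset.univ _ c fun i _ => hc i
  calc ∫ ω, pNorm (ENNReal.ofReal ρ) (S ω) ^ 2 ∂μ ≤ ∫ ω, (ρ / l) ^ 2 * W ω ^ (2 / ρ) ∂μ :=
        integral_mono_of_nonneg (.of_forall fun _ => sq_nonneg _)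
          ((integrable_rpow_of_le_one hW hW₀ hexponent₀ hexponent).const_mul _)
          (.of_forall fun ω => pNorm_sq_le_rpow_sum_exp (one_le_two.trans hρ) hl _)
    _ ≤ (ρ / l) ^ 2 * (∫ ω, W ω ∂μ) ^ (2 / ρ) := by
        rw [integral_const_mul]
        gcongr
        exact integral_rpow_le_rpow_integral hW hW₀ hexponent₀ hexponent
    _ ≤ (ρ / l) ^ 2 * (d * c) ^ (2 / ρ) := by
        gcongr

/-- The numerical constant in the bound for the variance of the batch gradient. -/
noncomputable def varianceConst : ℝ := 8 * 180 ^ 2 * Real.exp 16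

theorem varianceConst_pos : 0 < varianceConst := by
  unfold varianceConst
  positivity

section SumOfIndependentCopies

variable {Ω : Type*} [MeasurableSpace Ω] {μ : Measure Ω} [IsProbabilityMeasure μ] {B : ℕ}

theorem integrable_exp_mul_sum {ξ : Ω → ℝ} {θ l : ℝ} (hξ : AEStronglyMeasurable ξ μ)
    (hexp : Integrable (fun ω => Real.exp (θ * |ξ ω|)) μ) (hl : |l| ≤ θ) :
    Integrable (fun ω : Fin B → Ω => Real.exp (l * ∑ j, ξ (ω j))) (Measure.pi fun _ => μ) := by
  simp only [Finset.mul_sum, Real.exp_sum]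
  refine Integrable.fintype_prod (f := fun _ ω => Real.exp (l * ξ ω)) fun _ =>
    hexp.mono' (Real.continuous_exp.comp_aestronglyMeasurable (hξ.const_mul l))
      (.of_forall fun ω => ?_)
  rw [Real.norm_of_nonneg (Real.exp_pos _).le, Real.exp_le_exp]
  calc l * ξ ω ≤ |l| * |ξ ω| := (le_abs_self _).trans_eq (abs_mul _ _)
    _ ≤ θ * |ξ ω| := by gcongr

theorem exp_mul_abs_le (l t : ℝ) : Real.exp (l * |t|) ≤ Real.exp (l * t) + Real.exp (-l * t) := by
  rcases abs_choice t with ht | ht <;> rw [ht]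
  · exact le_add_of_nonneg_right (Real.exp_pos _).le
  · rw [mul_neg, ← neg_mul]
    exact le_add_of_nonneg_left (Real.exp_pos _).le

theorem integrable_exp_mul_abs_sum {ξ : Ω → ℝ} {θ l : ℝ} (hξ : AEStronglyMeasurable ξ μ)
    (hexp : Integrable (fun ω => Real.exp (θ * |ξ ω|)) μ) (hl : |l| ≤ θ) :
    Integrable (fun ω : Fin B → Ω => Real.exp (l * |∑ j, ξ (ω j)|)) (Measure.pi fun _ => μ) := by
  have hsum : AEStronglyMeasurable (fun ω : Fin B → Ω => ∑ j, ξ (ω j)) (Measure.pi fun _ => μ) :=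
    Finset.aestronglyMeasurable_fun_sum _ fun j _ =>
      hξ.comp_measurePreserving (measurePreserving_eval _ j)
  refine ((integrable_exp_mul_sum hξ hexp hl).add
    (integrable_exp_mul_sum hξ hexp ((abs_neg l).trans_le hl))).mono'
    (Real.continuous_exp.comp_aestronglyMeasurable
      (continuous_abs.comp_aestronglyMeasurable hsum |>.const_mul l)) (.of_forall fun ω => ?_)
  rw [Real.norm_of_nonneg (Real.exp_pos _).le]
  exact exp_mul_abs_le _ _

theorem integral_exp_mul_abs_sum_le {ξ : Ω → ℝ} {θ l m : ℝ} (hθ : 0 < θ) (hξ : Integrable ξ μ)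
    (hmean : ∫ ω, ξ ω ∂μ = 0) (hexp : Integrable (fun ω => Real.exp (θ * |ξ ω|)) μ)
    (hm : ∫ ω, Real.exp (θ * |ξ ω|) ∂μ ≤ m) (hl : |l| ≤ θ / 2) :
    ∫ ω : Fin B → Ω, Real.exp (l * |∑ j, ξ (ω j)|) ∂Measure.pi (fun _ => μ)
      ≤ 2 * Real.exp (B * (8 * m * (l / θ) ^ 2)) := by
  have hmgf {l' : ℝ} (hl' : |l'| = |l|) :
      ∫ ω : Fin B → Ω, Real.exp (l' * ∑ j, ξ (ω j)) ∂Measure.pi (fun _ => μ)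
        ≤ Real.exp (B * (8 * m * (l / θ) ^ 2)) := by
    rw [div_pow, ← sq_abs l, ← hl', sq_abs, ← div_pow]
    exact integral_exp_mul_sum_le
      (integral_exp_mul_le_of_centered hθ hξ hmean hexp hm (hl'.trans_le hl))
  have hl' : |l| ≤ θ := hl.trans (half_le_self hθ.le)
  have hint := integrable_exp_mul_sum (B := B) hξ.aestronglyMeasurable hexp hl'
  have hint' := integrable_exp_mul_sum (B := B) (l := -l) hξ.aestronglyMeasurable hexp
    ((abs_neg l).trans_le hl')
  calc ∫ ω : Fin B → Ω, Real.exp (l * |∑ j, ξ (ω j)|) ∂Measure.pi (fun _ => μ)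
      ≤ ∫ ω : Fin B → Ω, (Real.exp (l * ∑ j, ξ (ω j)) + Real.exp (-l * ∑ j, ξ (ω j)))
          ∂Measure.pi (fun _ => μ) :=
        integral_mono_of_nonneg (.of_forall fun _ => (Real.exp_pos _).le) (hint.add hint')
          (.of_forall fun ω => exp_mul_abs_le _ _)
    _ ≤ 2 * Real.exp (B * (8 * m * (l / θ) ^ 2)) := by
        rw [integral_add hint hint', two_mul]
        exact add_le_add (hmgf rfl) (hmgf (abs_neg l))

/-- The sum of the vectors with coordinates `ξ i (ω j)`, `i < d`, over the `B` independent
samples `ω j`. -/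
noncomputable def sampleSum (ξ : Fin d → Ω → ℝ) (ω : Fin B → Ω) : Vec d :=
  WithLp.toLp 2 fun i => ∑ j, ξ i (ω j)

theorem integral_pNorm_sq_sampleSum_le {ρ : ℝ} (hρ : 2 ≤ ρ) (hB : ρ ≤ B)
    {ξ : Fin d → Ω → ℝ} {θ m : ℝ} (hθ : 0 < θ) (hξ : ∀ i, Integrable (ξ i) μ)
    (hmean : ∀ i, ∫ ω, ξ i ω ∂μ = 0) (hexp : ∀ i, Integrable (fun ω => Real.exp (θ * |ξ i ω|)) μ)
    (hm : ∀ i, ∫ ω, Real.exp (θ * |ξ i ω|) ∂μ ≤ m) :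
    ∫ ω : Fin B → Ω, pNorm (ENNReal.ofReal ρ) (sampleSum ξ ω) ^ 2 ∂Measure.pi (fun _ => μ)
      ≤ 8 / θ ^ 2 * Real.exp (4 * m) * ρ * (d : ℝ) ^ (2 / ρ) * B := by
  have hρ₀ : 0 < ρ := two_pos.trans_le hρ
  have hB₀ : (0 : ℝ) < B := hρ₀.trans_le hB
  set l := θ / 2 * √(ρ / B)
  have hl : 0 < l := by positivity
  have hl_sq : l ^ 2 = θ ^ 2 * ρ / (4 * B) := by
    rw [mul_pow, Real.sq_sqrt (by positivity)]
    ring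
  have hl_le : |l| ≤ θ / 2 := by
    rw [abs_of_pos hl]
    exact mul_le_of_le_one_right (by positivity) (Real.sqrt_le_one.2 ((div_le_one hB₀).2 hB))
  have hexponent : B * (8 * m * (l / θ) ^ 2) = 2 * m * ρ := by
    rw [div_pow, hl_sq]
    field_simp
    ring
  calc ∫ ω : Fin B → Ω, pNorm (ENNReal.ofReal ρ) (sampleSum ξ ω) ^ 2 ∂Measure.pi (fun _ => μ)
      ≤ (ρ / l) ^ 2 * (d * (2 * Real.exp (2 * m * ρ))) ^ (2 / ρ) := by
        refine integral_pNorm_sq_le_of_integral_exp_le hρ hl (fun i => ?_) (fun i => ?_)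
        · exact integrable_exp_mul_abs_sum (hξ i).aestronglyMeasurable (hexp i)
            (hl_le.trans (half_le_self hθ.le))
        · rw [← hexponent]
          exact integral_exp_mul_abs_sum_le hθ (hξ i) (hmean i) (hexp i) (hm i) hl_le
    _ = (ρ / l) ^ 2 * ((d : ℝ) ^ (2 / ρ) * (2 ^ (2 / ρ) * Real.exp (4 * m))) := by
        rw [Real.mul_rpow d.cast_nonneg (by positivity), Real.mul_rpow two_pos.le (by positivity),
          ← Real.exp_mul]
        congr 4
        field_simp
        ring
    _ ≤ (ρ / l) ^ 2 * ((d : ℝ) ^ (2 / ρ) * (2 * Real.exp (4 * m))) := by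
        gcongr
        exact Real.rpow_le_self_of_one_le one_le_two ((div_le_one hρ₀).2 hρ)
    _ = 8 / θ ^ 2 * Real.exp (4 * m) * ρ * (d : ℝ) ^ (2 / ρ) * B := by
        rw [div_pow, hl_sq]
        field_simp
        ring

end SumOfIndependentCopies

section BatchGradient

variable {γ : ℝ} {F : Vec d → ℝ} {K : NNReal}

/-- The symmetric difference quotient of `F` at `x`, normalized so that it is `1`-Lipschitz in `u`
for a `K`-Lipschitz function `F`. -/
noncomputable def symmDiffQuotient (γ : ℝ) (K : NNReal) (F : Vec d → ℝ) (x u : Vec d) : ℝ :=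
  (F (x + γ • u) - F (x - γ • u)) / (2 * γ * K)

theorem symmDiffQuotient_neg (x u : Vec d) :
    symmDiffQuotient γ K F x (-u) = -symmDiffQuotient γ K F x u := by
  rw [symmDiffQuotient, symmDiffQuotient, smul_neg, sub_neg_eq_add, ← sub_eq_add_neg, ← neg_div,
    neg_sub]

theorem lipschitzWith_symmDiffQuotient (hK₀ : 0 < K) (hK : LipschitzWith K F) (hγ : 0 < γ)
    (x : Vec d) : LipschitzWith 1 (symmDiffQuotient γ K F x) := by
  refine LipschitzWith.of_dist_le_mul fun u w => ?_
  have hplus : |F (x + γ • u) - F (x + γ • w)| ≤ K * (γ * dist u w) := by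
    simpa [Real.dist_eq, dist_smul₀, abs_of_pos hγ] using hK.dist_le_mul (x + γ • u) (x + γ • w)
  have hminus : |F (x - γ • u) - F (x - γ • w)| ≤ K * (γ * dist u w) := by
    rw [← Real.norm_of_nonneg hγ.le, ← dist_smul₀, ← dist_sub_left x, ← Real.dist_eq,
      Real.norm_of_nonneg hγ.le]
    exact hK.dist_le_mul _ _
  rw [NNReal.coe_one, one_mul, Real.dist_eq, symmDiffQuotient, symmDiffQuotient, ← sub_div, abs_div,
    abs_of_pos (by positivity : 0 < 2 * γ * (K : ℝ)), div_le_iff₀ (by positivity),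
    sub_sub_sub_comm]
  linarith [abs_sub (F (x + γ • u) - F (x + γ • w)) (F (x - γ • u) - F (x - γ • w))]

/-- The deviation from its mean of the `i`-th coordinate of the two-point gradient estimator in the
direction `e`, divided by the Lipschitz constant `K`. -/
noncomputable def estimatorNoise (γ : ℝ) (K : NNReal) (F : Vec d → ℝ) (x : Vec d) (i : Fin d)
    (e : UnitSphere d) : ℝ :=
  d * symmDiffQuotient γ K F x e * (e : Vec d) i -
    ∫ e : UnitSphere d, d * symmDiffQuotient γ K F x e * (e : Vec d) i ∂uniformSphere d

theorem continuous_estimatorNoise (hF : Continuous F) (x : Vec d) (i : Fin d) :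
    Continuous (estimatorNoise γ K F x i) := by
  unfold estimatorNoise symmDiffQuotient
  fun_prop

variable [NeZero d]

theorem integral_estimatorNoise (hF : Continuous F) (x : Vec d) (i : Fin d) :
    ∫ e, estimatorNoise γ K F x i e ∂uniformSphere d = 0 := by
  have hint : Integrable (fun e : UnitSphere d => d * symmDiffQuotient γ K F x e * (e : Vec d) i)
      (uniformSphere d) := by
    refine integrable_of_continuous_of_compactSpace ?_
    unfold symmDiffQuotient
    fun_prop
  simp only [estimatorNoise]
  rw [integral_sub hint (integrable_const _), integral_const, probReal_univ, one_smul, sub_self]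

theorem integral_exp_mul_abs_estimatorNoise_le (hK₀ : 0 < K) (hK : LipschitzWith K F) (hγ : 0 < γ)
    (x : Vec d) (i : Fin d) :
    ∫ e, Real.exp (1 / 180 * |estimatorNoise γ K F x i e|) ∂uniformSphere d ≤ 4 := by
  have hH := lipschitzWith_symmDiffQuotient hK₀ hK hγ x
  have hHc := hH.continuous
  have hcoord : LipschitzWith 1 fun u : Vec d => u i :=
    LipschitzWith.of_dist_le_mul fun u w => by
      simpa [dist_eq_norm] using PiLp.norm_apply_le (u - w) i
  have hmoment := integral_exp_abs_mul_uniformSphere_le (c := 1 / 180) hH (symmDiffQuotient_neg x)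
    hcoord (fun _ => rfl) (by norm_num) (by norm_num)
  refine (integral_exp_mul_abs_sub_integral_le (by norm_num)
    (integrable_of_continuous_of_compactSpace (by fun_prop))
    (integrable_of_continuous_of_compactSpace (by fun_prop))).trans ?_
  exact (pow_le_pow_left₀ (integral_nonneg fun _ => (Real.exp_pos _).le) hmoment 2).trans
    (by norm_num)

theorem sphereGradient_apply (hK₀ : 0 < K) (hF : Continuous F) (x : Vec d) (i : Fin d) :
    sphereGradient γ F x i = K * ∫ e : UnitSphere d,
      d * symmDiffQuotient γ K F x e * (e : Vec d) i ∂uniformSphere d := by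
  have hinner := inner_sphereGradient (γ := γ) hF x (EuclideanSpace.single i (1 : ℝ))
  simp only [EuclideanSpace.inner_single_right, one_mul, conj_trivial] at hinner
  rw [hinner, ← integral_const_mul]
  refine integral_congr_ae (.of_forall fun e => ?_)
  have hK₀' : (K : ℝ) ≠ 0 := NNReal.coe_ne_zero.2 hK₀.ne'
  simp only [symmDiffQuotient]
  field_simp

theorem batchGradient_sub_sphereGradient (hK₀ : 0 < K) (hF : Continuous F) (x : Vec d) {B : ℕ}
    (hB : B ≠ 0) (ω : Fin B → UnitSphere d) :
    batchGradient γ ω (fun j => F (x + γ • (ω j : Vec d))) (fun j => F (x - γ • (ω j : Vec d)))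
      - sphereGradient γ F x = ((K : ℝ) / B) • sampleSum (estimatorNoise γ K F x) ω := by
  have hK₀' : (K : ℝ) ≠ 0 := NNReal.coe_ne_zero.2 hK₀.ne'
  have hB' : (B : ℝ) ≠ 0 := Nat.cast_ne_zero.2 hB
  ext i
  simp only [PiLp.sub_apply, PiLp.smul_apply, smul_eq_mul, batchGradient, sampleSum,
    sphereGradient_apply hK₀ hF, estimatorNoise, WithLp.ofLp_sum, Finset.sum_apply,
    Finset.sum_sub_distrib, Finset.sum_const, Finset.card_univ, Fintype.card_fin, nsmul_eq_mul]
  rw [mul_sub, Finset.mul_sum, Finset.mul_sum]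
  congr 1
  · refine Finset.sum_congr rfl fun j _ => ?_
    rw [symmDiffQuotient]
    field_simp
  · field_simp

theorem integral_pNorm_sq_batchGradient_sub_le (hK₀ : 0 < K) (hK : LipschitzWith K F)
    (hγ : 0 < γ) (x : Vec d) {ρ : ℝ} (hρ : 2 ≤ ρ) {B : ℕ} (hB : ρ ≤ B) :
    ∫ ω : Fin B → UnitSphere d, pNorm (ENNReal.ofReal ρ) (batchGradient γ ω
        (fun j => F (x + γ • (ω j : Vec d))) (fun j => F (x - γ • (ω j : Vec d)))
          - sphereGradient γ F x) ^ 2 ∂Measure.pi (fun _ => uniformSphere d)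
      ≤ varianceConst * ρ * (d : ℝ) ^ (2 / ρ) * (K : ℝ) ^ 2 / B := by
  have hF := hK.continuous
  have hB₀ : B ≠ 0 := by
    rintro rfl
    norm_num at hB
    linarith
  have hB' : (B : ℝ) ≠ 0 := Nat.cast_ne_zero.2 hB₀
  have hnoise (i : Fin d) := continuous_estimatorNoise (γ := γ) (K := K) hF x i
  simp only [batchGradient_sub_sphereGradient hK₀ hF x hB₀,
    pNorm_smul (ENNReal.one_le_ofReal.2 (one_le_two.trans hρ)), mul_pow, sq_abs, integral_const_mul]
  calc _ ≤ ((K : ℝ) / B) ^ 2 * (8 / (1 / 180) ^ 2 * Real.exp (4 * 4) * ρ * d ^ (2 / ρ) * B) := by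
        gcongr
        exact integral_pNorm_sq_sampleSum_le hρ hB (by norm_num)
          (fun i => integrable_of_continuous_of_compactSpace (hnoise i))
          (integral_estimatorNoise hF x)
          (fun i => integrable_of_continuous_of_compactSpace (by have := hnoise i; fun_prop))
          (integral_exp_mul_abs_estimatorNoise_le hK₀ hK hγ x)
    _ = varianceConst * ρ * (d : ℝ) ^ (2 / ρ) * (K : ℝ) ^ 2 / B := by
        rw [varianceConst, show (4 * 4 : ℝ) = 16 by norm_num]
        field_simp

end BatchGradient

end Variance
/-- The two-point batch estimator as a function of the point and of the directions. -/
noncomputable def batchEstimate {d B : ℕ} (γ : ℝ) (f : Vec d → ℝ) (x : Vec d)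
    (ω : Fin B → UnitSphere d) : Vec d :=
  batchGradient γ ω (fun j => f (x + γ • (ω j : Vec d))) (fun j => f (x - γ • (ω j : Vec d)))

section BatchEstimate

variable {d B : ℕ} {γ : ℝ} {Q : Set (Vec d)} {f F : Vec d → ℝ}

theorem continuous_batchEstimate (hF : Continuous F) :
    Continuous fun z : Vec d × (Fin B → UnitSphere d) => batchEstimate γ F z.1 z.2 := by
  unfold batchEstimate batchGradient
  fun_prop

theorem add_smul_mem_cthickening (hγ : 0 ≤ γ) {x u : Vec d} (hx : x ∈ Q) (hu : ‖u‖ ≤ 1) :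
    x + γ • u ∈ Metric.cthickening γ Q := by
  refine Metric.mem_cthickening_of_dist_le _ x _ _ hx ?_
  rw [dist_eq_norm, add_sub_cancel_left, norm_smul, Real.norm_of_nonneg hγ]
  exact mul_le_of_le_one_right hγ hu

theorem batchEstimate_congr (hγ : 0 ≤ γ) (h : Set.EqOn f F (Metric.cthickening γ Q)) {x : Vec d}
    (hx : x ∈ Q) (ω : Fin B → UnitSphere d) : batchEstimate γ f x ω = batchEstimate γ F x ω := by
  have hadd (j) : f (x + γ • (ω j : Vec d)) = F (x + γ • (ω j : Vec d)) :=
    h (add_smul_mem_cthickening hγ hx (norm_eq_of_mem_sphere _).le)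
  have hsub (j) : f (x - γ • (ω j : Vec d)) = F (x - γ • (ω j : Vec d)) := by
    rw [sub_eq_add_neg, ← smul_neg]
    exact h (add_smul_mem_cthickening hγ hx
      ((norm_neg _).trans (norm_eq_of_mem_sphere _)).le)
  simp only [batchEstimate, hadd, hsub]

theorem integral_inner_batchEstimate_sub [NeZero d] (hB : 0 < B) (hF : Continuous F)
    (x v : Vec d) :
    ∫ ω : Fin B → UnitSphere d, inner ℝ (batchEstimate γ F x ω - sphereGradient γ F x) v
      ∂Measure.pi (fun _ => uniformSphere d) = 0 := by
  set X : UnitSphere d → ℝ := fun e =>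
    (d : ℝ) * ((F (x + γ • (e : Vec d)) - F (x - γ • (e : Vec d))) / (2 * γ)) *
        inner ℝ (e : Vec d) v with hX
  have hXc : Continuous X := by fun_prop
  have hinner (ω : Fin B → UnitSphere d) :
      inner ℝ (batchEstimate γ F x ω - sphereGradient γ F x) v
        = (B : ℝ)⁻¹ * ∑ j, X (ω j) - inner ℝ (sphereGradient γ F x) v := by
    rw [inner_sub_left, batchEstimate, batchGradient, real_inner_smul_left, sum_inner]
    simp only [real_inner_smul_left, hX]
  have hmean (j : Fin B) :
      ∫ ω : Fin B → UnitSphere d, X (ω j) ∂Measure.pi (fun _ => uniformSphere d)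
        = inner ℝ (sphereGradient γ F x) v := by
    rw [inner_sphereGradient hF]
    exact integral_comp_eval (μ := fun _ : Fin B => uniformSphere d) (f := X)
      hXc.aestronglyMeasurable
  have hB' : (B : ℝ) ≠ 0 := by positivity
  simp only [hinner]
  rw [integral_sub (integrable_of_continuous_of_compactSpace (by fun_prop)) (integrable_const _),
    integral_const_mul,
    integral_finsetSum _ fun j _ => integrable_of_continuous_of_compactSpace (by fun_prop)]
  simp only [hmean, Finset.sum_const, Finset.card_univ, Fintype.card_fin, nsmul_eq_mul,
    integral_const, probReal_univ, one_smul]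
  rw [inv_mul_cancel_left₀ hB', sub_self]

end BatchEstimate

namespace AGMParams

section Iterates

variable {d : ℕ} (P : AGMParams) {γ : ℝ} {Q : Set (Vec d)} {x₀ : Vec d} {f F : Vec d → ℝ}

theorem A_zero : P.A 0 = 0 := Finset.sum_range_zero _

theorem A_succ (k : ℕ) : P.A (k + 1) = P.A k + P.a k := Finset.sum_range_succ _ _

theorem A_nonneg (k : ℕ) : 0 ≤ P.A k := Finset.sum_nonneg fun i _ => (P.a_pos i).le

theorem A_succ_pos (k : ℕ) : 0 < P.A (k + 1) := by
  rw [A_succ]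
  exact add_pos_of_nonneg_of_pos (P.A_nonneg k) (P.a_pos k)

theorem combine_mem (hQ : Convex ℝ Q) (k : ℕ) {y z : Vec d} (hy : y ∈ Q) (hz : z ∈ Q) :
    P.combine k y z ∈ Q := by
  have hA := P.A_succ_pos k
  have hmem := hQ hy hz (a := (P.A (k + 1))⁻¹ * P.A k) (b := (P.A (k + 1))⁻¹ * P.a k)
    (mul_nonneg (inv_nonneg.2 hA.le) (P.A_nonneg k))
    (mul_nonneg (inv_nonneg.2 hA.le) (P.a_pos k).le)
    (by rw [← mul_add, ← A_succ, inv_mul_cancel₀ hA.ne'])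
  rwa [mul_smul, mul_smul, ← smul_add] at hmem

theorem continuous_combine (k : ℕ) :
    Continuous fun z : Vec d × Vec d => P.combine k z.1 z.2 := by
  unfold combine
  fun_prop

theorem combine_sub_combine (k : ℕ) (y z z' : Vec d) :
    P.combine k y z' - P.combine k y z = (P.a k / P.A (k + 1)) • (z' - z) := by
  rw [combine, combine, ← smul_sub, add_sub_add_left_eq_sub, ← smul_sub, smul_smul, inv_mul_eq_div]

theorem smul_sub_combine_add (k : ℕ) (y z : Vec d) :
    P.A k • (y - P.combine k y z) + P.a k • (z - P.combine k y z) = 0 := by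
  have hcombine : P.A (k + 1) • P.combine k y z = P.A k • y + P.a k • z := by
    rw [combine, smul_inv_smul₀ (P.A_succ_pos k).ne']
  rw [A_succ, add_smul] at hcombine
  rw [smul_sub, smul_sub, sub_add_sub_comm, ← hcombine, sub_self]

/-- The sum `G_{k+1} = G_k + a_k g_{k+1}` when `y_k = y`, `G_k = G` and the directions of
iteration `k` are `ω`. -/
noncomputable def nextG (γ : ℝ) (f : Vec d → ℝ) (Q : Set (Vec d)) (x₀ : Vec d) (k : ℕ)
    (y G : Vec d) (ω : Fin P.B → UnitSphere d) : Vec d :=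
  G + P.a k • batchEstimate γ f (P.combine k y (P.prox Q x₀ G)) ω

/-- The point `y_{k+1}` when `y_k = y`, `G_k = G` and the directions of iteration `k` are `ω`. -/
noncomputable def nextY (γ : ℝ) (f : Vec d → ℝ) (Q : Set (Vec d)) (x₀ : Vec d) (k : ℕ)
    (y G : Vec d) (ω : Fin P.B → UnitSphere d) : Vec d :=
  P.combine k y (P.prox Q x₀ (P.nextG γ f Q x₀ k y G ω))

theorem nextY_mem (hQ : IsClosed Q) (hQc : Convex ℝ Q) (hx₀ : x₀ ∈ Q) (k : ℕ) {y : Vec d}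
    (hy : y ∈ Q) (G : Vec d) (ω : Fin P.B → UnitSphere d) : P.nextY γ f Q x₀ k y G ω ∈ Q :=
  P.combine_mem hQc k hy (P.prox_mem hQ hx₀ _)

theorem continuous_nextG (hf : Continuous f) (hQ : IsClosed Q) (hQc : Convex ℝ Q) (hx₀ : x₀ ∈ Q)
    (k : ℕ) : Continuous fun z : (Fin P.B → UnitSphere d) × Vec d × Vec d =>
      P.nextG γ f Q x₀ k z.2.1 z.2.2 z.1 := by
  have hprox := P.continuous_prox hQ hQc hx₀
  have hcombine : Continuous fun z : (Fin P.B → UnitSphere d) × Vec d × Vec d =>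
      P.combine k z.2.1 (P.prox Q x₀ z.2.2) :=
    (P.continuous_combine k).comp (continuous_snd.fst.prodMk (hprox.comp continuous_snd.snd))
  exact continuous_snd.snd.add
    (((continuous_batchEstimate hf).comp (hcombine.prodMk continuous_fst)).const_smul (P.a k))

theorem continuous_nextY (hf : Continuous f) (hQ : IsClosed Q) (hQc : Convex ℝ Q) (hx₀ : x₀ ∈ Q)
    (k : ℕ) : Continuous fun z : (Fin P.B → UnitSphere d) × Vec d × Vec d =>
      P.nextY γ f Q x₀ k z.2.1 z.2.2 z.1 :=
  (P.continuous_combine k).comp (continuous_snd.fst.prodMk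
    ((P.continuous_prox hQ hQc hx₀).comp (P.continuous_nextG hf hQ hQc hx₀ k)))

theorem run_fgmLoop_succ (n : ℕ) (e : Fin (n + 1) → Fin P.B → UnitSphere d) (k : ℕ) (y G : Vec d) :
    (fgmLoop P γ Q x₀ (n + 1) e k y G).run f =
      (fgmLoop P γ Q x₀ n (fun i => e i.succ) (k + 1) (P.nextY γ f Q x₀ k y G (e 0))
        (P.nextG γ f Q x₀ k y G (e 0))).run f := by
  simp only [fgmLoop, ZOMethod.run, Fin.append_left, Fin.append_right, nextY, nextG, batchEstimate]

theorem iterations_fgmLoop (n : ℕ) (e : Fin n → Fin P.B → UnitSphere d) (k : ℕ) (y G : Vec d) :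
    (fgmLoop P γ Q x₀ n e k y G).iterations f = n := by
  induction n generalizing k y G with
  | zero => rfl
  | succ n ih => simp only [fgmLoop, ZOMethod.iterations, ih]

theorem oracleCalls_fgmLoop (n : ℕ) (e : Fin n → Fin P.B → UnitSphere d) (k : ℕ) (y G : Vec d) :
    (fgmLoop P γ Q x₀ n e k y G).oracleCalls f = n * (P.B + P.B) := by
  induction n generalizing k y G with
  | zero => exact (zero_mul _).symm
  | succ n ih => simp only [fgmLoop, ZOMethod.oracleCalls, ih, add_one_mul]

theorem run_fgmLoop_mem (hQ : IsClosed Q) (hQc : Convex ℝ Q) (hx₀ : x₀ ∈ Q) (n : ℕ)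
    (e : Fin n → Fin P.B → UnitSphere d) (k : ℕ) {y : Vec d} (hy : y ∈ Q) (G : Vec d) :
    (fgmLoop P γ Q x₀ n e k y G).run f ∈ Q := by
  induction n generalizing k y G with
  | zero => exact hy
  | succ n ih =>
    rw [run_fgmLoop_succ]
    exact ih _ _ (P.nextY_mem hQ hQc hx₀ k hy G _) _

theorem run_fgmLoop_congr (hγ : 0 ≤ γ) (hQ : IsClosed Q) (hQc : Convex ℝ Q) (hx₀ : x₀ ∈ Q)
    (h : Set.EqOn f F (Metric.cthickening γ Q)) (n : ℕ)
    (e : Fin n → Fin P.B → UnitSphere d) (k : ℕ) {y : Vec d} (hy : y ∈ Q) (G : Vec d) :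
    (fgmLoop P γ Q x₀ n e k y G).run f = (fgmLoop P γ Q x₀ n e k y G).run F := by
  induction n generalizing k y G with
  | zero => rfl
  | succ n ih =>
    have hG : P.nextG γ f Q x₀ k y G (e 0) = P.nextG γ F Q x₀ k y G (e 0) := by
      rw [nextG, nextG, batchEstimate_congr hγ h (P.combine_mem hQc k hy (P.prox_mem hQ hx₀ _))]
    rw [run_fgmLoop_succ, run_fgmLoop_succ, nextY, nextY, hG]
    exact ih _ _ (P.nextY_mem hQ hQc hx₀ k hy G _) _

theorem continuous_run_fgmLoop (hf : Continuous f) (hQ : IsClosed Q) (hQc : Convex ℝ Q)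
    (hx₀ : x₀ ∈ Q) (n k : ℕ) :
    Continuous fun z : (Fin n → Fin P.B → UnitSphere d) × Vec d × Vec d =>
      (fgmLoop P γ Q x₀ n z.1 k z.2.1 z.2.2).run f := by
  induction n generalizing k with
  | zero => exact continuous_snd.fst
  | succ n ih =>
    simp only [run_fgmLoop_succ]
    have hfirst : Continuous fun z : (Fin (n + 1) → Fin P.B → UnitSphere d) × Vec d × Vec d =>
        (z.1 0, z.2) := by fun_prop
    have htail : Continuous fun z : (Fin (n + 1) → Fin P.B → UnitSphere d) × Vec d × Vec d =>
        fun i : Fin n => z.1 i.succ := by fun_prop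
    exact (ih (k + 1)).comp (htail.prodMk
      (((P.continuous_nextY hf hQ hQc hx₀ k).comp hfirst).prodMk
        ((P.continuous_nextG hf hQ hQc hx₀ k).comp hfirst)))

theorem continuous_comp_run_fgmLoop (hf : Continuous f) (hQ : IsClosed Q) (hQc : Convex ℝ Q)
    (hx₀ : x₀ ∈ Q) {φ : Vec d → ℝ} (hφ : Continuous φ) (n k : ℕ) (y G : Vec d) :
    Continuous fun e => φ ((fgmLoop P γ Q x₀ n e k y G).run f) :=
  hφ.comp ((P.continuous_run_fgmLoop hf hQ hQc hx₀ n k).comp (.prodMk_left (y, G)))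

end Iterates

section Potential

variable {d : ℕ} (P : AGMParams) {Q : Set (Vec d)} {x₀ xs : Vec d} {φ : Vec d → ℝ}

/-- The potential `A_k (φ y - φ xs) + ψ_G (xs) - min_Q ψ_G` of the analysis of the method for the
objective `φ`, where `ψ_G` is the objective of the prox-step and `xs` is the point of comparison. -/
noncomputable def potential (Q : Set (Vec d)) (x₀ : Vec d) (φ : Vec d → ℝ) (xs : Vec d) (k : ℕ)
    (y G : Vec d) : ℝ :=
  P.A k * (φ y - φ xs) + (P.proxObjective x₀ G xs - P.proxObjective x₀ G (P.prox Q x₀ G))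

theorem le_potential (hQ : IsClosed Q) (hx₀ : x₀ ∈ Q) (hxs : xs ∈ Q) (k : ℕ) (y G : Vec d) :
    P.A k * (φ y - φ xs) ≤ P.potential Q x₀ φ xs k y G :=
  le_add_of_nonneg_right (sub_nonneg.2 (isMinOn_iff.1 (P.isMinOn_prox hQ hx₀ G) xs hxs))

theorem potential_zero_le (Q : Set (Vec d)) (x₀ : Vec d) (φ : Vec d → ℝ) (xs : Vec d) :
    P.potential Q x₀ φ xs 0 x₀ 0 ≤ P.β * pNorm P.r (x₀ - xs) ^ 2 / 2 := by
  have hβ := P.β_pos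
  rw [potential, A_zero, zero_mul, zero_add, proxObjective, proxObjective, inner_zero_left,
    inner_zero_left, zero_add, zero_add, pNorm_sub_comm P.one_lt_r.le xs x₀, mul_div_assoc]
  exact sub_le_self _ (by positivity)

theorem continuous_potential (hQ : IsClosed Q) (hQc : Convex ℝ Q) (hx₀ : x₀ ∈ Q)
    (hφ : Continuous φ) (k : ℕ) :
    Continuous fun z : Vec d × Vec d => P.potential Q x₀ φ xs k z.1 z.2 := by
  have hprox := P.continuous_prox hQ hQc hx₀
  have hpNorm := continuous_pNorm (d := d) P.one_lt_r.le
  unfold potential proxObjective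
  fun_prop

theorem continuous_potential_next {γ : ℝ} {f : Vec d → ℝ} (hf : Continuous f) (hQ : IsClosed Q)
    (hQc : Convex ℝ Q) (hx₀ : x₀ ∈ Q) (hφ : Continuous φ) (k : ℕ) (y G : Vec d) :
    Continuous fun ω => P.potential Q x₀ φ xs (k + 1) (P.nextY γ f Q x₀ k y G ω)
      (P.nextG γ f Q x₀ k y G ω) :=
  (P.continuous_potential hQ hQc hx₀ hφ (k + 1)).comp
    (((P.continuous_nextY hf hQ hQc hx₀ k).comp (.prodMk_left (y, G))).prodMk
      ((P.continuous_nextG hf hQ hQc hx₀ k).comp (.prodMk_left (y, G))))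

theorem proxObjective_add_smul (x₀ G g w : Vec d) (c : ℝ) :
    P.proxObjective x₀ (G + c • g) w = P.proxObjective x₀ G w + c * inner ℝ g w := by
  rw [proxObjective, proxObjective, inner_add_left, real_inner_smul_left, add_right_comm]

theorem A_mul_combine_le {k : ℕ} {v y z z' : Vec d} {L τ : ℝ}
    (hsmooth : φ (P.combine k y z') ≤ φ (P.combine k y z)
      + inner ℝ v (P.combine k y z' - P.combine k y z)
      + L * pNorm P.r (P.combine k y z' - P.combine k y z) ^ 2 + τ)
    (hL : L * P.a k ^ 2 ≤ P.growth / 2 * P.A (k + 1)) :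
    P.A (k + 1) * φ (P.combine k y z') ≤ P.A (k + 1) * φ (P.combine k y z)
      + P.a k * inner ℝ v (z' - z) + P.growth / 2 * pNorm P.r (z' - z) ^ 2 + P.A (k + 1) * τ := by
  have hA := P.A_succ_pos k
  have ha := P.a_pos k
  have hcoeff : L * P.a k ^ 2 / P.A (k + 1) ≤ P.growth / 2 := (div_le_iff₀ hA).2 hL
  rw [combine_sub_combine, inner_smul_right, pNorm_smul P.one_lt_r.le,
    abs_of_pos (div_pos ha hA)] at hsmooth
  calc P.A (k + 1) * φ (P.combine k y z')
      ≤ P.A (k + 1) * (φ (P.combine k y z) + P.a k / P.A (k + 1) * inner ℝ v (z' - z)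
        + L * (P.a k / P.A (k + 1) * pNorm P.r (z' - z)) ^ 2 + τ) := by gcongr
    _ = P.A (k + 1) * φ (P.combine k y z) + P.a k * inner ℝ v (z' - z)
        + L * P.a k ^ 2 / P.A (k + 1) * pNorm P.r (z' - z) ^ 2 + P.A (k + 1) * τ := by
      field_simp
    _ ≤ _ := by gcongr

theorem A_mul_combine_add_le {k : ℕ} {v y z : Vec d}
    (hy : φ (P.combine k y z) + inner ℝ v (y - P.combine k y z) ≤ φ y)
    (hxs : φ (P.combine k y z) + inner ℝ v (xs - P.combine k y z) ≤ φ xs) :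
    P.A (k + 1) * φ (P.combine k y z) + P.a k * inner ℝ v (xs - z)
      ≤ P.A k * φ y + P.a k * φ xs := by
  have hinner := congrArg (inner ℝ v) (P.smul_sub_combine_add k y z)
  rw [inner_add_right, inner_smul_right, inner_smul_right, inner_zero_right] at hinner
  have hxz : inner ℝ v (xs - z)
      = inner ℝ v (xs - P.combine k y z) - inner ℝ v (z - P.combine k y z) := by
    rw [← inner_sub_right, sub_sub_sub_cancel_right]
  rw [A_succ, hxz]
  linarith [mul_le_mul_of_nonneg_left hy (P.A_nonneg k),
    mul_le_mul_of_nonneg_left hxs (P.a_pos k).le]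

theorem potential_succ_le (hQ : IsClosed Q) (hQc : Convex ℝ Q) (hx₀ : x₀ ∈ Q)
    {grad : Vec d → Vec d} (hxs : xs ∈ Q) {s : ℝ≥0∞}
    (hconj : s.toReal.HolderConjugate P.r.toReal)
    (hconv : ∀ x ∈ Q, ∀ z ∈ Q, φ x + inner ℝ (grad x) (z - x) ≤ φ z) {k : ℕ} {L τ : ℝ}
    (hsmooth : ∀ x ∈ Q, ∀ z ∈ Q,
      φ z ≤ φ x + inner ℝ (grad x) (z - x) + L * pNorm P.r (z - x) ^ 2 + τ)
    (hL : L * P.a k ^ 2 ≤ P.growth / 2 * P.A (k + 1)) {y : Vec d} (hy : y ∈ Q) (G g : Vec d) :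
    P.potential Q x₀ φ xs (k + 1) (P.combine k y (P.prox Q x₀ (G + P.a k • g))) (G + P.a k • g)
      ≤ P.potential Q x₀ φ xs k y G
        + P.a k * inner ℝ (g - grad (P.combine k y (P.prox Q x₀ G))) (xs - P.prox Q x₀ G)
        + P.a k ^ 2 / (2 * P.growth)
          * pNorm s (g - grad (P.combine k y (P.prox Q x₀ G))) ^ 2
        + P.A (k + 1) * τ := by
  set z := P.prox Q x₀ G with hz
  set z' := P.prox Q x₀ (G + P.a k • g)
  have hzQ : z ∈ Q := P.prox_mem hQ hx₀ G
  have hzQ' : z' ∈ Q := P.prox_mem hQ hx₀ _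
  have hxQ := P.combine_mem hQc k hy hzQ
  have hupper := P.A_mul_combine_le (hsmooth _ hxQ _ (P.combine_mem hQc k hy hzQ')) hL
  have hlower := P.A_mul_combine_add_le (hconv _ hxQ y hy) (hconv _ hxQ xs hxs)
  have hgrowth := P.proxObjective_prox_add_le hQ hQc hx₀ G hzQ'
  have hnoise := mul_inner_le_pNorm_sq_add hconj (P.a_pos k).le P.growth_pos
    (g - grad (P.combine k y z)) (z - z')
  rw [pNorm_sub_comm P.one_lt_r.le z z'] at hnoise
  rw [potential, potential, proxObjective_add_smul, proxObjective_add_smul, ← hz, A_succ]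
  rw [A_succ] at hupper hlower
  simp only [inner_sub_left, inner_sub_right] at hupper hlower hnoise ⊢
  linarith

end Potential

end AGMParams

section Fubini

variable {X E : Type*} [TopologicalSpace X] [CompactSpace X] [SecondCountableTopology X]
  [MeasurableSpace X] [BorelSpace X] (μ : Measure X) [IsProbabilityMeasure μ]
  [NormedAddCommGroup E] {n : ℕ} {h : (Fin (n + 1) → X) → E}

theorem integrable_cons (hh : Continuous h) :
    Integrable (fun z : X × (Fin n → X) => h (Fin.cons z.1 z.2))
      (μ.prod (Measure.pi fun _ : Fin n => μ)) :=
  integrable_of_continuous_of_compactSpace (by fun_prop)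

theorem integral_pi_fin_succ [NormedSpace ℝ E] (hh : Continuous h) :
    ∫ e, h e ∂Measure.pi (fun _ => μ)
      = ∫ x, ∫ e, h (Fin.cons x e) ∂Measure.pi (fun _ : Fin n => μ) ∂μ := by
  rw [← integral_prod _ (integrable_cons μ hh),
    ← (measurePreserving_piFinSuccAbove (fun _ : Fin (n + 1) => μ) 0).integral_comp'
      (fun z : X × (Fin n → X) => h (Fin.cons z.1 z.2))]
  exact integral_congr_ae (.of_forall fun e => congrArg h (Fin.cons_self_tail e).symm)

end Fubini

instance {d : ℕ} [NeZero d] (n B : ℕ) : IsProbabilityMeasure (directionLaw d n B) := by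
  unfold directionLaw
  infer_instance

namespace AGMParams

variable {d : ℕ} [NeZero d] (P : AGMParams) {γ : ℝ} {Q : Set (Vec d)} {x₀ xs : Vec d}
  {f φ : Vec d → ℝ} {grad : Vec d → Vec d} {s : ℝ≥0∞} {V : ℝ}

theorem integral_potential_succ_le (hf : Continuous f) (hQ : IsClosed Q) (hQc : Convex ℝ Q)
    (hx₀ : x₀ ∈ Q) (hφ : Continuous φ) (hxs : xs ∈ Q) (hs : 1 ≤ s)
    (hconj : s.toReal.HolderConjugate P.r.toReal)
    (hconv : ∀ x ∈ Q, ∀ z ∈ Q, φ x + inner ℝ (grad x) (z - x) ≤ φ z) {k : ℕ} {L τ : ℝ}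
    (hsmooth : ∀ x ∈ Q, ∀ z ∈ Q,
      φ z ≤ φ x + inner ℝ (grad x) (z - x) + L * pNorm P.r (z - x) ^ 2 + τ)
    (hL : L * P.a k ^ 2 ≤ P.growth / 2 * P.A (k + 1))
    (hmean : ∀ x v, ∫ ω : Fin P.B → UnitSphere d, inner ℝ (batchEstimate γ f x ω - grad x) v
      ∂Measure.pi (fun _ => uniformSphere d) = 0)
    (hvar : ∀ x, ∫ ω : Fin P.B → UnitSphere d, pNorm s (batchEstimate γ f x ω - grad x) ^ 2
      ∂Measure.pi (fun _ => uniformSphere d) ≤ V) {y : Vec d} (hy : y ∈ Q) (G : Vec d) :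
    ∫ ω, P.potential Q x₀ φ xs (k + 1) (P.nextY γ f Q x₀ k y G ω) (P.nextG γ f Q x₀ k y G ω)
        ∂Measure.pi (fun _ => uniformSphere d)
      ≤ P.potential Q x₀ φ xs k y G + P.a k ^ 2 / (2 * P.growth) * V + P.A (k + 1) * τ := by
  set z := P.prox Q x₀ G
  set x := P.combine k y z
  have hnoise : Continuous fun ω : Fin P.B → UnitSphere d => batchEstimate γ f x ω - grad x :=
    ((continuous_batchEstimate hf).comp (.prodMk_right x)).sub continuous_const
  have hpNorm := continuous_pNorm (d := d) hs
  have hint₁ : Integrable (fun ω : Fin P.B → UnitSphere d =>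
      inner ℝ (batchEstimate γ f x ω - grad x) (xs - z)) (Measure.pi fun _ => uniformSphere d) :=
    integrable_of_continuous_of_compactSpace (by fun_prop)
  have hint₂ : Integrable (fun ω : Fin P.B → UnitSphere d =>
      pNorm s (batchEstimate γ f x ω - grad x) ^ 2) (Measure.pi fun _ => uniformSphere d) :=
    integrable_of_continuous_of_compactSpace (by fun_prop)
  have hgrowth := P.growth_pos
  calc _ ≤ ∫ ω : Fin P.B → UnitSphere d, (P.potential Q x₀ φ xs k y G
          + P.a k * inner ℝ (batchEstimate γ f x ω - grad x) (xs - z)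
          + P.a k ^ 2 / (2 * P.growth) * pNorm s (batchEstimate γ f x ω - grad x) ^ 2
          + P.A (k + 1) * τ) ∂Measure.pi (fun _ => uniformSphere d) := by
        exact integral_mono (integrable_of_continuous_of_compactSpace
          (P.continuous_potential_next hf hQ hQc hx₀ hφ k y G)) (by fun_prop) fun ω =>
          P.potential_succ_le hQ hQc hx₀ hxs hconj hconv hsmooth hL hy G (batchEstimate γ f x ω)
    _ = P.potential Q x₀ φ xs k y G + P.a k ^ 2 / (2 * P.growth)
          * ∫ ω : Fin P.B → UnitSphere d, pNorm s (batchEstimate γ f x ω - grad x) ^ 2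
            ∂Measure.pi (fun _ => uniformSphere d) + P.A (k + 1) * τ := by
        rw [integral_add (by fun_prop) (by fun_prop), integral_add (by fun_prop) (by fun_prop),
          integral_add (by fun_prop) (by fun_prop), integral_const_mul, integral_const_mul, hmean,
          mul_zero, add_zero, integral_const, integral_const, probReal_univ, one_smul, one_smul]
    _ ≤ _ := by
        gcongr
        exact hvar x

theorem integrable_integral_run_fgmLoop_next (hf : Continuous f) (hQ : IsClosed Q)
    (hQc : Convex ℝ Q) (hx₀ : x₀ ∈ Q) (hφ : Continuous φ) (n k : ℕ) (y G : Vec d) :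
    Integrable (fun ω => ∫ e, φ ((fgmLoop P γ Q x₀ n e (k + 1) (P.nextY γ f Q x₀ k y G ω)
      (P.nextG γ f Q x₀ k y G ω)).run f) ∂directionLaw d n P.B)
      (Measure.pi fun _ => uniformSphere d) := by
  have hint := (integrable_cons (Measure.pi fun _ => uniformSphere d)
    (P.continuous_comp_run_fgmLoop (γ := γ) hf hQ hQc hx₀ hφ (n + 1) k y G)).integral_prod_left
  simp only [run_fgmLoop_succ, Fin.cons_zero, Fin.cons_succ] at hint
  exact hint

theorem integral_run_fgmLoop_succ (hf : Continuous f) (hQ : IsClosed Q) (hQc : Convex ℝ Q)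
    (hx₀ : x₀ ∈ Q) (hφ : Continuous φ) (n k : ℕ) (y G : Vec d) :
    ∫ e, φ ((fgmLoop P γ Q x₀ (n + 1) e k y G).run f) ∂directionLaw d (n + 1) P.B
      = ∫ ω, ∫ e, φ ((fgmLoop P γ Q x₀ n e (k + 1) (P.nextY γ f Q x₀ k y G ω)
        (P.nextG γ f Q x₀ k y G ω)).run f) ∂directionLaw d n P.B
        ∂Measure.pi fun _ => uniformSphere d := by
  rw [directionLaw,
    integral_pi_fin_succ _ (P.continuous_comp_run_fgmLoop hf hQ hQc hx₀ hφ (n + 1) k y G)]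
  simp only [run_fgmLoop_succ, Fin.cons_zero, Fin.cons_succ, directionLaw]

theorem integral_run_fgmLoop_le (hf : Continuous f) (hQ : IsClosed Q) (hQc : Convex ℝ Q)
    (hx₀ : x₀ ∈ Q) (hφ : Continuous φ) (hxs : xs ∈ Q) (hs : 1 ≤ s)
    (hconj : s.toReal.HolderConjugate P.r.toReal)
    (hconv : ∀ x ∈ Q, ∀ z ∈ Q, φ x + inner ℝ (grad x) (z - x) ≤ φ z) {L τ : ℕ → ℝ}
    (hsmooth : ∀ k, ∀ x ∈ Q, ∀ z ∈ Q,
      φ z ≤ φ x + inner ℝ (grad x) (z - x) + L k * pNorm P.r (z - x) ^ 2 + τ k)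
    (hL : ∀ k, L k * P.a k ^ 2 ≤ P.growth / 2 * P.A (k + 1))
    (hmean : ∀ x v, ∫ ω : Fin P.B → UnitSphere d, inner ℝ (batchEstimate γ f x ω - grad x) v
      ∂Measure.pi (fun _ => uniformSphere d) = 0)
    (hvar : ∀ x, ∫ ω : Fin P.B → UnitSphere d, pNorm s (batchEstimate γ f x ω - grad x) ^ 2
      ∂Measure.pi (fun _ => uniformSphere d) ≤ V)
    (n k : ℕ) {y : Vec d} (hy : y ∈ Q) (G : Vec d) :
    P.A (k + n) * (∫ e, φ ((fgmLoop P γ Q x₀ n e k y G).run f) ∂directionLaw d n P.B - φ xs)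
      ≤ P.potential Q x₀ φ xs k y G
        + ∑ i ∈ Finset.range n, (P.a (k + i) ^ 2 / (2 * P.growth) * V
          + P.A (k + i + 1) * τ (k + i)) := by
  induction n generalizing k y G with
  | zero =>
    simp only [fgmLoop, ZOMethod.run, integral_const, probReal_univ, one_smul, Finset.range_zero,
      Finset.sum_empty, add_zero]
    exact P.le_potential hQ hx₀ hxs k y G
  | succ n ih =>
    set S := ∑ i ∈ Finset.range n, (P.a (k + 1 + i) ^ 2 / (2 * P.growth) * V
      + P.A (k + 1 + i + 1) * τ (k + 1 + i))
    have hΦ := P.integrable_integral_run_fgmLoop_next (γ := γ) hf hQ hQc hx₀ hφ n k y G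
    have hpot := integrable_of_continuous_of_compactSpace
      (μ := Measure.pi fun _ => uniformSphere d)
      (P.continuous_potential_next (γ := γ) (xs := xs) hf hQ hQc hx₀ hφ k y G)
    have hsum : ∑ i ∈ Finset.range n, (P.a (k + (i + 1)) ^ 2 / (2 * P.growth) * V
        + P.A (k + (i + 1) + 1) * τ (k + (i + 1))) = S :=
      Finset.sum_congr rfl fun i _ => by rw [← add_assoc, add_right_comm]
    calc _ = ∫ ω, P.A (k + 1 + n) * (∫ e, φ ((fgmLoop P γ Q x₀ n e (k + 1)
            (P.nextY γ f Q x₀ k y G ω) (P.nextG γ f Q x₀ k y G ω)).run f) ∂directionLaw d n P.B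
              - φ xs) ∂Measure.pi fun _ => uniformSphere d := by
          rw [integral_const_mul, integral_sub hΦ (integrable_const _),
            P.integral_run_fgmLoop_succ hf hQ hQc hx₀ hφ, integral_const, probReal_univ, one_smul,
            add_right_comm, add_assoc]
      _ ≤ ∫ ω, (P.potential Q x₀ φ xs (k + 1) (P.nextY γ f Q x₀ k y G ω)
            (P.nextG γ f Q x₀ k y G ω) + S) ∂Measure.pi fun _ => uniformSphere d :=
          integral_mono ((hΦ.sub (integrable_const _)).const_mul _)
            (hpot.add (integrable_const _)) fun ω =>
              ih (k + 1) (P.nextY_mem hQ hQc hx₀ k hy G ω) (P.nextG γ f Q x₀ k y G ω)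
      _ = ∫ ω, P.potential Q x₀ φ xs (k + 1) (P.nextY γ f Q x₀ k y G ω)
            (P.nextG γ f Q x₀ k y G ω) ∂(Measure.pi fun _ => uniformSphere d) + S := by
          rw [integral_add hpot (integrable_const _), integral_const, probReal_univ, one_smul]
      _ ≤ _ := by
          rw [Finset.sum_range_succ', hsum, add_zero]
          linarith [P.integral_potential_succ_le hf hQ hQc hx₀ hφ hxs hs hconj hconv (hsmooth k)
            (hL k) hmean hvar hy G]

end AGMParams

section Smoothing

variable {d : ℕ} {γ M : ℝ} {F : Vec d → ℝ} {r : ℝ≥0∞}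

theorem exists_lipschitzWith_of_le_pNorm (hr : 1 ≤ r) (hr₂ : r ≤ 2) (hM : 0 ≤ M)
    (hF : ∀ x y, |F y - F x| ≤ M * pNorm r (y - x)) : ∃ K, LipschitzWith K F := by
  set c := M * (d : ℝ) ^ (1 / r.toReal - 1 / (2 : ℝ≥0∞).toReal)
  have hc : 0 ≤ c := by positivity
  refine ⟨c.toNNReal, LipschitzWith.of_dist_le_mul fun x y => ?_⟩
  rw [Real.coe_toNNReal _ hc, Real.dist_eq, dist_eq_norm, ← pNorm_two, mul_assoc]
  exact (hF y x).trans
    (mul_le_mul_of_nonneg_left (pNorm_le_card_rpow_mul hr hr₂ (by simp) (x - y)) hM)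

theorem ballAverage_sub_le (hFc : Continuous F) (hF : ∀ x y, |F y - F x| ≤ M * pNorm r (y - x))
    (x z : Vec d) : ballAverage γ F z - ballAverage γ F x ≤ M * pNorm r (z - x) := by
  rw [sub_le_iff_le_add']
  refine ballAverage_le_ballAverage_add hFc hFc fun u _ => ?_
  have := (abs_le.1 (hF (x + γ • u) (z + γ • u))).2
  rw [add_sub_add_right_eq_sub] at this
  linarith

theorem lipschitzWith_ballAverage {K : NNReal} (hF : LipschitzWith K F) :
    LipschitzWith K (ballAverage γ F) := by
  refine LipschitzWith.of_le_add_mul K fun x y => ?_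
  rw [dist_eq_norm, ← pNorm_two, ← sub_le_iff_le_add']
  refine ballAverage_sub_le hF.continuous (fun x y => ?_) y x
  rw [pNorm_two, ← dist_eq_norm, ← Real.dist_eq]
  exact hF.dist_le_mul y x

variable [NeZero d]

theorem ballAverage_le_quadratic (hr : 1 ≤ r) (hr₂ : r ≤ 2) (hM : 0 ≤ M)
    (hFconv : ConvexOn ℝ Set.univ F) (hF : ∀ x y, |F y - F x| ≤ M * pNorm r (y - x)) (hγ : 0 < γ)
    (x z : Vec d) :
    ballAverage γ F z ≤ ballAverage γ F x + inner ℝ (sphereGradient γ F x) (z - x)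
      + √d * M / γ * pNorm r (z - x) ^ 2 := by
  obtain ⟨K, hK⟩ := exists_lipschitzWith_of_le_pNorm hr hr₂ hM hF
  have hN : 0 ≤ pNorm r (z - x) := pNorm_nonneg hr _
  have hconvex := inner_sphereGradient_le hFconv hK hγ z (x - z)
  have hgrad := inner_sphereGradient_sub_le (c := M * pNorm r (z - x)) (x := x) (y := z)
    hK.continuous hγ (by positivity)
    (fun u => by simpa only [add_sub_add_right_eq_sub] using hF (x + u) (z + u)) (z - x)
  have hnorm : ‖z - x‖ ≤ pNorm r (z - x) := by
    rw [← pNorm_two]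
    exact pNorm_antitone hr hr₂ (by simp) _
  have hquad : √d / γ * (M * pNorm r (z - x)) * ‖z - x‖ ≤ √d * M / γ * pNorm r (z - x) ^ 2 :=
    calc √d / γ * (M * pNorm r (z - x)) * ‖z - x‖
        ≤ √d / γ * (M * pNorm r (z - x)) * pNorm r (z - x) := by gcongr
      _ = √d * M / γ * pNorm r (z - x) ^ 2 := by ring
  rw [add_sub_cancel, ← neg_sub z x, inner_neg_right] at hconvex
  rw [inner_sub_left] at hgrad
  linarith

theorem ballAverage_le_quadratic_add (hr : 1 ≤ r) (hr₂ : r ≤ 2) (hM : 0 ≤ M)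
    (hFconv : ConvexOn ℝ Set.univ F) (hF : ∀ x y, |F y - F x| ≤ M * pNorm r (y - x)) (hγ : 0 < γ)
    {L : ℝ} (hL : 0 < L) (x z : Vec d) :
    ballAverage γ F z ≤ ballAverage γ F x + inner ℝ (sphereGradient γ F x) (z - x)
      + L * pNorm r (z - x) ^ 2 + M ^ 2 / L := by
  obtain ⟨K, hK⟩ := exists_lipschitzWith_of_le_pNorm hr hr₂ hM hF
  have hconvex := inner_sphereGradient_le hFconv hK hγ x (x - z)
  have hforward := ballAverage_sub_le (γ := γ) hK.continuous hF x z
  have hbackward := ballAverage_sub_le (γ := γ) hK.continuous hF x (x + (x - z))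
  have hamgm : 2 * (M * pNorm r (z - x)) ≤ L * pNorm r (z - x) ^ 2 + M ^ 2 / L := by
    have hsq : L * pNorm r (z - x) ^ 2 + M ^ 2 / L - 2 * (M * pNorm r (z - x))
        = (L * pNorm r (z - x) - M) ^ 2 / L := by
      field_simp
      ring
    rw [← sub_nonneg, hsq]
    positivity
  rw [add_sub_cancel_left, pNorm_sub_comm hr] at hbackward
  rw [← neg_sub z x, inner_neg_right] at hconvex
  rw [← neg_sub z x] at hbackward
  linarith

end Smoothing

/-- The assumptions on the problem of minimizing `f` over `Q`: the feasible set is closed and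
convex, and on its `γ`-neighbourhood, where the method evaluates `f`, the objective is convex and
Lipschitz with constant `M` for the `p`-norm and `M₂` for the Euclidean norm. -/
structure IsLipschitzProblem {d : ℕ} (p : ℝ≥0∞) (M M₂ γ : ℝ) (Q : Set (Vec d))
    (f : Vec d → ℝ) : Prop where
  isClosed : IsClosed Q
  convex : Convex ℝ Q
  convexOn : ConvexOn ℝ (Metric.cthickening γ Q) f
  abs_sub_le_pNorm : ∀ x ∈ Metric.cthickening γ Q, ∀ y ∈ Metric.cthickening γ Q,
    |f y - f x| ≤ M * pNorm p (y - x)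
  abs_sub_le_norm : ∀ x ∈ Metric.cthickening γ Q, ∀ y ∈ Metric.cthickening γ Q,
    |f y - f x| ≤ M₂ * ‖y - x‖

/-- The Euclidean Lipschitz extension of the objective from the `γ`-neighbourhood of `Q`. The
method behaves on it as on `f`, and its smoothing is defined everywhere. -/
noncomputable def globalObjective {d : ℕ} (M₂ γ : ℝ) (Q : Set (Vec d)) (f : Vec d → ℝ) :
    Vec d → ℝ :=
  lipschitzExtension 2 M₂ (Metric.cthickening γ Q) f

namespace IsLipschitzProblem

variable {d : ℕ} {p : ℝ≥0∞} {M M₂ γ : ℝ} {Q : Set (Vec d)} {f : Vec d → ℝ}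

theorem abs_sub_le_pNorm_two (h : IsLipschitzProblem p M M₂ γ Q f) :
    ∀ x ∈ Metric.cthickening γ Q, ∀ y ∈ Metric.cthickening γ Q,
      |f y - f x| ≤ M₂ * pNorm 2 (y - x) := by
  simpa only [pNorm_two] using h.abs_sub_le_norm

theorem eqOn_globalObjective (h : IsLipschitzProblem p M M₂ γ Q f) (hM₂ : 0 ≤ M₂) :
    Set.EqOn f (globalObjective M₂ γ Q f) (Metric.cthickening γ Q) := fun _ hx =>
  (lipschitzExtension_eq one_le_two hM₂ h.abs_sub_le_pNorm_two hx).symm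

theorem globalObjective_eq (h : IsLipschitzProblem p M M₂ γ Q f) (hM₂ : 0 ≤ M₂) {x : Vec d}
    (hx : x ∈ Q) : globalObjective M₂ γ Q f x = f x :=
  (h.eqOn_globalObjective hM₂ (Metric.self_subset_cthickening Q hx)).symm

theorem lipschitzWith_globalObjective (h : IsLipschitzProblem p M M₂ γ Q f) (hM₂ : 0 ≤ M₂)
    (hQ : Q.Nonempty) : LipschitzWith M₂.toNNReal (globalObjective M₂ γ Q f) := by
  refine LipschitzWith.of_dist_le_mul fun x y => ?_
  rw [Real.coe_toNNReal _ hM₂, Real.dist_eq, dist_eq_norm, ← pNorm_two]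
  exact abs_lipschitzExtension_sub_le one_le_two
    (hQ.mono (Metric.self_subset_cthickening Q)) hM₂ h.abs_sub_le_pNorm_two y x

theorem convexOn_globalObjective (h : IsLipschitzProblem p M M₂ γ Q f) (hM₂ : 0 ≤ M₂)
    (hQ : Q.Nonempty) : ConvexOn ℝ Set.univ (globalObjective M₂ γ Q f) :=
  convexOn_lipschitzExtension one_le_two (hQ.mono (Metric.self_subset_cthickening Q)) h.convexOn
    hM₂ h.abs_sub_le_pNorm_two

-- The Euclidean extension need not be Lipschitz for the `p`-norm with constant `M`. The extension
-- for the `p`-norm is, and its smoothing agrees with that of the Euclidean one on `Q`.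
theorem ballAverage_globalObjective_le [NeZero d] (h : IsLipschitzProblem p M M₂ γ Q f)
    (hp : 1 ≤ p) (hp₂ : p ≤ 2) (hM : 0 ≤ M) (hM₂ : 0 ≤ M₂) (hγ : 0 < γ) {L τ : ℝ}
    (hLτ : (L = √d * M / γ ∧ τ = 0) ∨ (0 < L ∧ τ = M ^ 2 / L)) {x z : Vec d} (hx : x ∈ Q)
    (hz : z ∈ Q) :
    ballAverage γ (globalObjective M₂ γ Q f) z ≤ ballAverage γ (globalObjective M₂ γ Q f) x
      + inner ℝ (sphereGradient γ (globalObjective M₂ γ Q f) x) (z - x)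
      + L * pNorm p (z - x) ^ 2 + τ := by
  have hne : (Metric.cthickening γ Q).Nonempty := ⟨x, Metric.self_subset_cthickening Q hx⟩
  have heq {y : Vec d} (hy : y ∈ Q) (u : Vec d) (hu : ‖u‖ ≤ 1) :
      lipschitzExtension p M (Metric.cthickening γ Q) f (y + γ • u)
        = globalObjective M₂ γ Q f (y + γ • u) := by
    have hmem := add_smul_mem_cthickening hγ.le hy hu
    rw [lipschitzExtension_eq hp hM h.abs_sub_le_pNorm hmem, h.eqOn_globalObjective hM₂ hmem]
  have hconv := convexOn_lipschitzExtension hp hne h.convexOn hM h.abs_sub_le_pNorm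
  have hlip := abs_lipschitzExtension_sub_le hp hne hM h.abs_sub_le_pNorm
  rw [← ballAverage_congr (heq hx), ← ballAverage_congr (heq hz), ← sphereGradient_congr (heq hx)]
  rcases hLτ with ⟨rfl, rfl⟩ | ⟨hL, rfl⟩
  · rw [add_zero]
    exact ballAverage_le_quadratic hp hp₂ hM hconv hlip hγ x z
  · exact ballAverage_le_quadratic_add hp hp₂ hM hconv hlip hγ hL x z

end IsLipschitzProblem

namespace AGMParams

variable {d : ℕ} (P : AGMParams) {M M₂ γ ρ : ℝ} {p : ℝ≥0∞} {Q : Set (Vec d)} {x₀ xs : Vec d}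
  {f : Vec d → ℝ}

theorem run_fgm_globalObjective (hprob : IsLipschitzProblem p M M₂ γ Q f) (hM₂ : 0 ≤ M₂)
    (hγ : 0 ≤ γ) (hx₀ : x₀ ∈ Q) (e : Fin P.N → Fin P.B → UnitSphere d) :
    f ((fgm P γ Q x₀ e).run f)
      = globalObjective M₂ γ Q f ((fgm P γ Q x₀ e).run (globalObjective M₂ γ Q f)) := by
  rw [fgm, ← P.run_fgmLoop_congr hγ hprob.isClosed hprob.convex hx₀
    (hprob.eqOn_globalObjective hM₂) P.N e 0 hx₀ 0]
  exact (hprob.globalObjective_eq hM₂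
    (P.run_fgmLoop_mem hprob.isClosed hprob.convex hx₀ P.N e 0 hx₀ 0)).symm

variable [NeZero d]

theorem integrable_run_fgm (hprob : IsLipschitzProblem p M M₂ γ Q f) (hM₂ : 0 ≤ M₂)
    (hγ : 0 ≤ γ) (hx₀ : x₀ ∈ Q) :
    Integrable (fun e => f ((fgm P γ Q x₀ e).run f)) (directionLaw d P.N P.B) := by
  have hF := (hprob.lipschitzWith_globalObjective hM₂ ⟨x₀, hx₀⟩).continuous
  simp only [P.run_fgm_globalObjective hprob hM₂ hγ hx₀]
  exact integrable_of_continuous_of_compactSpace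
    (P.continuous_comp_run_fgmLoop hF hprob.isClosed hprob.convex hx₀ hF P.N 0 x₀ 0)

theorem A_mul_integral_ballAverage_run_fgm_sub_le {F : Vec d → ℝ} {K : NNReal} (hK₀ : 0 < K)
    (hK : LipschitzWith K F) (hF : ConvexOn ℝ Set.univ F) (hQ : IsClosed Q) (hQc : Convex ℝ Q)
    (hρ : 2 ≤ ρ) (hconj : ρ.HolderConjugate P.r.toReal) (hρB : ρ ≤ P.B) (hγ : 0 < γ)
    (hx₀ : x₀ ∈ Q) (hxs : xs ∈ Q) {L τ : ℕ → ℝ}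
    (hsmooth : ∀ k, ∀ x ∈ Q, ∀ z ∈ Q, ballAverage γ F z ≤ ballAverage γ F x
      + inner ℝ (sphereGradient γ F x) (z - x) + L k * pNorm P.r (z - x) ^ 2 + τ k)
    (hL : ∀ k, L k * P.a k ^ 2 ≤ P.growth / 2 * P.A (k + 1)) :
    P.A P.N * (∫ e, ballAverage γ F ((fgm P γ Q x₀ e).run F) ∂directionLaw d P.N P.B
        - ballAverage γ F xs)
      ≤ P.β * pNorm P.r (x₀ - xs) ^ 2 / 2
        + ∑ k ∈ Finset.range P.N, (P.a k ^ 2 / (2 * P.growth)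
            * (varianceConst * ρ * (d : ℝ) ^ (2 / ρ) * K ^ 2 / P.B) + P.A (k + 1) * τ k) := by
  have hconv : ∀ x ∈ Q, ∀ z ∈ Q,
      ballAverage γ F x + inner ℝ (sphereGradient γ F x) (z - x) ≤ ballAverage γ F z := by
    intro x _ z _
    have := inner_sphereGradient_le hF hK hγ x (z - x)
    rw [add_sub_cancel] at this
    linarith
  have hloop := P.integral_run_fgmLoop_le (s := ENNReal.ofReal ρ) hK.continuous hQ hQc hx₀
    (lipschitzWith_ballAverage hK).continuous hxs (ENNReal.one_le_ofReal.2 (by linarith))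
    (by rwa [ENNReal.toReal_ofReal (by linarith)]) hconv hsmooth hL
    (fun x v => integral_inner_batchEstimate_sub P.B_pos hK.continuous x v)
    (fun x => integral_pNorm_sq_batchGradient_sub_le hK₀ hK hγ x hρ hρB) P.N 0 hx₀ 0
  simp only [zero_add] at hloop
  refine hloop.trans ?_
  gcongr
  exact P.potential_zero_le Q x₀ _ xs

theorem A_mul_integral_run_fgm_sub_le (hprob : IsLipschitzProblem P.r M M₂ γ Q f) (hρ : 2 ≤ ρ)
    (hconj : ρ.HolderConjugate P.r.toReal) (hρB : ρ ≤ P.B) (hγ : 0 < γ) (hM : 0 ≤ M)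
    (hM₂ : 0 < M₂) (hx₀ : x₀ ∈ Q) (hxs : xs ∈ Q) {L τ : ℕ → ℝ}
    (hLτ : ∀ k, (L k = √d * M / γ ∧ τ k = 0) ∨ (0 < L k ∧ τ k = M ^ 2 / L k))
    (hL : ∀ k, L k * P.a k ^ 2 ≤ P.growth / 2 * P.A (k + 1)) :
    P.A P.N * (∫ e, f ((fgm P γ Q x₀ e).run f) ∂directionLaw d P.N P.B - f xs - γ * M₂)
      ≤ P.β * pNorm P.r (x₀ - xs) ^ 2 / 2
        + ∑ k ∈ Finset.range P.N, (P.a k ^ 2 / (2 * P.growth)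
            * (varianceConst * ρ * (d : ℝ) ^ (2 / ρ) * M₂ ^ 2 / P.B) + P.A (k + 1) * τ k) := by
  set F := globalObjective M₂ γ Q f with hFdef
  have hK : LipschitzWith M₂.toNNReal F := hprob.lipschitzWith_globalObjective hM₂.le ⟨x₀, hx₀⟩
  have hFconv : ConvexOn ℝ Set.univ F := hprob.convexOn_globalObjective hM₂.le ⟨x₀, hx₀⟩
  have hφ : Continuous (ballAverage γ F) := (lipschitzWith_ballAverage hK).continuous
  have hsmoothed := P.A_mul_integral_ballAverage_run_fgm_sub_le (Real.toNNReal_pos.2 hM₂) hK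
    hFconv hprob.isClosed hprob.convex hρ hconj hρB hγ hx₀ hxs
    (fun k x hx z hz => hprob.ballAverage_globalObjective_le P.one_lt_r.le P.r_le_two hM hM₂.le
      hγ (hLτ k) hx hz) hL
  have hintegrable {g : Vec d → ℝ} (hg : Continuous g) :
      Integrable (fun e => g ((fgm P γ Q x₀ e).run F)) (directionLaw d P.N P.B) :=
    integrable_of_continuous_of_compactSpace (P.continuous_comp_run_fgmLoop hK.continuous
      hprob.isClosed hprob.convex hx₀ hg P.N 0 x₀ 0)
  have hbelow : ∫ e, F ((fgm P γ Q x₀ e).run F) ∂directionLaw d P.N P.B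
      ≤ ∫ e, ballAverage γ F ((fgm P γ Q x₀ e).run F) ∂directionLaw d P.N P.B :=
    integral_mono (hintegrable hK.continuous) (hintegrable hφ) fun e =>
      le_ballAverage hFconv hK.continuous _
  have habove : ballAverage γ F xs ≤ f xs + γ * M₂ := by
    have := ballAverage_le hK hγ.le xs
    rwa [hFdef, hprob.globalObjective_eq hM₂.le hxs, Real.coe_toNNReal _ hM₂.le] at this
  rw [Real.coe_toNNReal _ hM₂.le] at hsmoothed
  simp only [P.run_fgm_globalObjective hprob hM₂.le hγ.le hx₀]
  exact (mul_le_mul_of_nonneg_left (by linarith) (P.A_nonneg _)).trans hsmoothed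

/-- The conditions that make the method `ε`-accurate: the prox-exponent is conjugate to `ρ`, a batch
has at least `ρ` directions, and the error budget is met. Here `L₀` is the smoothness constant and
`M` the Lipschitz constant of the smoothed objective, `V` the variance of one gradient estimate and
`S` the squared distance to the comparison point. Iteration `k` may use either the curvature `L₀` or
any curvature `L k`, at the price of the error `M ^ 2 / L k` of the quadratic upper bound. Half of
`ε` is left for the error of smoothing. -/
structure IsAccurate (P : AGMParams) (ρ L₀ M V S ε : ℝ) : Prop where
  holderConjugate : ρ.HolderConjugate P.r.toReal
  le_B : ρ ≤ P.B
  N_pos : 0 < P.N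
  exists_curvature : ∃ L τ : ℕ → ℝ,
    (∀ k, (L k = L₀ ∧ τ k = 0) ∨ (0 < L k ∧ τ k = M ^ 2 / L k)) ∧
    (∀ k, L k * P.a k ^ 2 ≤ P.growth / 2 * P.A (k + 1)) ∧
    P.β * S / 2 + ∑ k ∈ Finset.range P.N,
        (P.a k ^ 2 / (2 * P.growth) * (V / P.B) + P.A (k + 1) * τ k) ≤ P.A P.N * (ε / 2)

theorem integral_run_fgm_sub_le {d : ℕ} [NeZero d] {P : AGMParams} {ρ M M₂ S ε : ℝ}
    {Q : Set (Vec d)} {x₀ xs : Vec d} {f : Vec d → ℝ}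
    (hprob : IsLipschitzProblem P.r M M₂ (ε / (2 * M₂)) Q f)
    (hP : P.IsAccurate ρ (√d * M / (ε / (2 * M₂))) M
      (varianceConst * ρ * (d : ℝ) ^ (2 / ρ) * M₂ ^ 2) S ε)
    (hρ : 2 ≤ ρ) (hε : 0 < ε) (hM : 0 ≤ M) (hM₂ : 0 < M₂) (hx₀ : x₀ ∈ Q) (hxs : xs ∈ Q)
    (hS : pNorm P.r (x₀ - xs) ^ 2 ≤ S) :
    ∫ e, f ((fgm P (ε / (2 * M₂)) Q x₀ e).run f) ∂directionLaw d P.N P.B - f xs ≤ ε := by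
  obtain ⟨L, τ, hLτ, hL, hbudget⟩ := hP.exists_curvature
  have herror := P.A_mul_integral_run_fgm_sub_le hprob hρ hP.holderConjugate hP.le_B
    (by positivity) hM hM₂ hx₀ hxs hLτ hL
  have hprox : P.β * pNorm P.r (x₀ - xs) ^ 2 / 2 ≤ P.β * S / 2 := by
    have := P.β_pos
    gcongr
  have hA : 0 < P.A P.N := by
    rw [← Nat.sub_one_add_one hP.N_pos.ne']
    exact P.A_succ_pos _
  have hdiv := le_of_mul_le_mul_left (herror.trans ((add_le_add_left hprox _).trans hbudget)) hA
  have hbias : ε / (2 * M₂) * M₂ = ε / 2 := by field_simp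
  linarith

/-- The parameters with prox-exponent conjugate to `ρ` and growth modulus `g`. -/
noncomputable def ofGrowth (N B : ℕ) (a : ℕ → ℝ) (ρ g : ℝ) (hB : 0 < B) (ha : ∀ k, 0 < a k)
    (hρ : 2 ≤ ρ) (hg : 0 < g) : AGMParams where
  N := N
  B := B
  a := a
  β := 4 * g * (ρ - 1)
  r := ENNReal.ofReal (ρ / (ρ - 1))
  B_pos := hB
  a_pos := ha
  β_pos := mul_pos (by positivity) (by linarith)
  one_lt_r := by
    rw [ENNReal.one_lt_ofReal, lt_div_iff₀ (by linarith)]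
    linarith
  r_le_two := by
    rw [← ENNReal.ofReal_ofNat]
    refine ENNReal.ofReal_le_ofReal ?_
    rw [div_le_iff₀ (by linarith)]
    linarith

section OfGrowth

variable {N B : ℕ} {a : ℕ → ℝ} {ρ g : ℝ} (hB : 0 < B) (ha : ∀ k, 0 < a k) (hρ : 2 ≤ ρ)
  (hg : 0 < g)

theorem holderConjugate_ofGrowth :
    ρ.HolderConjugate (ofGrowth N B a ρ g hB ha hρ hg).r.toReal := by
  rw [ofGrowth, ENNReal.toReal_ofReal (div_nonneg (by linarith) (by linarith))]
  exact Real.HolderConjugate.conjExponent (by linarith)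

theorem growth_ofGrowth : (ofGrowth N B a ρ g hB ha hρ hg).growth = g := by
  have hρ₁ : 0 < ρ - 1 := by linarith
  simp only [growth, ofGrowth]
  rw [ENNReal.toReal_ofReal (by positivity)]
  field_simp
  ring

theorem β_ofGrowth_mul_le {S : ℝ} (hS : 0 ≤ S) :
    (ofGrowth N B a ρ g hB ha hρ hg).β * S / 2 ≤ 2 * g * ρ * S := by
  have : 0 ≤ g * S := by positivity
  simp only [ofGrowth]
  linarith

end OfGrowth

/-- The accelerated schedule for an objective with smoothness constant `L`: the weights grow
linearly. -/
noncomputable def accelerated (N B : ℕ) (ρ L : ℝ) (hB : 0 < B) (hρ : 2 ≤ ρ) (hL : 0 < L) :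
    AGMParams :=
  ofGrowth N B (fun k => (k : ℝ) + 1) ρ (4 * L) hB (fun k => by positivity) hρ (by positivity)

/-- The schedule for a nonsmooth objective: the weights are constant. -/
noncomputable def robust (N B : ℕ) (ρ g : ℝ) (hB : 0 < B) (hρ : 2 ≤ ρ) (hg : 0 < g) : AGMParams :=
  ofGrowth N B (fun _ => 1) ρ g hB (fun _ => one_pos) hρ hg

section Schedules

variable {ρ L g M W S ε : ℝ} {N B : ℕ}

theorem A_accelerated (hB : 0 < B) (hρ : 2 ≤ ρ) (hL : 0 < L) (k : ℕ) :
    (accelerated N B ρ L hB hρ hL).A k = k * (k + 1) / 2 := by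
  induction k with
  | zero => simp [A_zero]
  | succ k ih =>
    rw [A_succ, ih]
    simp only [accelerated, ofGrowth]
    push_cast
    ring

theorem A_robust (hB : 0 < B) (hρ : 2 ≤ ρ) (hg : 0 < g) (k : ℕ) :
    (robust N B ρ g hB hρ hg).A k = k := by
  simp [A, robust, ofGrowth]

theorem sum_range_sq_mul_le (hL : 0 < L) (hW : 0 ≤ W) (hB : 0 < B)
    (hBW : N * W ≤ L * ε * B) :
    ∑ k ∈ Finset.range N, ((k : ℝ) + 1) ^ 2 / (2 * (4 * L)) * (W / B)
      ≤ (N : ℝ) ^ 2 * (ε / 8) := by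
  have : (0 : ℝ) < B := by exact_mod_cast hB
  calc ∑ k ∈ Finset.range N, ((k : ℝ) + 1) ^ 2 / (2 * (4 * L)) * (W / B)
      ≤ ∑ _k ∈ Finset.range N, (N : ℝ) ^ 2 / (2 * (4 * L)) * (W / B) := by
        refine Finset.sum_le_sum fun k hk => ?_
        have : (k : ℝ) + 1 ≤ N := by exact_mod_cast Finset.mem_range.1 hk
        gcongr
    _ = (N : ℝ) ^ 2 * ((N * W) / (8 * L * B)) := by
        rw [Finset.sum_const, Finset.card_range, nsmul_eq_mul]
        field_simp
        ring
    _ ≤ (N : ℝ) ^ 2 * (ε / 8) := by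
        refine mul_le_mul_of_nonneg_left ?_ (by positivity)
        rw [div_le_iff₀ (by positivity)]
        linarith

theorem isAccurate_accelerated (hρ : 2 ≤ ρ) (hL : 0 < L) (hW : 0 ≤ W) (hS : 0 ≤ S)
    (hε : 0 ≤ ε) (hN : 0 < N) (hB : 0 < B) (hρB : ρ ≤ B) (hNS : 64 * L * ρ * S ≤ N ^ 2 * ε)
    (hBW : N * W ≤ L * ε * B) : (accelerated N B ρ L hB hρ hL).IsAccurate ρ L M W S ε where
  holderConjugate := holderConjugate_ofGrowth ..
  le_B := hρB
  N_pos := hN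
  exists_curvature := by
    refine ⟨fun _ => L, fun _ => 0, fun _ => .inl ⟨rfl, rfl⟩, fun k => ?_, ?_⟩
    · rw [A_accelerated, accelerated, growth_ofGrowth]
      simp only [ofGrowth]
      push_cast
      have : 0 ≤ L * ((k : ℝ) + 1) := by positivity
      linarith
    · have hbias : (accelerated N B ρ L hB hρ hL).β * S / 2 ≤ 2 * (4 * L) * ρ * S :=
        β_ofGrowth_mul_le hB _ hρ _ hS
      have hnoise := sum_range_sq_mul_le hL hW hB hBW
      have : 0 ≤ (N : ℝ) * ε := by positivity
      simp only [mul_zero, add_zero, A_accelerated]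
      rw [accelerated, growth_ofGrowth]
      simp only [accelerated, ofGrowth] at hbias ⊢
      linarith

theorem isAccurate_robust (hρ : 2 ≤ ρ) (hg : 0 < g) (hW : 0 ≤ W) (hS : 0 ≤ S) (hN : 0 < N)
    (hB : 0 < B) (hρB : ρ ≤ B) (hWM : W / ρ / 2 + 2 * M ^ 2 ≤ g * (ε / 4))
    (hNS : 8 * g * ρ * S ≤ N * ε) (L₀ : ℝ) :
    (robust N B ρ g hB hρ hg).IsAccurate ρ L₀ M W S ε where
  holderConjugate := holderConjugate_ofGrowth ..
  le_B := hρB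
  N_pos := hN
  exists_curvature := by
    refine ⟨fun k => g / 2 * (k + 1), fun k => M ^ 2 / (g / 2 * (k + 1)),
      fun k => .inr ⟨by positivity, rfl⟩, fun k => ?_, ?_⟩
    · rw [A_robust, robust, growth_ofGrowth]
      simp only [ofGrowth]
      push_cast
      linarith
    · have hbias : (robust N B ρ g hB hρ hg).β * S / 2 ≤ 2 * g * ρ * S :=
        β_ofGrowth_mul_le hB _ hρ hg hS
      have hterm (k : ℕ) : (1 : ℝ) ^ 2 / (2 * g) * (W / B)
          + ((k + 1 : ℕ) : ℝ) * (M ^ 2 / (g / 2 * (k + 1))) ≤ ε / 4 :=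
        calc _ = (W / B / 2 + 2 * M ^ 2) / g := by
              push_cast
              field_simp
          _ ≤ (W / ρ / 2 + 2 * M ^ 2) / g := by gcongr
          _ ≤ ε / 4 := by rwa [div_le_iff₀' hg]
      have hsum := Finset.sum_le_card_nsmul (Finset.range N) _ _ fun k _ => hterm k
      rw [Finset.card_range, nsmul_eq_mul] at hsum
      simp only [A_robust]
      rw [robust, growth_ofGrowth]
      simp only [robust, ofGrowth] at hbias ⊢
      linarith

theorem exists_isAccurate_accelerated (hρ : 2 ≤ ρ) (hL : 0 < L) (hW : 0 ≤ W) (hS : 0 ≤ S)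
    (hε : 0 < ε) (hLS : ε ≤ 64 * L * ρ * S) (M : ℝ) :
    ∃ P : AGMParams, P.IsAccurate ρ L M W S ε ∧ (P.N : ℝ) ^ 2 ≤ 256 * L * ρ * S / ε ∧
      (P.N : ℝ) * (P.B + P.B) ≤ 4 * ρ * P.N + 512 * W * ρ * S / ε ^ 2 := by
  set X := 64 * L * ρ * S / ε with hX
  have hX₁ : 1 ≤ X := (one_le_div hε).2 hLS
  have hsq : √X ^ 2 = X := Real.sq_sqrt (by linarith)
  set N := ⌈√X⌉₊
  have hXN : X ≤ (N : ℝ) ^ 2 := hsq ▸ pow_le_pow_left₀ (Real.sqrt_nonneg X) (Nat.le_ceil _) 2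
  have hN : (N : ℝ) ^ 2 ≤ 4 * X := by
    have : (N : ℝ) ≤ 2 * √X := by
      linarith [Nat.ceil_lt_add_one (Real.sqrt_nonneg X), Real.one_le_sqrt.2 hX₁]
    calc (N : ℝ) ^ 2 ≤ (2 * √X) ^ 2 := by gcongr
      _ = 4 * X := by
        rw [mul_pow, hsq]
        norm_num
  set b := max ρ (N * W / (L * ε))
  have hb : 0 < b := lt_max_of_lt_left (by linarith)
  set B := ⌈b⌉₊
  have hbB : b ≤ B := Nat.le_ceil _
  have hB : (B : ℝ) ≤ 2 * ρ + N * W / (L * ε) := by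
    have hmax : b ≤ ρ + N * W / (L * ε) := max_le_add_of_nonneg (by linarith) (by positivity)
    linarith [Nat.ceil_lt_add_one hb.le]
  refine ⟨accelerated N B ρ L (Nat.ceil_pos.2 hb) hρ hL, isAccurate_accelerated hρ hL hW hS
    hε.le (Nat.ceil_pos.2 (Real.sqrt_pos.2 (by linarith))) _ ((le_max_left _ _).trans hbB)
    ((div_le_iff₀ hε).1 hXN) ?_, hN.trans_eq (by ring), ?_⟩
  · rw [← div_le_iff₀' (by positivity)]
    exact (le_max_right _ _).trans hbB
  · calc (N : ℝ) * (B + B) ≤ N * (2 * (2 * ρ + N * W / (L * ε))) := by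
          gcongr
          linarith
      _ = 4 * ρ * N + 2 * (N : ℝ) ^ 2 * W / (L * ε) := by ring
      _ ≤ 4 * ρ * N + 2 * (4 * X) * W / (L * ε) := by gcongr
      _ = 4 * ρ * N + 512 * W * ρ * S / ε ^ 2 := by
          rw [hX]
          field_simp
          ring

theorem exists_isAccurate_robust {K : ℝ} (hρ : 2 ≤ ρ) (hK : 0 < K) (hW : 0 ≤ W)
    (hWK : W / ρ / 2 + 2 * M ^ 2 ≤ K) (hε : 0 < ε) (hS : 0 < S) (L₀ : ℝ) :
    ∃ P : AGMParams, P.IsAccurate ρ L₀ M W S ε ∧ (P.N : ℝ) ≤ 32 * K * ρ * S / ε ^ 2 + 1 ∧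
      (P.N : ℝ) * (P.B + P.B) ≤ 4 * ρ * P.N := by
  set X := 32 * K * ρ * S / ε ^ 2 with hX
  have hX₀ : 0 < X := by positivity
  have hB : (⌈ρ⌉₊ : ℝ) ≤ 2 * ρ := by
    linarith [Nat.ceil_lt_add_one (show 0 ≤ ρ by linarith)]
  refine ⟨robust ⌈X⌉₊ ⌈ρ⌉₊ ρ (4 * K / ε) (Nat.ceil_pos.2 (by linarith)) hρ (by positivity),
    isAccurate_robust hρ _ hW hS.le (Nat.ceil_pos.2 hX₀) _ (Nat.le_ceil _)
    (hWK.trans_eq (by field_simp)) ?_ L₀, (Nat.ceil_lt_add_one hX₀.le).le, ?_⟩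
  · calc 8 * (4 * K / ε) * ρ * S = X * ε := by
          rw [hX]
          field_simp
          ring
      _ ≤ ⌈X⌉₊ * ε := by
          gcongr
          exact Nat.le_ceil _
  · calc (⌈X⌉₊ : ℝ) * (⌈ρ⌉₊ + ⌈ρ⌉₊) ≤ ⌈X⌉₊ * (2 * ρ + 2 * ρ) := by gcongr
      _ = 4 * ρ * ⌈X⌉₊ := by ring

end Schedules

end AGMParams

section Exponent

variable {d : ℕ} {p p' q q' r : ℝ≥0∞}

theorem le_of_holderConjugate_of_le (hpq : p.HolderConjugate q) (hpq' : p'.HolderConjugate q')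
    (hp : p ≤ p') : q' ≤ q := by
  rw [← ENNReal.inv_le_inv, ← ENNReal.HolderConjugate.one_sub_inv p q,
    ← ENNReal.HolderConjugate.one_sub_inv p' q']
  exact tsub_le_tsub_left (ENNReal.inv_le_inv.2 hp) 1

theorem toReal_inv_add_toReal_inv (hpq : p.HolderConjugate q) :
    (p⁻¹).toReal + (q⁻¹).toReal = 1 := by
  rw [← ENNReal.toReal_add, ENNReal.HolderConjugate.inv_add_inv_eq_one p q, ENNReal.toReal_one]
  · exact ENNReal.inv_ne_top.2 (ENNReal.HolderConjugate.ne_zero p q)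
  · exact ENNReal.inv_ne_top.2 (ENNReal.HolderConjugate.ne_zero q p)

/-- The conjugate of the prox-exponent. It is comparable with `min {q, ln d}`, and close enough to
`q` for the norms of its conjugate exponent and of the conjugate exponent of `q` to be
equivalent with a constant that does not depend on `d`. -/
noncomputable def dualExponent (q : ℝ≥0∞) (d : ℕ) : ℝ :=
  (min q (ENNReal.ofReal (max 2 (Real.log d)))).toReal

theorem two_le_dualExponent (hq : 2 ≤ q) : 2 ≤ dualExponent q d := by
  have htwo : (2 : ℝ≥0∞) ≤ ENNReal.ofReal (max 2 (Real.log d)) := by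
    simp
  simpa [dualExponent] using
    ENNReal.toReal_mono (min_lt_of_right_lt ENNReal.ofReal_lt_top).ne (le_min hq htwo)

theorem ofReal_dualExponent_le : ENNReal.ofReal (dualExponent q d) ≤ q :=
  ENNReal.ofReal_toReal_le.trans (min_le_left _ _)

theorem dualExponent_le_three_mul_minQLog (hd : 2 ≤ d) :
    dualExponent q d ≤ 3 * minQLog q d := by
  have hlog : max 2 (Real.log d) ≤ 3 * Real.log d := by
    have := Real.log_two_gt_d9
    have : Real.log 2 ≤ Real.log d := Real.log_le_log two_pos (by exact_mod_cast hd)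
    exact max_le (by linarith) (by linarith)
  have hle : min q (ENNReal.ofReal (max 2 (Real.log d)))
      ≤ 3 * min q (ENNReal.ofReal (Real.log d)) := by
    rw [mul_min]
    refine min_le_min (le_mul_of_one_le_left' (by norm_num)) ?_
    simpa [ENNReal.ofReal_mul] using ENNReal.ofReal_le_ofReal hlog
  simpa [dualExponent, minQLog] using ENNReal.toReal_mono
    (ENNReal.mul_ne_top (by simp) (min_lt_of_right_lt ENNReal.ofReal_lt_top).ne) hle

theorem rpow_one_div_dualExponent_sub_le (hd : 0 < d) :
    (d : ℝ) ^ (1 / dualExponent q d - (q⁻¹).toReal) ≤ Real.exp 1 := by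
  have hd₀ : (0 : ℝ) < d := by exact_mod_cast hd
  have : 0 ≤ Real.log d := Real.log_natCast_nonneg d
  rw [Real.rpow_def_of_pos hd₀, Real.exp_le_exp]
  rcases le_total q (ENNReal.ofReal (max 2 (Real.log d))) with hq | hq
  · rw [dualExponent, min_eq_left hq, ENNReal.toReal_inv, one_div, sub_self, mul_zero]
    exact zero_le_one
  · rw [dualExponent, min_eq_right hq, ENNReal.toReal_ofReal (by positivity), mul_sub,
      mul_one_div]
    have hdiv : Real.log d / max 2 (Real.log d) ≤ 1 :=
      div_le_one_of_le₀ (le_max_right _ _) (by positivity)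
    have hinv : 0 ≤ Real.log d * (q⁻¹).toReal := by positivity
    linarith

theorem rpow_two_div_dualExponent_le (hd : 0 < d) :
    (d : ℝ) ^ (2 / dualExponent q d) ≤ Real.exp 1 ^ 2 * (d : ℝ) ^ (2 * (q⁻¹).toReal) := by
  have hd₀ : (0 : ℝ) < d := by exact_mod_cast hd
  have hsplit : (d : ℝ) ^ (2 / dualExponent q d)
      = ((d : ℝ) ^ (1 / dualExponent q d - (q⁻¹).toReal)) ^ 2 * (d : ℝ) ^ (2 * (q⁻¹).toReal) := by
    rw [← Real.rpow_mul_natCast hd₀.le, ← Real.rpow_add hd₀]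
    congr 1
    push_cast
    ring
  rw [hsplit]
  gcongr
  exact rpow_one_div_dualExponent_sub_le hd

theorem le_of_holderConjugate_dualExponent (hpq : p.HolderConjugate q) (hr : r ≠ ⊤)
    (hconj : (dualExponent q d).HolderConjugate r.toReal) : p ≤ r := by
  have hr_conj := hconj.ennrealOfReal
  rw [ENNReal.ofReal_toReal hr] at hr_conj
  exact le_of_holderConjugate_of_le hr_conj hpq.symm ofReal_dualExponent_le

theorem pNorm_le_exp_one_mul (hp : 1 ≤ p) (hpq : p.HolderConjugate q) (hr : r ≠ ⊤)
    (hconj : (dualExponent q d).HolderConjugate r.toReal) (hd : 0 < d) (x : Vec d) :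
    pNorm p x ≤ Real.exp 1 * pNorm r x := by
  have hle := le_of_holderConjugate_dualExponent hpq hr hconj
  have hexp : 1 / p.toReal - 1 / r.toReal = 1 / dualExponent q d - (q⁻¹).toReal := by
    have hpq_sum := toReal_inv_add_toReal_inv hpq
    have hr_sum := hconj.inv_add_inv_eq_one
    rw [ENNReal.toReal_inv p] at hpq_sum
    simp only [one_div]
    linarith
  have hcard := pNorm_le_card_rpow_mul hp hle hr x
  rw [hexp] at hcard
  exact hcard.trans (mul_le_mul_of_nonneg_right (rpow_one_div_dualExponent_sub_le hd)
    (pNorm_nonneg (hp.trans hle) x))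

theorem minQLog_two_mul_rpow_le : minQLog 2 d * (d : ℝ) ^ (2 * ((2 : ℝ≥0∞)⁻¹).toReal) ≤ 2 * d := by
  have hmin : minQLog 2 d ≤ 2 := by
    simpa [minQLog] using ENNReal.toReal_mono (by simp)
      (min_le_left (2 : ℝ≥0∞) (ENNReal.ofReal (Real.log d)))
  have hexp : 2 * ((2 : ℝ≥0∞)⁻¹).toReal = 1 := by simp
  rw [hexp, Real.rpow_one]
  gcongr

theorem minQLog_top_mul_rpow :
    minQLog ⊤ d * (d : ℝ) ^ (2 * ((⊤ : ℝ≥0∞)⁻¹).toReal) = Real.log d := by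
  simp [minQLog, ENNReal.toReal_ofReal (Real.log_natCast_nonneg d)]

end Exponent

namespace AGMParams

/-- The constant of the complexity bounds, up to the factor `2` lost in bounding `min {q, ln d}`
for `q = 2`. -/
noncomputable def complexityConst : ℝ := 5000 * Real.exp 1 ^ 2 * varianceConst

theorem hundred_le_varianceConst : 100 ≤ varianceConst := by
  have : 1 ≤ Real.exp 16 := Real.one_le_exp (by norm_num)
  unfold varianceConst
  linarith

theorem le_complexityConst {c : ℝ} (hc : c ≤ 5000 * varianceConst) : c ≤ complexityConst := by
  have hexp : 1 ≤ Real.exp 1 ^ 2 := one_le_pow₀ (Real.one_le_exp zero_le_one)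
  have := varianceConst_pos
  unfold complexityConst
  nlinarith

theorem complexityConst_pos : 0 < complexityConst := by
  have := varianceConst_pos
  unfold complexityConst
  positivity

section Regimes

variable {d : ℕ} {ρ κ m M₂ R ε h n : ℝ}

theorem mul_sq_div_le (hρκ : ρ ≤ 3 * κ) (hκ : 0 < κ) : ρ * (R ^ 2 / κ) ≤ 3 * R ^ 2 := by
  rw [mul_div_assoc', div_le_iff₀ hκ]
  nlinarith [sq_nonneg R]

theorem accelerated_calls_le (hρ : 2 ≤ ρ) (hρκ : ρ ≤ 3 * κ)
    (hh : (d : ℝ) ^ (2 / ρ) ≤ Real.exp 1 ^ 2 * h) {N : ℕ}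
    (hN : (N : ℝ) ≤ 80 * (h * M₂ ^ 2 * R ^ 2 / ε ^ 2)) :
    4 * ρ * N + 512 * (varianceConst * ρ * (d : ℝ) ^ (2 / ρ) * M₂ ^ 2) * ρ * (R ^ 2 / κ) / ε ^ 2
      ≤ complexityConst * (κ * (h * M₂ ^ 2 * R ^ 2 / ε ^ 2)) := by
  have hκ : 0 < κ := by linarith
  have hvar := varianceConst_pos
  have hh₀ : 0 ≤ h := nonneg_of_mul_nonneg_right
    ((Real.rpow_nonneg d.cast_nonneg _).trans hh) (by positivity)
  set T := h * M₂ ^ 2 * R ^ 2 / ε ^ 2 with hT_def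
  have : 0 ≤ T := by positivity
  have hN' : 4 * ρ * N ≤ 960 * (κ * T) := by
    calc 4 * ρ * N ≤ 4 * (3 * κ) * (80 * T) := by gcongr
      _ = 960 * (κ * T) := by ring
  have hbatch : 512 * (varianceConst * ρ * (d : ℝ) ^ (2 / ρ) * M₂ ^ 2) * ρ * (R ^ 2 / κ) / ε ^ 2
      ≤ 4608 * Real.exp 1 ^ 2 * varianceConst * (κ * T) := by
    calc 512 * (varianceConst * ρ * (d : ℝ) ^ (2 / ρ) * M₂ ^ 2) * ρ * (R ^ 2 / κ) / ε ^ 2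
        = 512 * (varianceConst * ρ * (d : ℝ) ^ (2 / ρ) * M₂ ^ 2) * (ρ * (R ^ 2 / κ)) / ε ^ 2 := by
          ring
      _ ≤ 512 * (varianceConst * (3 * κ) * (Real.exp 1 ^ 2 * h) * M₂ ^ 2) * (3 * R ^ 2)
          / ε ^ 2 := by
        gcongr ?_ * (?_ * ?_ * ?_ * _) * ?_ / _
        exact mul_sq_div_le hρκ hκ
      _ = 4608 * Real.exp 1 ^ 2 * varianceConst * (κ * T) := by
        rw [hT_def]
        ring
  have hconst : 960 + 4608 * Real.exp 1 ^ 2 * varianceConst ≤ complexityConst := by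
    have hexp : 1 ≤ Real.exp 1 ^ 2 := one_le_pow₀ (Real.one_le_exp zero_le_one)
    unfold complexityConst
    nlinarith [hundred_le_varianceConst]
  calc _ ≤ (960 + 4608 * Real.exp 1 ^ 2 * varianceConst) * (κ * T) := by linarith
    _ ≤ complexityConst * (κ * T) := by gcongr

theorem exists_accelerated_bounds (hd : 0 < d) (hρ : 2 ≤ ρ) (hρκ : ρ ≤ 3 * κ) (hm : 0 < m)
    (hM₂ : 0 < M₂) (hε : 0 < ε) (hh : (d : ℝ) ^ (2 / ρ) ≤ Real.exp 1 ^ 2 * h) (hn₀ : 0 ≤ n)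
    (hn : √d * m * M₂ * R ^ 2 / ε ^ 2 ≤ n ^ 2) (hκ : κ * ε ^ 2 ≤ m * M₂ * R ^ 2)
    (hnh : n ≤ h * M₂ ^ 2 * R ^ 2 / ε ^ 2) :
    ∃ P : AGMParams,
      P.IsAccurate ρ (√d * (Real.exp 1 * m) / (ε / (2 * M₂))) (Real.exp 1 * m)
        (varianceConst * ρ * (d : ℝ) ^ (2 / ρ) * M₂ ^ 2) (R ^ 2 / κ) ε ∧
      (P.N : ℝ) ≤ complexityConst * n ∧
      (P.N : ℝ) * (P.B + P.B) ≤ complexityConst * (κ * (h * M₂ ^ 2 * R ^ 2 / ε ^ 2)) := by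
  have hκ₀ : 0 < κ := by linarith
  have hvar := varianceConst_pos
  have hsqrt : 1 ≤ √(d : ℝ) := Real.one_le_sqrt.2 (by exact_mod_cast hd)
  have hexp : 1 ≤ Real.exp 1 := Real.one_le_exp zero_le_one
  have hexp₃ : Real.exp 1 ≤ 3 := by linarith [Real.exp_one_lt_d9]
  set L := √d * (Real.exp 1 * m) / (ε / (2 * M₂)) with hL_def
  have hL : 0 < L := by positivity
  have hLε : L * R ^ 2 / ε = 2 * Real.exp 1 * (√d * m * M₂ * R ^ 2 / ε ^ 2) := by
    rw [hL_def]
    field_simp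
  have hLS : ε ≤ 64 * L * ρ * (R ^ 2 / κ) := by
    have hκL : κ ≤ L * R ^ 2 / ε := by
      rw [hLε]
      calc κ ≤ m * M₂ * R ^ 2 / ε ^ 2 := by rwa [le_div_iff₀ (by positivity)]
        _ ≤ (2 * Real.exp 1 * √d) * (m * M₂ * R ^ 2 / ε ^ 2) :=
          le_mul_of_one_le_left (by positivity) (by nlinarith)
        _ = _ := by ring
    rw [le_div_iff₀ hε, mul_comm, ← le_div_iff₀ hκ₀] at hκL
    calc ε ≤ L * R ^ 2 / κ := hκL
      _ ≤ (64 * ρ) * (L * R ^ 2 / κ) :=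
        le_mul_of_one_le_left (by positivity) (by linarith)
      _ = _ := by ring
  obtain ⟨P, hP, hN, hcalls⟩ := exists_isAccurate_accelerated (S := R ^ 2 / κ) hρ hL
    (by positivity : 0 ≤ varianceConst * ρ * (d : ℝ) ^ (2 / ρ) * M₂ ^ 2) (by positivity) hε hLS
    (Real.exp 1 * m)
  have hNn : (P.N : ℝ) ≤ 80 * n := by
    refine le_of_sq_le_sq (hN.trans ?_) (by positivity)
    calc 256 * L * ρ * (R ^ 2 / κ) / ε = 256 * L / ε * (ρ * (R ^ 2 / κ)) := by ring
      _ ≤ 256 * L / ε * (3 * R ^ 2) := by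
        gcongr ?_ * ?_
        exact mul_sq_div_le hρκ hκ₀
      _ = 1536 * Real.exp 1 * (√d * m * M₂ * R ^ 2 / ε ^ 2) := by linear_combination 768 * hLε
      _ ≤ 1536 * 3 * n ^ 2 := by gcongr
      _ ≤ (80 * n) ^ 2 := by nlinarith [sq_nonneg n]
  refine ⟨P, hP, hNn.trans ?_, hcalls.trans (accelerated_calls_le hρ hρκ hh (hNn.trans ?_))⟩
  · exact mul_le_mul_of_nonneg_right
      (le_complexityConst (by linarith [hundred_le_varianceConst])) hn₀
  · gcongr

theorem robust_budget_le {H : ℝ} (hρ : 0 < ρ) (hH : 1 ≤ H) (hm : 0 ≤ m) (hmM₂ : m ≤ M₂) :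
    varianceConst * ρ * H * M₂ ^ 2 / ρ / 2 + 2 * (Real.exp 1 * m) ^ 2
      ≤ varianceConst * H * M₂ ^ 2 := by
  have hvar := hundred_le_varianceConst
  have hexp : Real.exp 1 ≤ 3 := by linarith [Real.exp_one_lt_d9]
  have hLip : 2 * (Real.exp 1 * m) ^ 2 ≤ varianceConst * H * M₂ ^ 2 / 2 :=
    calc 2 * (Real.exp 1 * m) ^ 2 ≤ 2 * (3 * M₂) ^ 2 := by gcongr
      _ = 36 * 1 * M₂ ^ 2 / 2 := by ring
      _ ≤ varianceConst * H * M₂ ^ 2 / 2 := by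
        gcongr
        linarith
  have hcancel : varianceConst * ρ * H * M₂ ^ 2 / ρ / 2 = varianceConst * H * M₂ ^ 2 / 2 := by
    field_simp
  linarith

theorem robust_iterations_le (hρ : 0 ≤ ρ) (hκ : 0 < κ) (hρκ : ρ ≤ 3 * κ)
    (hh : (d : ℝ) ^ (2 / ρ) ≤ Real.exp 1 ^ 2 * h) (hT : 2 ≤ 3 * (h * M₂ ^ 2 * R ^ 2 / ε ^ 2)) :
    32 * (varianceConst * (d : ℝ) ^ (2 / ρ) * M₂ ^ 2) * ρ * (R ^ 2 / κ) / ε ^ 2 + 1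
      ≤ 98 * Real.exp 1 ^ 2 * varianceConst * (h * M₂ ^ 2 * R ^ 2 / ε ^ 2) := by
  have hvar := hundred_le_varianceConst
  have hexp : 1 ≤ Real.exp 1 ^ 2 := one_le_pow₀ (Real.one_le_exp zero_le_one)
  have hh₀ : 0 ≤ h := nonneg_of_mul_nonneg_right
    ((Real.rpow_nonneg d.cast_nonneg _).trans hh) (by positivity)
  set T := h * M₂ ^ 2 * R ^ 2 / ε ^ 2 with hT_def
  have hmain : 32 * (varianceConst * (d : ℝ) ^ (2 / ρ) * M₂ ^ 2) * ρ * (R ^ 2 / κ) / ε ^ 2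
      ≤ 96 * Real.exp 1 ^ 2 * varianceConst * T :=
    calc 32 * (varianceConst * (d : ℝ) ^ (2 / ρ) * M₂ ^ 2) * ρ * (R ^ 2 / κ) / ε ^ 2
        = 32 * (varianceConst * (d : ℝ) ^ (2 / ρ) * M₂ ^ 2) * (ρ * (R ^ 2 / κ)) / ε ^ 2 := by ring
      _ ≤ 32 * (varianceConst * (Real.exp 1 ^ 2 * h) * M₂ ^ 2) * (3 * R ^ 2) / ε ^ 2 := by
        gcongr ?_ * (?_ * ?_ * _) * ?_ / _
        exact mul_sq_div_le hρκ hκ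
      _ = 96 * Real.exp 1 ^ 2 * varianceConst * T := by
        rw [hT_def]
        ring
  have hone : 1 ≤ 2 * Real.exp 1 ^ 2 * varianceConst * T := by
    have : 1 ≤ Real.exp 1 ^ 2 * varianceConst := one_le_mul_of_one_le_of_one_le hexp (by linarith)
    nlinarith
  linarith

theorem exists_robust_bounds (hd : 0 < d) (hρ : 2 ≤ ρ) (hρκ : ρ ≤ 3 * κ) (hm : 0 < m)
    (hmM₂ : m ≤ M₂) (hε : 0 < ε) (hh₁ : 1 ≤ h)
    (hh : (d : ℝ) ^ (2 / ρ) ≤ Real.exp 1 ^ 2 * h) (hκ : κ * ε ^ 2 ≤ m * M₂ * R ^ 2)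
    (hhn : h * M₂ ^ 2 * R ^ 2 / ε ^ 2 ≤ n) (L₀ : ℝ) :
    ∃ P : AGMParams,
      P.IsAccurate ρ L₀ (Real.exp 1 * m)
        (varianceConst * ρ * (d : ℝ) ^ (2 / ρ) * M₂ ^ 2) (R ^ 2 / κ) ε ∧
      (P.N : ℝ) ≤ complexityConst * n ∧
      (P.N : ℝ) * (P.B + P.B) ≤ complexityConst * (κ * (h * M₂ ^ 2 * R ^ 2 / ε ^ 2)) := by
  have hκ₀ : 0 < κ := by linarith
  have hM₂ : 0 < M₂ := hm.trans_le hmM₂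
  have hR : R ≠ 0 := by
    rintro rfl
    have : 0 < κ * ε ^ 2 := by positivity
    linarith
  have hvar := varianceConst_pos
  have hdρ : 1 ≤ (d : ℝ) ^ (2 / ρ) := Real.one_le_rpow (by exact_mod_cast hd) (by positivity)
  have hbudget : varianceConst * ρ * (d : ℝ) ^ (2 / ρ) * M₂ ^ 2 / ρ / 2
      + 2 * (Real.exp 1 * m) ^ 2 ≤ varianceConst * (d : ℝ) ^ (2 / ρ) * M₂ ^ 2 :=
    robust_budget_le (by linarith) hdρ hm.le hmM₂
  obtain ⟨P, hP, hN, hcalls⟩ := exists_isAccurate_robust (S := R ^ 2 / κ) hρ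
    (by positivity : 0 < varianceConst * (d : ℝ) ^ (2 / ρ) * M₂ ^ 2)
    (by positivity : 0 ≤ varianceConst * ρ * (d : ℝ) ^ (2 / ρ) * M₂ ^ 2) hbudget hε
    (by positivity) L₀
  set T := h * M₂ ^ 2 * R ^ 2 / ε ^ 2 with hT_def
  have hκT : κ ≤ T := by
    rw [hT_def, le_div_iff₀ (by positivity)]
    calc κ * ε ^ 2 ≤ m * M₂ * R ^ 2 := hκ
      _ ≤ M₂ * M₂ * R ^ 2 := by gcongr
      _ = M₂ ^ 2 * R ^ 2 := by ring
      _ ≤ h * (M₂ ^ 2 * R ^ 2) := le_mul_of_one_le_left (by positivity) hh₁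
      _ = h * M₂ ^ 2 * R ^ 2 := by ring
  have hNT : (P.N : ℝ) ≤ 98 * Real.exp 1 ^ 2 * varianceConst * T :=
    hN.trans (robust_iterations_le (by linarith) hκ₀ hρκ hh (by linarith))
  refine ⟨P, hP, ?_, hcalls.trans ?_⟩
  · calc (P.N : ℝ) ≤ 98 * Real.exp 1 ^ 2 * varianceConst * T := hNT
      _ ≤ complexityConst * n := by
        unfold complexityConst
        gcongr
        norm_num
  · calc 4 * ρ * (P.N : ℝ)
        ≤ 4 * (3 * κ) * (98 * Real.exp 1 ^ 2 * varianceConst * T) := by gcongr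
      _ ≤ complexityConst * (κ * T) := by
        unfold complexityConst
        nlinarith

end Regimes

end AGMParams

namespace IsLipschitzProblem

variable {d : ℕ} {p q r : ℝ≥0∞} {M M₂ γ R ε : ℝ} {Q : Set (Vec d)} {f : Vec d → ℝ}
  {x₀ xs : Vec d}

theorem of_holderConjugate_dualExponent (h : IsLipschitzProblem p M M₂ γ Q f) (hd : 0 < d)
    (hp : 1 ≤ p) (hpq : p.HolderConjugate q) (hr : 1 ≤ r) (hr₂ : r ≤ 2)
    (hconj : (dualExponent q d).HolderConjugate r.toReal) (hM : 0 ≤ M) (hM₂ : 0 ≤ M₂) :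
    IsLipschitzProblem r (Real.exp 1 * min M M₂) M₂ γ Q f where
  isClosed := h.isClosed
  convex := h.convex
  convexOn := h.convexOn
  abs_sub_le_norm := h.abs_sub_le_norm
  abs_sub_le_pNorm x hx y hy := by
    have hr_top : r ≠ ⊤ := ne_top_of_le_ne_top (by simp) hr₂
    have hp_le : |f y - f x| ≤ M * (Real.exp 1 * pNorm r (y - x)) :=
      (h.abs_sub_le_pNorm x hx y hy).trans
        (mul_le_mul_of_nonneg_left (pNorm_le_exp_one_mul hp hpq hr_top hconj hd _) hM)
    have h₂_le : |f y - f x| ≤ M₂ * (Real.exp 1 * pNorm r (y - x)) := by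
      refine (h.abs_sub_le_pNorm_two x hx y hy).trans (mul_le_mul_of_nonneg_left ?_ hM₂)
      exact (pNorm_antitone hr hr₂ (by simp) _).trans
        (le_mul_of_one_le_left (pNorm_nonneg hr _) (Real.one_le_exp zero_le_one))
    calc |f y - f x| ≤ min M M₂ * (Real.exp 1 * pNorm r (y - x)) := by
          rw [min_mul_of_nonneg _ _ (mul_nonneg (Real.exp_pos 1).le (pNorm_nonneg hr _))]
          exact le_min hp_le h₂_le
      _ = Real.exp 1 * min M M₂ * pNorm r (y - x) := by ring

theorem sub_le_min_mul_pNorm (h : IsLipschitzProblem p M M₂ γ Q f) (hp : 1 ≤ p) (hp₂ : p ≤ 2)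
    (hM₂ : 0 ≤ M₂) (hx₀ : x₀ ∈ Q) (hxs : xs ∈ Q) :
    f x₀ - f xs ≤ min M M₂ * pNorm p (x₀ - xs) := by
  have hx₀' := Metric.self_subset_cthickening (δ := γ) Q hx₀
  have hxs' := Metric.self_subset_cthickening (δ := γ) Q hxs
  rw [min_mul_of_nonneg _ _ (pNorm_nonneg hp _)]
  refine (le_abs_self _).trans (le_min (h.abs_sub_le_pNorm xs hxs' x₀ hx₀') ?_)
  exact (h.abs_sub_le_pNorm_two xs hxs' x₀ hx₀').trans
    (mul_le_mul_of_nonneg_left (pNorm_antitone hp hp₂ (by simp) _) hM₂)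

theorem sub_le_of_le_mul_sq (h : IsLipschitzProblem p M M₂ γ Q f) (hp : 1 ≤ p) (hp₂ : p ≤ 2)
    (hM : 0 ≤ M) (hM₂ : 0 ≤ M₂) (hε : 0 ≤ ε) (hx₀ : x₀ ∈ Q) (hxs : xs ∈ Q) {κ : ℝ} (hκ : 0 < κ)
    (hR : pNorm p (x₀ - xs) * √κ ≤ R) (hεR : min M M₂ * M₂ * R ^ 2 ≤ κ * ε ^ 2) :
    f x₀ - f xs ≤ ε := by
  refine (h.sub_le_min_mul_pNorm hp hp₂ hM₂ hx₀ hxs).trans (le_of_sq_le_sq ?_ hε)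
  have hnorm := pNorm_nonneg hp (x₀ - xs)
  have : 0 ≤ min M M₂ := le_min hM hM₂
  refine le_of_mul_le_mul_left ?_ hκ
  calc κ * (min M M₂ * pNorm p (x₀ - xs)) ^ 2
      = min M M₂ * min M M₂ * (pNorm p (x₀ - xs) * √κ) ^ 2 := by
        rw [mul_pow _ (√κ), Real.sq_sqrt hκ.le]
        ring
    _ ≤ min M M₂ * M₂ * R ^ 2 := by
        gcongr
        exact min_le_right M M₂
    _ ≤ κ * ε ^ 2 := hεR

end IsLipschitzProblem

namespace AGMParams

/-- The method with parameters `P` solves every problem of the class in expectation with accuracy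
`ε`, started at scaled distance at most `R` from the comparison point. -/
def Solves (P : AGMParams) (d : ℕ) (p q : ℝ≥0∞) (M M₂ R ε : ℝ) : Prop :=
  ∀ ⦃Q : Set (Vec d)⦄ ⦃f : Vec d → ℝ⦄ ⦃x₀ xs : Vec d⦄,
    IsLipschitzProblem p M M₂ (ε / (2 * M₂)) Q f → x₀ ∈ Q → xs ∈ Q →
    pNorm p (x₀ - xs) * √(minQLog q d) ≤ R →
    ∫ e, f ((fgm P (ε / (2 * M₂)) Q x₀ e).run f) ∂directionLaw d P.N P.B - f xs ≤ ε

variable {d : ℕ} [NeZero d] {p q : ℝ≥0∞} {M M₂ R ε : ℝ}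

theorem IsAccurate.solves {P : AGMParams}
    (hP : P.IsAccurate (dualExponent q d)
      (√d * (Real.exp 1 * min M M₂) / (ε / (2 * M₂))) (Real.exp 1 * min M M₂)
      (varianceConst * dualExponent q d * (d : ℝ) ^ (2 / dualExponent q d) * M₂ ^ 2)
      (R ^ 2 / minQLog q d) ε)
    (hp : 1 ≤ p) (hpq : p.HolderConjugate q) (hq : 2 ≤ q) (hκ : 0 < minQLog q d)
    (hM : 0 ≤ M) (hM₂ : 0 < M₂) (hε : 0 < ε) :
    P.Solves d p q M M₂ R ε := by
  intro Q f x₀ xs hprob hx₀ hxs hdist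
  have hr := P.one_lt_r.le
  have hprob_r := hprob.of_holderConjugate_dualExponent (NeZero.pos d) hp hpq hr P.r_le_two
    hP.holderConjugate hM hM₂.le
  refine integral_run_fgm_sub_le hprob_r hP (two_le_dualExponent hq) hε
    (mul_nonneg (Real.exp_pos 1).le (le_min hM hM₂.le)) hM₂ hx₀ hxs ?_
  have hnorm := pNorm_nonneg hr (x₀ - xs)
  have hpr := le_of_holderConjugate_dualExponent hpq P.r_ne_top hP.holderConjugate
  rw [le_div_iff₀ hκ, ← Real.sq_sqrt hκ.le, ← mul_pow]
  gcongr
  exact (mul_le_mul_of_nonneg_right (pNorm_antitone hp hpr P.r_ne_top _)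
    (Real.sqrt_nonneg _)).trans hdist

theorem solves_of_N_eq_zero {P : AGMParams} (hN : P.N = 0) (hp : 1 ≤ p) (hp₂ : p ≤ 2)
    (hM : 0 ≤ M) (hM₂ : 0 ≤ M₂) (hε : 0 ≤ ε) (hκ : 0 < minQLog q d)
    (hεR : min M M₂ * M₂ * R ^ 2 ≤ minQLog q d * ε ^ 2) :
    P.Solves d p q M M₂ R ε := by
  intro Q f x₀ xs hprob hx₀ hxs hdist
  have hrun (e : Fin P.N → Fin P.B → UnitSphere d) :
      (fgm P (ε / (2 * M₂)) Q x₀ e).run f = x₀ := by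
    obtain ⟨N, B, a, β, r, hB, ha, hβ, hr, hr₂⟩ := P
    subst hN
    rfl
  simp only [hrun, integral_const, probReal_univ, one_smul]
  exact hprob.sub_le_of_le_mul_sq hp hp₂ hM hM₂ hε hx₀ hxs hκ hdist hεR

theorem exists_solves_of_le (hd : 2 ≤ d) (hp : 1 ≤ p) (hpq : p.HolderConjugate q) (hq : 2 ≤ q)
    (hM : 0 < M) (hM₂ : 0 < M₂) (hR : 0 ≤ R) (hε : 0 < ε)
    (hεR : minQLog q d * ε ^ 2 ≤ min M M₂ * M₂ * R ^ 2) :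
    ∃ P : AGMParams, P.Solves d p q M M₂ R ε ∧
      (P.N : ℝ) ≤ complexityConst * ((d : ℝ) ^ (1 / 4 : ℝ) * √(M * M₂) * R / ε) ∧
      (P.N : ℝ) * (P.B + P.B) ≤ complexityConst *
        (minQLog q d * ((d : ℝ) ^ (2 * (q⁻¹).toReal) * M₂ ^ 2 * R ^ 2 / ε ^ 2)) := by
  have hρ : 2 ≤ dualExponent q d := two_le_dualExponent hq
  have hρκ := dualExponent_le_three_mul_minQLog (q := q) hd
  have hm : 0 < min M M₂ := lt_min hM hM₂
  have hh₁ : 1 ≤ (d : ℝ) ^ (2 * (q⁻¹).toReal) :=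
    Real.one_le_rpow (by exact_mod_cast NeZero.one_le) (by positivity)
  have hh := rpow_two_div_dualExponent_le (q := q) (NeZero.pos d)
  have hn : √d * min M M₂ * M₂ * R ^ 2 / ε ^ 2
      ≤ ((d : ℝ) ^ (1 / 4 : ℝ) * √(M * M₂) * R / ε) ^ 2 := by
    have hsqrt : ((d : ℝ) ^ (1 / 4 : ℝ)) ^ 2 = √d := by
      rw [← Real.rpow_mul_natCast d.cast_nonneg, Real.sqrt_eq_rpow]
      norm_num
    rw [div_pow, mul_pow, mul_pow, hsqrt, Real.sq_sqrt (by positivity), ← mul_assoc]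
    gcongr
    exact min_le_left M M₂
  rcases le_total ((d : ℝ) ^ (1 / 4 : ℝ) * √(M * M₂) * R / ε)
    ((d : ℝ) ^ (2 * (q⁻¹).toReal) * M₂ ^ 2 * R ^ 2 / ε ^ 2) with hle | hle
  · obtain ⟨P, hP, hN, hcalls⟩ := exists_accelerated_bounds (NeZero.pos d) hρ hρκ hm hM₂ hε hh
      (by positivity) hn hεR hle
    exact ⟨P, hP.solves hp hpq hq (by linarith) hM.le hM₂ hε, hN, hcalls⟩
  · obtain ⟨P, hP, hN, hcalls⟩ := exists_robust_bounds (NeZero.pos d) hρ hρκ hm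
      (min_le_right M M₂) hε hh₁ hh hεR hle (√d * (Real.exp 1 * min M M₂) / (ε / (2 * M₂)))
    exact ⟨P, hP.solves hp hpq hq (by linarith) hM.le hM₂ hε, hN, hcalls⟩

theorem exists_solves (hd : 2 ≤ d) (hp : 1 ≤ p) (hp₂ : p ≤ 2) (hpq : p.HolderConjugate q)
    (hM : 0 < M) (hM₂ : 0 < M₂) (hR : 0 ≤ R) (hε : 0 < ε) :
    ∃ P : AGMParams, P.Solves d p q M M₂ R ε ∧
      (P.N : ℝ) ≤ complexityConst * ((d : ℝ) ^ (1 / 4 : ℝ) * √(M * M₂) * R / ε) ∧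
      (P.N : ℝ) * (P.B + P.B) ≤ complexityConst *
        (minQLog q d * ((d : ℝ) ^ (2 * (q⁻¹).toReal) * M₂ ^ 2 * R ^ 2 / ε ^ 2)) := by
  have hq : 2 ≤ q := le_of_holderConjugate_of_le hpq ENNReal.HolderConjugate.instTwoTwo hp₂
  rcases le_total (minQLog q d * ε ^ 2) (min M M₂ * M₂ * R ^ 2) with hεR | hεR
  · exact exists_solves_of_le hd hp hpq hq hM hM₂ hR hε hεR
  · have hκ : 0 < minQLog q d := by
      linarith [two_le_dualExponent (d := d) hq, dualExponent_le_three_mul_minQLog (q := q) hd]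
    have := complexityConst_pos
    have hN : (robust 0 1 2 1 one_pos le_rfl one_pos).N = 0 := rfl
    refine ⟨robust 0 1 2 1 one_pos le_rfl one_pos,
      solves_of_N_eq_zero hN hp hp₂ hM.le hM₂.le hε.le hκ hεR, ?_, ?_⟩
    · rw [hN, Nat.cast_zero]
      positivity
    · rw [hN, Nat.cast_zero, zero_mul]
      positivity

end AGMParams

theorem theorem3_general :
    ∃ C : ℝ, 0 < C ∧
      ∀ (d : ℕ) (p q : ℝ≥0∞) (M M₂ R ε : ℝ),
        2 ≤ d → 1 ≤ p → p ≤ 2 → 1 / p + 1 / q = 1 → 0 < M → 0 < M₂ → 0 ≤ R → 0 < ε →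
        ∃ P : AGMParams,
          ∀ (Q : Set (Vec d)) (f : Vec d → ℝ) (x₀ xs : Vec d),
            IsLipschitzProblem p M M₂ (ε / (2 * M₂)) Q f → x₀ ∈ Q → xs ∈ Q →
            pNorm p (x₀ - xs) * √(minQLog q d) ≤ R →
            Integrable (fun e => f ((fgm P (ε / (2 * M₂)) Q x₀ e).run f))
                (directionLaw d P.N P.B) ∧
              ∫ e, f ((fgm P (ε / (2 * M₂)) Q x₀ e).run f) ∂(directionLaw d P.N P.B)
                - f xs ≤ ε ∧
              ∀ e : Fin P.N → Fin P.B → UnitSphere d,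
                ((fgm P (ε / (2 * M₂)) Q x₀ e).iterations f : ℝ)
                    ≤ C * ((d : ℝ) ^ (1 / 4 : ℝ) * √(M * M₂) * R / ε) ∧
                ((fgm P (ε / (2 * M₂)) Q x₀ e).oracleCalls f : ℝ)
                    ≤ C * (minQLog q d * (d : ℝ) ^ (2 * (q⁻¹).toReal) * M₂ ^ 2 * R ^ 2 / ε ^ 2) ∧
                (p = 2 → ((fgm P (ε / (2 * M₂)) Q x₀ e).oracleCalls f : ℝ)
                    ≤ C * (d * M₂ ^ 2 * R ^ 2 / ε ^ 2)) ∧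
                (p = 1 → ((fgm P (ε / (2 * M₂)) Q x₀ e).oracleCalls f : ℝ)
                    ≤ C * (Real.log d * M₂ ^ 2 * R ^ 2 / ε ^ 2)) := by
  refine ⟨2 * AGMParams.complexityConst, mul_pos two_pos AGMParams.complexityConst_pos, ?_⟩
  intro d p q M M₂ R ε hd hp hp₂ hpq hM hM₂ hR hε
  have : NeZero d := ⟨by omega⟩
  have hpq : p.HolderConjugate q :=
    ENNReal.holderConjugate_iff.2 (by simpa only [one_div] using hpq)
  obtain ⟨P, hP, hN, hcalls⟩ := AGMParams.exists_solves hd hp hp₂ hpq hM hM₂ hR hε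
  refine ⟨P, fun Q f x₀ xs hprob hx₀ hxs hdist =>
    ⟨P.integrable_run_fgm hprob hM₂.le (by positivity) hx₀,
      hP hprob hx₀ hxs hdist, fun e => ?_⟩⟩
  have hlog : 0 ≤ Real.log d := Real.log_natCast_nonneg d
  have hκ : 0 ≤ minQLog q d := ENNReal.toReal_nonneg
  rw [fgm, P.iterations_fgmLoop P.N e 0 x₀ 0, P.oracleCalls_fgmLoop P.N e 0 x₀ 0]
  push_cast
  have hcalls_le {b : ℝ} (hb : minQLog q d * (d : ℝ) ^ (2 * (q⁻¹).toReal) ≤ 2 * b) :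
      (P.N : ℝ) * (P.B + P.B)
        ≤ 2 * AGMParams.complexityConst * (b * M₂ ^ 2 * R ^ 2 / ε ^ 2) := by
    have := AGMParams.complexityConst_pos
    calc _ ≤ _ := hcalls
      _ = AGMParams.complexityConst * (minQLog q d * (d : ℝ) ^ (2 * (q⁻¹).toReal)) *
          (M₂ ^ 2 * R ^ 2 / ε ^ 2) := by ring
      _ ≤ AGMParams.complexityConst * (2 * b) * (M₂ ^ 2 * R ^ 2 / ε ^ 2) := by gcongr
      _ = _ := by ring
  refine ⟨?_, hcalls_le (le_mul_of_one_le_left (by positivity) one_le_two), ?_, ?_⟩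
  · nlinarith [(Nat.cast_nonneg P.N : (0 : ℝ) ≤ P.N)]
  · rintro rfl
    obtain rfl := ENNReal.HolderConjugate.unique 2 q 2
    exact hcalls_le minQLog_two_mul_rpow_le
  · rintro rfl
    obtain rfl := ENNReal.HolderConjugate.unique 1 q ⊤
    exact hcalls_le (minQLog_top_mul_rpow.trans_le (by linarith))

theorem theorem3 :
    ∃ C : ℝ, 0 < C ∧
      ∀ (d : ℕ) (p q : ℝ≥0∞) (M M₂ R ε : ℝ),
        2 ≤ d → 1 ≤ p → p ≤ 2 → 1 / p + 1 / q = 1 → 0 < M → 0 < M₂ → 0 ≤ R → 0 < ε →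
        ∃ P : AGMParams,
          ∀ (Q : Set (Vec d)) (f : Vec d → ℝ) (x₀ xstar : Vec d),
            IsClosed Q → Convex ℝ Q → x₀ ∈ Q →
            ConvexOn ℝ (Metric.cthickening (ε / (2 * M₂)) Q) f →
            (∀ x ∈ Metric.cthickening (ε / (2 * M₂)) Q,
              ∀ y ∈ Metric.cthickening (ε / (2 * M₂)) Q, |f y - f x| ≤ M * pNorm p (y - x)) →
            (∀ x ∈ Metric.cthickening (ε / (2 * M₂)) Q,
              ∀ y ∈ Metric.cthickening (ε / (2 * M₂)) Q, |f y - f x| ≤ M₂ * ‖y - x‖) →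
            xstar ∈ Q → IsMinOn f Q xstar →
            pNorm p (x₀ - xstar) * √(minQLog q d) ≤ R →
            -- the output is an `ε`-solution in expectation
            Integrable (fun e => f ((fgm P (ε / (2 * M₂)) Q x₀ e).run f))
                (directionLaw d P.N P.B) ∧
              ∫ e, f ((fgm P (ε / (2 * M₂)) Q x₀ e).run f) ∂(directionLaw d P.N P.B)
                - f xstar ≤ ε ∧
              ∀ e : Fin P.N → Fin P.B → UnitSphere d,
                -- successive iterations
                ((fgm P (ε / (2 * M₂)) Q x₀ e).iterations f : ℝ)
                    ≤ C * ((d : ℝ) ^ (1 / 4 : ℝ) * √(M * M₂) * R / ε) ∧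
                -- zeroth-order oracle calls
                ((fgm P (ε / (2 * M₂)) Q x₀ e).oracleCalls f : ℝ)
                    ≤ C * (minQLog q d * (d : ℝ) ^ (2 * (q⁻¹).toReal) * M₂ ^ 2 * R ^ 2 / ε ^ 2) ∧
                (p = 2 → ((fgm P (ε / (2 * M₂)) Q x₀ e).oracleCalls f : ℝ)
                    ≤ C * (d * M₂ ^ 2 * R ^ 2 / ε ^ 2)) ∧
                (p = 1 → ((fgm P (ε / (2 * M₂)) Q x₀ e).oracleCalls f : ℝ)
                    ≤ C * (Real.log d * M₂ ^ 2 * R ^ 2 / ε ^ 2)) := by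
  obtain ⟨C, hC, h⟩ := theorem3_general
  refine ⟨C, hC, fun d p q M M₂ R ε hd hp hp₂ hpq hM hM₂ hR hε => ?_⟩
  obtain ⟨P, hP⟩ := h d p q M M₂ R ε hd hp hp₂ hpq hM hM₂ hR hε
  exact ⟨P, fun Q f x₀ xs hQ hQc hx₀ hf hfM hfM₂ hxs _ hdist =>
    hP Q f x₀ xs ⟨hQ, hQc, hf, hfM, hfM₂⟩ hx₀ hxs hdist⟩
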